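/- Let $K$ be an algebraically closed field of characteristic $p>0$. Let $M\subset\mathbb Z^d$ be a positive normal affine monoid with $\operatorname{gp}(M)=\mathbb Z^d$: $M$ is a finitely generated submonoid of $\mathbb Z^d$ that generates $\mathbb Z^d$ as a group, $0$ is its only invertible element, and $x\in\mathbb Z^d$, $nx\in M$ with $n\ge 1$ imply $x\in M$. Let $\mathbb R_+M=\{x\in\mathbb R^d:\sigma_i(x)\ge 0,\ i=1,\dots,s\}$ be the irredundant representation of the cone generated by $M$ with primitive integral linear forms $\sigma_i$ (forms with integral coprime coefficients), and $\sigma=(\sigma_1,\dots,\sigma_s)$. Let $R=K[M]$, let $\mathfrak m$ be the ideal of $R$ generated by the monomials different from $1$, and for $n\ge 1$ let $R^{(n)}=K[\frac1nM]\supset R$. For $y\in\mathbb R^d$ let $\mathcal C(y)=K\cdot(\mathbb Z^d\cap(y+\mathbb R_+M))\subset K[\mathbb Z^d]$, an $R$-module. Let $\Gamma$ be the cell decomposition of $\mathbb R^d$ by the hyperplanes $\sigma_i(x)=z$, $1\le i\le s$, $z\in\mathbb Z$. Choose one representative $\gamma$ of each orbit of open $d$-cells of $\Gamma$ under translation by $\mathbb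 Z^d$ (equivalently, of each open $d$-cell of the induced decomposition of the torus $\mathbb R^d/\mathbb Z^d$); there are only finitely many orbits, and $\sum_\gamma$ denotes the sum over the chosen representatives. Let $\lceil\gamma\rceil=\{x\in\mathbb R^d:\lceil\sigma(x)\rceil=\lceil\sigma(y)\rceil\}$ with $y\in\gamma$, and let $\mathcal C_\gamma$ be the common value of $\mathcal C(x)$, $x\in\lceil\gamma\rceil$. Let $v_\gamma(n)$ be the number of $c\in(\frac1n\mathbb Z^d)/\mathbb Z^d$ such that $I_c\cong\mathcal C_\gamma$ as $R$-modules, where $R^{(n)}=\bigoplus_c I_c$ and $I_c=R^{(n)}\cap K\cdot c$ is the $K$-span of the monomials in $R^{(n)}$ with exponent in the residue class $c$. Let $\mu_A(N)$ be the minimal number of generators of an $A$-module $N$, let $I^{[q]}$ be the ideal generated by the $q$-th powers of the elements of an ideal $I$, and let $\operatorname{vol}$ be Lebesgue measure on $\mathbb R^d$. (a) For all $e\ge 1$, $$\dim_K R/\mathfrak m^{[p^e]}=\mu_R(R^{(p^e)})=\sum_\gamma\mu_R(\mathcal C_\gamma)\,v_\gamma(p^e).$$ There is a quasi-polynomial $q_{HK}$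 with rational coefficients and of degree $d$ such that $q_{HK}(n)=\sum_\gamma\mu_R(\mathcal C_\gamma)v_\gamma(n)$ for all integers $n\ge 1$. Its leading (degree $d$) coefficient is constant and equal to $$e_{HK}(R)=\lim_{e\to\infty}\frac{\dim_K R/\mathfrak m^{[p^e]}}{p^{de}}=\sum_\gamma\mu_R(\mathcal C_\gamma)\operatorname{vol}(\gamma)\in\mathbb Q,$$ and, if $d\ge 1$, its coefficient of degree $d-1$ is constant and rational. (b) Let $R$ be graded by a monoid homomorphism $\deg:M\to\mathbb Z_{\ge0}$ with $\deg x>0$ for $x\ne0$ (each monomial $x$ being homogeneous of degree $\deg x$). Let $S\subset R$ be a graded $K$-subalgebra such that $R$ is a finite $S$-module and $R$ is the normalization of $S$ (that is, $S$ and $R$ have the same fraction field and $R$ is the integral closure of $S$ in it), and let $\mathfrak m_S$ be the ideal of $S$ generated by its homogeneous elements of positive degree. Then all $S/\mathfrak m_S^{[p^e]}$ are finite-dimensional over $K$ and $$e_{HK}(S)=\lim_{e\to\infty}\frac{\dim_K S/\mathfrak m_S^{[p^e]}}{p^{de}}=\sum_\gamma\operatorname{vol}(\gamma)\,\mu_S(\mathcal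 C_\gamma)\in\mathbb Q.$$ -/

import Mathlib

open MeasureTheory Filter Topology Polynomial

noncomputable section

namespace ConicHK

/-! ### Lattices, monoids and cones -/

/-- The inclusion `ℤ^d → ℝ^d`. -/
def castHom (d : ℕ) : (Fin d → ℤ) →+ (Fin d → ℝ) :=
  (Int.castAddHom ℝ).compLeft (Fin d)

/-- `M ⊆ ℤ^d` is a positive normal affine monoid with `gp(M) = ℤ^d` (so that its rank is `d`). -/
structure IsPositiveNormalAffine {d : ℕ} (M : AddSubmonoid (Fin d → ℤ)) : Prop where
  /-- affine: finitely generated (and contained in a lattice) -/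
  fg : M.FG
  /-- `gp(M) = ℤ^d` -/
  gp : AddSubgroup.closure (M : Set (Fin d → ℤ)) = ⊤
  /-- normal: `x ∈ gp(M)` and `n x ∈ M` with `n ≥ 1` imply `x ∈ M` -/
  normal : ∀ x : Fin d → ℤ, ∀ n : ℕ, 1 ≤ n → n • x ∈ M → x ∈ M
  /-- positive: `0` is the only invertible element -/
  positive : ∀ x ∈ M, -x ∈ M → x = 0

/-- The cone `ℝ_+ M`: all linear combinations of elements of `M` with nonnegative coefficients. -/
def realCone {d : ℕ} (M : AddSubmonoid (Fin d → ℤ)) : PointedCone ℝ (Fin d → ℝ) :=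
  PointedCone.hull ℝ (castHom d '' (M : Set (Fin d → ℤ)))

/-- The linear form on `ℝ^d` with integral coefficient vector `a`. -/
def evalForm {d : ℕ} (a : Fin d → ℤ) (x : Fin d → ℝ) : ℝ := ∑ j, (a j : ℝ) * x j

/-- `σ_1, …, σ_s` are the support forms of `ℝ_+ M`: the primitive integral forms in the irredundant
representation of the cone as an intersection of half-spaces. -/
structure IsSupportForms {d s : ℕ} (M : AddSubmonoid (Fin d → ℤ)) (σ : Fin s → Fin d → ℤ) :
    Prop where
  /-- `ℝ_+ M = {x : σ_i(x) ≥ 0 for all i}` -/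
  mem_iff : ∀ x : Fin d → ℝ, x ∈ realCone M ↔ ∀ i, 0 ≤ evalForm (σ i) x
  /-- no half-space can be omitted -/
  irredundant : ∀ i, ∃ x : Fin d → ℝ, evalForm (σ i) x < 0 ∧ ∀ j, j ≠ i → 0 ≤ evalForm (σ j) x
  /-- the values of `σ_i` on the canonical basis are coprime -/
  primitive : ∀ i, Finset.univ.gcd (σ i) = 1

/-! ### The cell decomposition -/

/-- `γ` is an open `d`-cell of the decomposition `Γ` of `ℝ^d` by the hyperplanes
`σ_i(x) = z`, `z ∈ ℤ`. -/
def IsOpenCell {d s : ℕ} (σ : Fin s → Fin d → ℤ) (γ : Set (Fin d → ℝ)) : Prop :=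
  γ.Nonempty ∧ ∃ z : Fin s → ℤ,
    γ = {x | ∀ i, (z i : ℝ) - 1 < evalForm (σ i) x ∧ evalForm (σ i) x < z i}

/-- The upper closure `⌈γ⌉ = {x : ⌈σ(x)⌉ = ⌈σ(y)⌉}`, `y ∈ γ`. -/
def cellUpperClosure {d s : ℕ} (σ : Fin s → Fin d → ℤ) (γ : Set (Fin d → ℝ)) : Set (Fin d → ℝ) :=
  {x | ∀ y ∈ γ, ∀ i, ⌈evalForm (σ i) x⌉ = ⌈evalForm (σ i) y⌉}

/-- `T` contains exactly one representative `γ` of each open `d`-cell of the decomposition induced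
by `Γ` on the torus `ℝ^d/ℤ^d`, that is, of each orbit of open `d`-cells of `Γ` under translation
by `ℤ^d`. -/
structure IsCellRepresentatives {d s : ℕ} (σ : Fin s → Fin d → ℤ) (T : Set (Set (Fin d → ℝ))) :
    Prop where
  isOpenCell : ∀ γ ∈ T, IsOpenCell σ γ
  existsUnique : ∀ γ', IsOpenCell σ γ' →
    ∃! γ, γ ∈ T ∧ ∃ z : Fin d → ℤ, γ' = (fun x => castHom d z + x) '' γ

/-! ### Monoid algebras and conic ideals -/

/-- The monoid `(1/n) M ⊆ ℝ^d` (for `n ≥ 1`). -/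
def rootMonoid {d : ℕ} (M : AddSubmonoid (Fin d → ℤ)) (n : ℕ) : AddSubmonoid (Fin d → ℝ) :=
  (M.map (castHom d)).comap (nsmulAddMonoidHom n)

/-- The inclusion `M → (1/n) M`. -/
def toRoot {d : ℕ} (M : AddSubmonoid (Fin d → ℤ)) (n : ℕ) : M →+ rootMonoid M n :=
  ((castHom d).comp M.subtype).codRestrict (rootMonoid M n) fun x =>
    ⟨n • (x : Fin d → ℤ), M.nsmul_mem x.2 n, map_nsmul (castHom d) n (x : Fin d → ℤ)⟩

variable (K : Type*) [Field K]

/-- The inclusion `K[M] → K[ℤ^d]` as an algebra structure. -/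
instance algebraGroup {d : ℕ} (M : AddSubmonoid (Fin d → ℤ)) :
    Algebra (AddMonoidAlgebra K M) (AddMonoidAlgebra K (Fin d → ℤ)) :=
  (AddMonoidAlgebra.mapDomainRingHom K M.subtype).toAlgebra

/-- The inclusion `R = K[M] → R^(n) = K[(1/n) M]` as an algebra structure. -/
instance algebraRoot {d : ℕ} (M : AddSubmonoid (Fin d → ℤ)) (n : ℕ) :
    Algebra (AddMonoidAlgebra K M) (AddMonoidAlgebra K (rootMonoid M n)) :=
  (AddMonoidAlgebra.mapDomainRingHom K (toRoot M n)).toAlgebra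

/-- The elements of a monoid algebra supported in a set of exponents stable under translation by
the image of `φ : N → P`, as a module over `K[N]`. -/
def supportedSubmodule {N P : Type*} [AddCommMonoid N] [AddCommMonoid P]
    [Algebra (AddMonoidAlgebra K N) (AddMonoidAlgebra K P)] (φ : N →+ P)
    (hφ : algebraMap (AddMonoidAlgebra K N) (AddMonoidAlgebra K P) =
      AddMonoidAlgebra.mapDomainRingHom K φ)
    (A : Set P) (hA : ∀ m, ∀ x ∈ A, φ m + x ∈ A) :
    Submodule (AddMonoidAlgebra K N) (AddMonoidAlgebra K P) where
  carrier := {f | ∀ x ∈ f.coeff.support, x ∈ A}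
  zero_mem' := by simp
  add_mem' := by
    classical
    intro f g hf hg x hx
    rw [AddMonoidAlgebra.coeff_add] at hx
    rcases Finset.mem_union.1 (Finsupp.support_add hx) with h | h
    · exact hf x h
    · exact hg x h
  smul_mem' := by
    classical
    intro r f hf x hx
    rw [Algebra.smul_def, hφ] at hx
    obtain ⟨a, ha, b, hb, rfl⟩ :=
      Finset.mem_add.1 (AddMonoidAlgebra.support_coeff_mul_subset _ _ hx)
    obtain ⟨m, -, rfl⟩ := Finset.mem_image.1 (Finsupp.mapDomain_support ha)
    exact hA m b (hf b hb)

/-- The conic ideal `𝒞(y) = K · (ℤ^d ∩ (y + ℝ_+ M))`, a module over `K[M]`. -/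
def conicIdeal {d : ℕ} (M : AddSubmonoid (Fin d → ℤ)) (y : Fin d → ℝ) :
    Submodule (AddMonoidAlgebra K M) (AddMonoidAlgebra K (Fin d → ℤ)) :=
  supportedSubmodule K M.subtype rfl {x | castHom d x - y ∈ realCone M} (by
    intro m x hx
    have h : castHom d (M.subtype m + x) - y = castHom d m + (castHom d x - y) := by
      rw [map_add, add_sub_assoc]; rfl
    rw [Set.mem_ofPred_eq, h]
    exact add_mem (Submodule.subset_span ⟨m, m.2, rfl⟩) hx)

/-- The conic ideal `𝒞_γ`: the common value of the ideals `𝒞(x)`, `x ∈ ⌈γ⌉`. -/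
def conicOfCell {d s : ℕ} (M : AddSubmonoid (Fin d → ℤ)) (σ : Fin s → Fin d → ℤ)
    (γ : Set (Fin d → ℝ)) :
    Submodule (AddMonoidAlgebra K M) (AddMonoidAlgebra K (Fin d → ℤ)) :=
  ⨆ x ∈ cellUpperClosure σ γ, conicIdeal K M x

/-! ### The decomposition of `R^(n)` -/

/-- The torus `ℝ^d/ℤ^d`. -/
abbrev Torus (d : ℕ) : Type := (Fin d → ℝ) ⧸ (castHom d).range

/-- The subgroup `(1/n)ℤ^d/ℤ^d` of the torus. -/
def rootClasses (d n : ℕ) : AddSubgroup (Torus d) :=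
  ((castHom d).range.comap (nsmulAddMonoidHom n)).map (QuotientAddGroup.mk' (castHom d).range)

/-- The `R`-submodule `I_c = R^(n) ∩ K·c` of `R^(n)`, for a residue class `c` modulo `ℤ^d`. -/
def residueSummand {d : ℕ} (M : AddSubmonoid (Fin d → ℤ)) (n : ℕ) (c : Torus d) :
    Submodule (AddMonoidAlgebra K M) (AddMonoidAlgebra K (rootMonoid M n)) :=
  supportedSubmodule K (toRoot M n) rfl
    {x | (QuotientAddGroup.mk (x : Fin d → ℝ) : Torus d) = c} (by
      intro m x hx
      have h : (QuotientAddGroup.mk (castHom d m) : Torus d) = 0 :=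
        (QuotientAddGroup.eq_zero_iff _).2 ⟨m, rfl⟩
      change (QuotientAddGroup.mk (castHom d m + (x : Fin d → ℝ)) : Torus d) = c
      rw [QuotientAddGroup.mk_add, h, zero_add]
      exact hx)

/-- `v_γ(n)`: the number of summands in the decomposition `R^(n) = ⨁ I_c`,
`c ∈ (1/n)ℤ^d/ℤ^d`, that are isomorphic to `𝒞_γ` as `R`-modules. -/
def multiplicity {d s : ℕ} (M : AddSubmonoid (Fin d → ℤ)) (σ : Fin s → Fin d → ℤ)
    (γ : Set (Fin d → ℝ)) (n : ℕ) : ℕ :=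
  {c : Torus d | c ∈ rootClasses d n ∧
    Nonempty (residueSummand K M n c ≃ₗ[AddMonoidAlgebra K M] conicOfCell K M σ γ)}.ncard

/-! ### Generators, Frobenius powers, Hilbert-Kunz multiplicity -/

/-- `μ_A(N)`: the minimal number of generators of the `A`-module `N`. -/
def minGens (A N : Type*) [Semiring A] [AddCommMonoid N] [Module A N] : ℕ :=
  (⊤ : Submodule A N).spanFinrank

/-- The ideal `I^[q]` generated by the `q`-th powers of the elements of `I`. -/
def frobeniusPower {A : Type*} [CommRing A] (I : Ideal A) (q : ℕ) : Ideal A :=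
  Ideal.span ((fun a => a ^ q) '' (I : Set A))

/-- The maximal ideal of `K[M]` generated by the monomials different from `1`. -/
def monomialMaxIdeal {d : ℕ} (M : AddSubmonoid (Fin d → ℤ)) : Ideal (AddMonoidAlgebra K M) :=
  Ideal.span {f | ∃ x : M, x ≠ 0 ∧ f = AddMonoidAlgebra.single x 1}

/-- `r` is the Hilbert-Kunz multiplicity of the `K`-algebra `A` of dimension `d` with respect to
the ideal `I`: the spaces `A/I^[p^e]` are finite-dimensional and
`dim_K (A/I^[p^e]) / p^(d e)` converges to `r`. -/
def HasHKMultiplicity (p d : ℕ) (A : Type*) [CommRing A] [Algebra K A] (I : Ideal A) (r : ℝ) :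
    Prop :=
  (∀ e : ℕ, Module.Finite K (A ⧸ frobeniusPower I (p ^ e))) ∧
  Tendsto (fun e : ℕ => (Module.finrank K (A ⧸ frobeniusPower I (p ^ e)) : ℝ) / (p : ℝ) ^ (d * e))
    atTop (𝓝 r)

/-- A quasi-polynomial `n ↦ ∑ a_i(n) n^i` with periodic rational coefficients `a_i`, given by the
polynomial with coefficients `a_i(n)` for each `n ∈ ℤ`. -/
structure QuasiPolynomial where
  poly : ℤ → ℚ[X]
  periodic : ∃ N : ℕ, 0 < N ∧ ∀ n : ℤ, poly (n + N) = poly n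

/-- The value of a quasi-polynomial at `n`. -/
def QuasiPolynomial.value (q : QuasiPolynomial) (n : ℤ) : ℚ := (q.poly n).eval (n : ℚ)

/-- `S` is a graded subalgebra of `K[M]` with respect to the grading in which a monomial `x ∈ M`
has degree `deg x`. -/
def IsGradedSubalgebra {N : Type*} [AddCommMonoid N] (deg : N →+ ℕ)
    (S : Subalgebra K (AddMonoidAlgebra K N)) : Prop :=
  ∀ f ∈ S, ∀ n : ℕ,
    (DirectSum.decompose (AddMonoidAlgebra.gradeBy K deg) f n : AddMonoidAlgebra K N) ∈ S

/-- The irrelevant ideal of a graded subalgebra: generated by the elements of positive degree. -/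
def irrelevantIdeal {N : Type*} [AddCommMonoid N] (deg : N →+ ℕ)
    (S : Subalgebra K (AddMonoidAlgebra K N)) : Ideal S :=
  Ideal.span {f | ∃ n : ℕ, 0 < n ∧ (f : AddMonoidAlgebra K N) ∈ AddMonoidAlgebra.gradeBy K deg n}

/-- `R` is the normalization of its subalgebra `S`: the fraction field of `R` is that of `S`, and
`R` is the integral closure of `S` in it. -/
def IsNormalizationOf {R : Type*} [CommRing R] [Algebra K R] (S : Subalgebra K R) : Prop :=
  IsFractionRing S (FractionRing R) ∧ IsIntegralClosure R S (FractionRing R)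

end ConicHK

end

/-! Everything reduces to counting lattice points in dilated cells. Write a class `c` as the class
of `-x/n` with `x ∈ ℤ^d`. The exponents of `R^(n)` in this class are the `u - x/n` with `u ∈ ℤ^d`
and `σ(u) ≥ σ(x/n)`, so `I_c` is isomorphic to the conic ideal `𝒞(x/n)`, and this ideal depends only
on `⌈σ(x/n)⌉` (`nonempty_residueSummand_equiv`, `conicIdeal_eq`). A homomorphism between two such
ideals is multiplication by a Laurent polynomial, and each inequality `σ_i ≥ z_i` is an equality for
some point of the ideal; hence two of the ideals are isomorphic only if their ceiling vectors differ
by `σ(t)` with `t ∈ ℤ^d` (`eq_add_formValues_of_equiv`). So `v_γ(n)` is the number of points of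
`(1/n)ℤ^d` in `⌈γ⌉` (`multiplicity_eq`).

Let `q = p^e`. Since `K` is perfect, `f ↦ f^q` identifies `R^(q)` with `R` and carries `J R^(q)` to
`J^[q]`. Therefore `dim R/J^[q] = dim R^(q)/J R^(q) = ∑ dim(𝒞_γ/J𝒞_γ) v_γ(q)` for every ideal `J` of
finite colength (`finrank_quotient_frobeniusPower`, `finrank_root_quotient`). For `J = 𝔪` a graded
Nakayama lemma (`minGens_eq_finrank_quotient`) turns the dimensions into numbers of generators.

The counting functions are treated in three ways. They are quasi-polynomials because the algebra of
piecewise quasi-polynomial functions is closed under discrete summation over boxes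
(`exists_antidiff_pwFun`, `exists_pwFun_sum_box`). Their leading term is the volume of the cell, by
convergence of indicator functions (`tendsto_card_polyhedron`). For the second coefficient, the step
from `n` to `n + 1` moves each facet across a fixed number of lattice slices, and each slice
contains `L n^(d-1) + o(n^(d-1))` points (`exists_tendsto_latticeCount_diff`); so the second
coefficient changes by a constant from `n` to `n + 1`, and periodicity makes this constant zero
(`QuasiPolynomial.second_coeff`).

For `S ⊂ R` there is a nonzerodivisor `c` with `cR ⊂ S`. Multiplication by `c` raises degrees by a
bounded amount, so the dimensions of `S/𝔪_S^[q]` and `R/𝔪_S^[q]R` differ by at most the number of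
monomials in a strip of bounded width at degree about `Cq`, which is `o(q^d)`
(`exists_bound_finrank_sub`). The formula above for `J = 𝔪_S R` then gives (b), as `dim 𝒞_γ/𝔪_S 𝒞_γ
= μ_S(𝒞_γ)`. -/

noncomputable section
namespace ConicHK

/-! ### Piecewise quasi-polynomial functions on abelian groups -/

section QuasiPoly

variable {E E' : Type*} [AddCommGroup E] [AddCommGroup E']

/-- The polynomial functions on `E`: the algebra generated by the integral linear forms. -/
def polyFun (E : Type*) [AddCommGroup E] : Subalgebra ℚ (E → ℚ) :=
  Algebra.adjoin ℚ {f | ∃ l : E →+ ℤ, f = fun e => (l e : ℚ)}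

lemma linear_mem_polyFun (l : E →+ ℤ) : (fun e => (l e : ℚ)) ∈ polyFun E :=
  Algebra.subset_adjoin ⟨l, rfl⟩

lemma const_mem_polyFun (c : ℚ) : (fun _ : E => c) ∈ polyFun E :=
  (polyFun E).algebraMap_mem c

/-- Pulling back functions along a map, as an algebra homomorphism. -/
def pullback {X Y : Type*} (φ : X → Y) : (Y → ℚ) →ₐ[ℚ] (X → ℚ) where
  toFun f := f ∘ φ
  map_one' := rfl
  map_mul' _ _ := rfl
  map_zero' := rfl
  map_add' _ _ := rfl
  commutes' _ := rfl

lemma polyFun_comp {f : E → ℚ} (hf : f ∈ polyFun E) (φ : E' →+ E) :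
    (fun e => f (φ e)) ∈ polyFun E' := by
  have h : polyFun E ≤ (polyFun E').comap (pullback φ) := by
    refine Algebra.adjoin_le ?_
    rintro _ ⟨l, rfl⟩
    exact linear_mem_polyFun (l.comp φ)
  exact h hf

/-- `f` is a quasi-polynomial function: polynomial on the cosets of `N E` for some `N ≥ 1`. -/
def IsQuasiPolyFun (f : E → ℚ) : Prop :=
  ∃ N : ℕ, 0 < N ∧ ∀ e₀, (fun e => f (e₀ + N • e)) ∈ polyFun E

lemma polyFun_modulus {f : E → ℚ} {N : ℕ} (h : ∀ e₀, (fun e => f (e₀ + N • e)) ∈ polyFun E)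
    (k : ℕ) (e₀ : E) : (fun e => f (e₀ + (N * k) • e)) ∈ polyFun E := by
  simpa [mul_smul] using polyFun_comp (h e₀) (nsmulAddMonoidHom k)

/-- The algebra of quasi-polynomial functions. -/
def quasiPolyFun (E : Type*) [AddCommGroup E] : Subalgebra ℚ (E → ℚ) where
  carrier := {f | IsQuasiPolyFun f}
  algebraMap_mem' c := ⟨1, one_pos, fun _ => const_mem_polyFun c⟩
  add_mem' := by
    rintro f g ⟨N, hN, hf⟩ ⟨N', hN', hg⟩
    refine ⟨N * N', Nat.mul_pos hN hN', fun e₀ => ?_⟩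
    have h2 := polyFun_modulus hg N e₀
    rw [Nat.mul_comm] at h2
    exact add_mem (polyFun_modulus hf N' e₀) h2
  mul_mem' := by
    rintro f g ⟨N, hN, hf⟩ ⟨N', hN', hg⟩
    refine ⟨N * N', Nat.mul_pos hN hN', fun e₀ => ?_⟩
    have h2 := polyFun_modulus hg N e₀
    rw [Nat.mul_comm] at h2
    exact mul_mem (polyFun_modulus hf N' e₀) h2

lemma quasiPolyFun_comp {f : E → ℚ} (hf : f ∈ quasiPolyFun E) (φ : E' →+ E) :
    (fun e => f (φ e)) ∈ quasiPolyFun E' := by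
  obtain ⟨N, hN, hf⟩ := hf
  refine ⟨N, hN, fun e₀ => ?_⟩
  simpa using polyFun_comp (hf (φ e₀)) φ

/-- The indicator of a proposition, as a rational number. -/
def ind (P : Prop) : ℚ := open Classical in if P then 1 else 0

lemma ind_true {P : Prop} (h : P) : ind P = 1 := if_pos h
lemma ind_false {P : Prop} (h : ¬P) : ind P = 0 := if_neg h

/-- The algebra of piecewise quasi-polynomial functions, generated by the quasi-polynomial functions
and the indicators of half-spaces. -/
def pwFun (E : Type*) [AddCommGroup E] : Subalgebra ℚ (E → ℚ) :=
  Algebra.adjoin ℚ ((quasiPolyFun E : Set (E → ℚ)) ∪ {f | ∃ l : E →+ ℤ, f = fun e => ind (0 ≤ l e)})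

lemma quasiPolyFun_le_pwFun : quasiPolyFun E ≤ pwFun E := fun _ hf =>
  Algebra.subset_adjoin (Or.inl hf)

lemma ind_nonneg_mem (l : E →+ ℤ) : (fun e => ind (0 ≤ l e)) ∈ pwFun E :=
  Algebra.subset_adjoin (Or.inr ⟨l, rfl⟩)

lemma ind_le_mem (a b : E →+ ℤ) : (fun e => ind (a e ≤ b e)) ∈ pwFun E := by
  simpa using ind_nonneg_mem (b - a)

lemma ind_lt_mem (a b : E →+ ℤ) : (fun e => ind (a e < b e)) ∈ pwFun E := by
  have h : (fun e => ind (a e < b e)) = 1 - fun e => ind (b e ≤ a e) := by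
    funext e
    by_cases h : a e < b e
    · simp [ind_true h, ind_false (not_le.2 h)]
    · simp [ind_false h, ind_true (not_lt.1 h)]
  rw [h]
  exact sub_mem (one_mem _) (ind_le_mem b a)

lemma pwFun_comp {f : E → ℚ} (hf : f ∈ pwFun E) (φ : E' →+ E) :
    (fun e => f (φ e)) ∈ pwFun E' := by
  have h : pwFun E ≤ (pwFun E').comap (pullback φ) := by
    refine Algebra.adjoin_le ?_
    rintro _ (hf | ⟨l, rfl⟩)
    · exact quasiPolyFun_le_pwFun (quasiPolyFun_comp hf φ)
    · exact ind_nonneg_mem (l.comp φ)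
  exact h hf

/-! #### Discrete antiderivatives -/

/-- The sum `∑_{0 ≤ i < t} u i`, extended to negative `t` so that its difference function is `u`. -/
def antidiff (u : ℤ → ℚ) (t : ℤ) : ℚ :=
  ∑ i ∈ Finset.Ico 0 t, u i - ∑ i ∈ Finset.Ico t 0, u i

lemma antidiff_zero (u : ℤ → ℚ) : antidiff u 0 = 0 := by simp [antidiff]

lemma antidiff_succ (u : ℤ → ℚ) (t : ℤ) : antidiff u (t + 1) = antidiff u t + u t := by
  unfold antidiff
  rcases lt_or_ge t 0 with h | h
  · have h1 : Finset.Ico t 0 = insert t (Finset.Ico (t + 1) 0) := by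
      ext i; simp; omega
    rw [h1, Finset.sum_insert (by simp), Finset.Ico_eq_empty (b := t + 1) (by omega),
      Finset.Ico_eq_empty (b := t) (by omega)]
    simp
  · have h1 : Finset.Ico 0 (t + 1) = insert t (Finset.Ico 0 t) := by
      ext i; simp; omega
    rw [h1, Finset.sum_insert (by simp), Finset.Ico_eq_empty (a := t) (by omega),
      Finset.Ico_eq_empty (a := t + 1) (by omega)]
    simp [add_comm]

lemma eq_of_diff_eq {F G : ℤ → ℚ} (h0 : F 0 = G 0)
    (h : ∀ t, F (t + 1) - F t = G (t + 1) - G t) (t : ℤ) : F t = G t := by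
  induction t using Int.induction_on with
  | zero => exact h0
  | succ i ih => have := h i; linarith
  | pred i ih => have := h (-i - 1); simp only [sub_add_cancel] at this; linarith

lemma sum_Ico_eq_sub {u F : ℤ → ℚ} (h : ∀ t, F (t + 1) - F t = u t) {a b : ℤ} (hab : a ≤ b) :
    ∑ i ∈ Finset.Ico a b, u i = F b - F a := by
  induction b, hab using Int.leInduction with
  | base => simp
  | succ b hb ih =>
    have h1 : Finset.Ico a (b + 1) = insert b (Finset.Ico a b) := by
      ext i; simp; omega
    rw [h1, Finset.sum_insert (by simp), ih, ← h b]
    ring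

/-- A polynomial whose difference function is `t ^ j`. -/
lemma exists_poly_diff_pow (j : ℕ) :
    ∃ P : ℚ[X], ∀ t : ℚ, P.eval (t + 1) - P.eval t = t ^ j := by
  -- The Bernoulli polynomials satisfy `B_{j+1}(t + 1) - B_{j+1}(t) = (j + 1) t^j`.
  refine ⟨C ((j : ℚ) + 1)⁻¹ * Polynomial.bernoulli (j + 1), fun t => ?_⟩
  have h := Polynomial.bernoulli_eval_one_add (j + 1) t
  have hj : (j : ℚ) + 1 ≠ 0 := by positivity
  rw [add_comm t 1]
  simp only [eval_mul, eval_C, h]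
  push_cast
  field_simp
  ring

lemma poly_comp_mem {X : Type*} {f : X → ℚ} {A : Subalgebra ℚ (X → ℚ)} (hf : f ∈ A) (P : ℚ[X]) :
    (fun e => P.eval (f e)) ∈ A := by
  induction P using Polynomial.induction_on' with
  | add p q hp hq =>
    simp only [eval_add]
    exact add_mem hp hq
  | monomial n a =>
    simp only [eval_monomial]
    exact A.smul_mem (pow_mem hf n) a

/-- Separating the variable `t` reduces discrete integration in `t` to powers of `t`. The span is
closed under products and contains the generators because `l(e, t) = l(e, 0) + t l(0, 1)`. -/
lemma polyFun_prod_induction {f : E × ℤ → ℚ} (hf : f ∈ polyFun (E × ℤ)) :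
    f ∈ Submodule.span ℚ
      {f : E × ℤ → ℚ | ∃ g ∈ polyFun E, ∃ j : ℕ, f = fun x => g x.1 * (x.2 : ℚ) ^ j} := by
  set V := Submodule.span ℚ
      {f : E × ℤ → ℚ | ∃ g ∈ polyFun E, ∃ j : ℕ, f = fun x => g x.1 * (x.2 : ℚ) ^ j} with hV
  have hmul : ∀ f ∈ V, ∀ g ∈ V, f * g ∈ V := by
    intro f hf g hg
    have h := Submodule.mul_mem_mul hf hg
    rw [hV, Submodule.span_mul_span] at h
    refine Submodule.span_mono ?_ h
    rintro _ ⟨_, ⟨g, hg, j, rfl⟩, _, ⟨g', hg', j', rfl⟩, rfl⟩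
    refine ⟨g * g', mul_mem hg hg', j + j', ?_⟩
    funext x
    simp only [Pi.mul_apply]
    ring
  refine Algebra.adjoin_induction (p := fun f _ => f ∈ V) ?_ ?_ ?_ ?_ hf
  · rintro _ ⟨l, rfl⟩
    have h : (fun x : E × ℤ => (l x : ℚ)) =
        (fun x => (l (x.1, 0) : ℚ) * (x.2 : ℚ) ^ 0) + fun x => (l (0, 1) : ℚ) * (x.2 : ℚ) ^ 1 := by
      funext ⟨e, t⟩
      have : l (e, t) = l (e, 0) + t * l (0, 1) := by
        rw [← smul_eq_mul, ← map_zsmul, ← map_add]; simp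
      simp [this, mul_comm]
    rw [h]
    refine add_mem (Submodule.subset_span ⟨fun e => l (e, 0), ?_, 0, rfl⟩)
      (Submodule.subset_span ⟨fun e => l (0, 1), const_mem_polyFun _, 1, rfl⟩)
    exact linear_mem_polyFun (l.comp (AddMonoidHom.inl E ℤ))
  · intro c
    exact Submodule.subset_span ⟨fun _ => c, const_mem_polyFun c, 0, by funext x; simp⟩
  · intro f g _ _ hf hg
    exact add_mem hf hg
  · intro f g _ _ hf hg
    exact hmul f hf g hg

lemma antidiff_mem_polyFun {f : E × ℤ → ℚ} (hf : f ∈ polyFun (E × ℤ)) :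
    (fun x : E × ℤ => antidiff (fun i => f (x.1, i)) x.2) ∈ polyFun (E × ℤ) := by
  suffices h : ∃ F ∈ polyFun (E × ℤ), ∀ e t, F (e, t + 1) - F (e, t) = f (e, t) by
    obtain ⟨F, hF, h⟩ := h
    have : (fun x : E × ℤ => antidiff (fun i => f (x.1, i)) x.2) =
        F - fun x => F (x.1, 0) := by
      funext ⟨e, t⟩
      refine eq_of_diff_eq (F := antidiff (fun i => f (e, i))) (G := fun t => F (e, t) - F (e, 0))
        (by simp [antidiff_zero]) (fun t => ?_) t
      rw [antidiff_succ, ← h e t]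
      ring
    rw [this]
    exact sub_mem hF (polyFun_comp hF ((AddMonoidHom.inl E ℤ).comp (AddMonoidHom.fst E ℤ)))
  refine Submodule.span_induction (p := fun f _ => ∃ F ∈ polyFun (E × ℤ),
    ∀ e t, F (e, t + 1) - F (e, t) = f (e, t)) ?_ ?_ ?_ ?_ (polyFun_prod_induction hf)
  · rintro _ ⟨g, hg, j, rfl⟩
    obtain ⟨P, hP⟩ := exists_poly_diff_pow j
    refine ⟨(fun x => g x.1) * fun x => P.eval (x.2 : ℚ),
      mul_mem (polyFun_comp hg (AddMonoidHom.fst E ℤ))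
        (poly_comp_mem (linear_mem_polyFun (AddMonoidHom.snd E ℤ)) P), fun e t => ?_⟩
    have := hP t
    simp only [Pi.mul_apply]
    push_cast
    rw [← this]; ring
  · exact ⟨0, zero_mem _, by simp⟩
  · rintro f g _ _ ⟨F, hF, h⟩ ⟨G, hG, h'⟩
    refine ⟨F + G, add_mem hF hG, fun e t => ?_⟩
    simp only [Pi.add_apply, ← h, ← h']; ring
  · rintro c f _ ⟨F, hF, h⟩
    refine ⟨c • F, Subalgebra.smul_mem _ hF c, fun e t => ?_⟩
    simp only [Pi.smul_apply, ← h, smul_eq_mul]; ring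

/-- The sum over `N t` consecutive integers is split by residues modulo `N`. A quasi-polynomial
summand of modulus `N` becomes polynomial on each residue class, so the polynomial case applies to
every inner sum. -/
lemma antidiff_add_mul (u : ℤ → ℚ) (t₀ : ℤ) (N : ℕ) (t : ℤ) :
    antidiff u (t₀ + N * t) = antidiff u t₀ +
      ∑ r ∈ Finset.range N, antidiff (fun i => u (t₀ + r + N * i)) t := by
  refine eq_of_diff_eq (F := fun t => antidiff u (t₀ + N * t))
    (G := fun t => antidiff u t₀ +
      ∑ r ∈ Finset.range N, antidiff (fun i => u (t₀ + r + N * i)) t)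
    (by simp [antidiff_zero]) (fun t => ?_) t
  have h1 : ∀ k : ℕ, ∀ s, antidiff u (s + k) - antidiff u s =
      ∑ r ∈ Finset.range k, u (s + r) := by
    intro k s
    induction k with
    | zero => simp
    | succ k ih =>
      rw [Finset.sum_range_succ, ← ih]
      push_cast
      rw [← add_assoc, antidiff_succ]
      ring
  have h2 : t₀ + N * (t + 1) = t₀ + N * t + N := by ring
  simp only [antidiff_succ, Finset.sum_add_distrib]
  rw [h2, h1]
  have : ∀ r : ℕ, t₀ + N * t + r = t₀ + r + N * t := fun r => by ring
  simp only [this]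
  ring

lemma antidiff_mem_quasiPolyFun {f : E × ℤ → ℚ} (hf : f ∈ quasiPolyFun (E × ℤ)) :
    (fun x : E × ℤ => antidiff (fun i => f (x.1, i)) x.2) ∈ quasiPolyFun (E × ℤ) := by
  obtain ⟨N, hN, hf⟩ := hf
  refine ⟨N, hN, fun ⟨e₀, t₀⟩ => ?_⟩
  have key : (fun x : E × ℤ => antidiff (fun i => f ((((e₀, t₀) : E × ℤ) + N • x).1, i))
        (((e₀, t₀) : E × ℤ) + N • x).2) =
      (fun x => antidiff (fun i => f (e₀ + N • x.1, i)) t₀) +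
      ∑ r ∈ Finset.range N, fun x => antidiff (fun i => f (e₀ + N • x.1, t₀ + r + N * i)) x.2 := by
    funext ⟨e, t⟩
    simp [antidiff_add_mul]
  rw [key]
  have h1 : ∀ i : ℤ, (fun x : E × ℤ => f (e₀ + N • x.1, i)) ∈ polyFun (E × ℤ) := fun i => by
    simpa using polyFun_comp (hf (e₀, i)) ((AddMonoidHom.inl E ℤ).comp (AddMonoidHom.fst E ℤ))
  refine add_mem ?_ (sum_mem fun r _ => ?_)
  · have : (fun x : E × ℤ => antidiff (fun i => f (e₀ + N • x.1, i)) t₀) =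
        ∑ i ∈ Finset.Ico 0 t₀, (fun x : E × ℤ => f (e₀ + N • x.1, i)) -
        ∑ i ∈ Finset.Ico t₀ 0, (fun x : E × ℤ => f (e₀ + N • x.1, i)) := by
      funext x; simp [antidiff]
    rw [this]
    exact sub_mem (sum_mem fun i _ => h1 i) (sum_mem fun i _ => h1 i)
  · have := antidiff_mem_polyFun (hf (e₀, t₀ + r))
    simpa using this

end QuasiPoly

end ConicHK
end

/-! ### Discrete integration of piecewise quasi-polynomial functions -/

noncomputable section
namespace ConicHK

section Piecewise

variable {E : Type*} [AddCommGroup E]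

/-- The constant function `1` and the indicators of rays `a(e) + δ ≤ c t`, `c > 0`. -/
def rayFun (E : Type*) [AddCommGroup E] : Set (E × ℤ → ℚ) :=
  {r | r = 1 ∨ ∃ (a : E →+ ℤ) (c δ : ℤ), 0 < c ∧ (δ = 0 ∨ δ = 1) ∧
    r = fun x => ind (a x.1 + δ ≤ c * x.2)}

/-- Two upward rays in `t` are nested, so their product is the smaller one. Which one is smaller
depends only on the end points, and is decided by a half-space condition in `e`. -/
lemma rayFun_mul {r r' : E × ℤ → ℚ} (hr : r ∈ rayFun E) (hr' : r' ∈ rayFun E) :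
    ∃ h ∈ pwFun E, ∀ x, r x * r' x = h x.1 * r x + (1 - h x.1) * r' x := by
  rcases hr with rfl | ⟨a, c, δ, hc, hδ, rfl⟩
  · exact ⟨0, zero_mem _, fun x => by simp⟩
  rcases hr' with rfl | ⟨a', c', δ', hc', hδ', rfl⟩
  · exact ⟨1, one_mem _, fun x => by simp⟩
  have key : ∃ P : E → Prop, (fun e => ind (P e)) ∈ pwFun E ∧
      (∀ e t, P e → a e + δ ≤ c * t → a' e + δ' ≤ c' * t) ∧
      (∀ e t, ¬P e → a' e + δ' ≤ c' * t → a e + δ ≤ c * t) := by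
    have hδ'' : 0 ≤ δ' ∧ δ' ≤ 1 := by omega
    -- The end points `a/c` and `a'/c'` are compared strictly if the first ray is closed (`δ = 0`)
    -- and weakly if it is open (`δ = 1`); this way a tie always falls on the side where the
    -- inclusion holds, whatever `δ'` is.
    rcases hδ with rfl | rfl
    · refine ⟨fun e => c * a' e < c' * a e, ind_lt_mem (c • a') (c' • a), ?_, ?_⟩
      · intro e t h1 h2
        have : a' e < c' * t := by
          by_contra hcon
          nlinarith
        omega
      · intro e t h1 h2
        by_contra hcon
        nlinarith
    · refine ⟨fun e => c * a' e ≤ c' * a e, ind_le_mem (c • a') (c' • a), ?_, ?_⟩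
      · intro e t h1 h2
        have : a' e < c' * t := by
          by_contra hcon
          nlinarith
        omega
      · intro e t h1 h2
        have : a e < c * t := by
          by_contra hcon
          nlinarith
        omega
  obtain ⟨P, hP, h1, h2⟩ := key
  refine ⟨_, hP, fun ⟨e, t⟩ => ?_⟩
  simp only [ind]
  have h1 := h1 e t
  have h2 := h2 e t
  split_ifs <;> simp_all

/-- The products `g(e) r(e, t) q(e, t)` with `g` piecewise quasi-polynomial, `r` a ray and `q`
quasi-polynomial. -/
def raySpan (E : Type*) [AddCommGroup E] : Submodule ℚ (E × ℤ → ℚ) :=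
  Submodule.span ℚ {f | ∃ g ∈ pwFun E, ∃ r ∈ rayFun E, ∃ q ∈ quasiPolyFun (E × ℤ),
    f = fun x => g x.1 * r x * q x}

lemma raySpan_mul {f f' : E × ℤ → ℚ} (hf : f ∈ raySpan E) (hf' : f' ∈ raySpan E) :
    f * f' ∈ raySpan E := by
  have h := Submodule.mul_mem_mul hf hf'
  rw [raySpan, Submodule.span_mul_span] at h
  refine Submodule.span_le.2 ?_ h
  rintro _ ⟨_, ⟨g, hg, r, hr, q, hq, rfl⟩, _, ⟨g', hg', r', hr', q', hq', rfl⟩, rfl⟩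
  obtain ⟨h, hh, hx⟩ := rayFun_mul hr hr'
  have key : ((fun x => g x.1 * r x * q x) * fun x => g' x.1 * r' x * q' x) =
      (fun x : E × ℤ => (g * g' * h) x.1 * r x * (q * q') x) +
      fun x => (g * g' * (1 - h)) x.1 * r' x * (q * q') x := by
    funext x
    simp only [Pi.mul_apply, Pi.add_apply, Pi.sub_apply, Pi.one_apply]
    linear_combination (g x.1 * g' x.1 * q x * q' x) * hx x
  simp only [SetLike.mem_coe]
  rw [key]
  exact add_mem
    (Submodule.subset_span ⟨_, mul_mem (mul_mem hg hg') hh, r, hr, _, mul_mem hq hq', rfl⟩)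
    (Submodule.subset_span ⟨_, mul_mem (mul_mem hg hg') (sub_mem (one_mem _) hh), r', hr', _,
      mul_mem hq hq', rfl⟩)

/-- A half-space in `E × ℤ` is, for fixed `e`, an upward ray, a condition on `e` alone, or the
complement of an open upward ray, according to the sign of the coefficient `l(0, 1)` of `t`.
Products of rays collapse to single rays, so one cut-off per term suffices. -/
lemma pwFun_le_raySpan {f : E × ℤ → ℚ} (hf : f ∈ pwFun (E × ℤ)) : f ∈ raySpan E := by
  have hray : ∀ r ∈ rayFun E, r ∈ raySpan E := fun r hr =>
    Submodule.subset_span ⟨1, one_mem _, r, hr, 1, one_mem _, by funext x; simp⟩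
  have hq : ∀ q ∈ quasiPolyFun (E × ℤ), q ∈ raySpan E := fun q hq =>
    Submodule.subset_span ⟨1, one_mem _, 1, Or.inl rfl, q, hq, by funext x; simp⟩
  refine Algebra.adjoin_induction (p := fun f _ => f ∈ raySpan E) ?_ ?_ ?_ ?_ hf
  · rintro _ (hf | ⟨l, rfl⟩)
    · exact hq _ hf
    · have hl : ∀ e t, l (e, t) = l (e, 0) + t * l (0, 1) := by
        intro e t
        rw [← smul_eq_mul, ← map_zsmul, ← map_add]; simp
      set a : E →+ ℤ := l.comp (AddMonoidHom.inl E ℤ) with ha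
      have hl' : ∀ x : E × ℤ, l x = a x.1 + x.2 * l (0, 1) := fun x => hl x.1 x.2
      rcases lt_trichotomy (l (0, 1)) 0 with h | h | h
      · have : (fun x => ind (0 ≤ l x)) =
            1 - fun x : E × ℤ => ind (a x.1 + 1 ≤ (- l (0, 1)) * x.2) := by
          funext x
          have h1 : a x.1 + 1 ≤ (- l (0, 1)) * x.2 ↔ ¬ 0 ≤ l x := by
            rw [hl' x]
            have : (- l (0, 1)) * x.2 = - (x.2 * l (0, 1)) := by ring
            omega
          by_cases h2 : 0 ≤ l x
          · rw [ind_true h2, Pi.sub_apply, ind_false (by rw [h1]; exact not_not.2 h2)]; simp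
          · rw [ind_false h2, Pi.sub_apply, ind_true (h1.2 h2)]; simp
        rw [this]
        exact sub_mem (hq _ (one_mem _))
          (hray _ (Or.inr ⟨a, _, 1, by omega, Or.inr rfl, rfl⟩))
      · refine Submodule.subset_span ⟨_, ind_nonneg_mem a, 1, Or.inl rfl, 1, one_mem _, ?_⟩
        funext x
        simp [hl' x, h]
      · refine hray _ (Or.inr ⟨-a, l (0, 1), 0, h, Or.inl rfl, ?_⟩)
        funext x
        congr 1
        rw [hl' x, mul_comm, AddMonoidHom.neg_apply, add_zero, eq_iff_iff]
        constructor <;> intro h <;> linarith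
  · intro c
    exact hq _ ((quasiPolyFun _).algebraMap_mem c)
  · intro f g _ _ hf hg
    exact add_mem hf hg
  · intro f g _ _ hf hg
    exact raySpan_mul hf hg

lemma ceilDiv_le_iff {c : ℤ} (hc : 0 < c) (b t : ℤ) : -((-b) / c) ≤ t ↔ b ≤ c * t := by
  rw [neg_le, Int.le_ediv_iff_mul_le hc]
  constructor <;> intro h <;> nlinarith

/-- The second argument is `⌈(a(e) + δ)/c⌉`. Rounding is harmless on cosets of `N c E`: replacing
`e₀` by `e₀ + N c e` changes the ceiling by exactly `N a(e)`, which is linear. -/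
lemma quasiPolyFun_comp_ceilDiv {Q : E × ℤ → ℚ} (hQ : Q ∈ quasiPolyFun (E × ℤ)) (a : E →+ ℤ)
    {c : ℤ} (hc : 0 < c) (δ : ℤ) :
    (fun e => Q (e, -((-(a e + δ)) / c))) ∈ quasiPolyFun E := by
  obtain ⟨N, hN, hQ⟩ := hQ
  refine ⟨N * c.toNat, Nat.mul_pos hN (by omega), fun e₀ => ?_⟩
  have h := polyFun_comp (hQ (e₀, -((-(a e₀ + δ)) / c))) ((nsmulAddMonoidHom c.toNat).prod a)
  convert h using 3 with e
  · have h1 : -(a (e₀ + (N * c.toNat) • e) + δ) = -(a e₀ + δ) + (- (N * a e)) * c := by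
      rw [map_add, map_nsmul]
      have : ((N * c.toNat : ℕ) : ℤ) = N * c := by
        rw [Nat.cast_mul, Int.toNat_of_nonneg hc.le]
      rw [nsmul_eq_mul, this]
      ring
    rw [h1, Int.add_mul_ediv_right _ _ hc.ne']
    simp [mul_smul]
    ring

/-- Piecewise quasi-polynomial functions have piecewise quasi-polynomial discrete antiderivatives. -/
lemma exists_antidiff_pwFun {f : E × ℤ → ℚ} (hf : f ∈ pwFun (E × ℤ)) :
    ∃ F ∈ pwFun (E × ℤ), ∀ e t, F (e, t + 1) - F (e, t) = f (e, t) := by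
  refine Submodule.span_induction (p := fun f _ => ∃ F ∈ pwFun (E × ℤ),
    ∀ e t, F (e, t + 1) - F (e, t) = f (e, t)) ?_ ?_ ?_ ?_ (pwFun_le_raySpan hf)
  · rintro _ ⟨g, hg, r, hr, q, hq, rfl⟩
    have hg' := pwFun_comp hg (AddMonoidHom.fst E ℤ)
    have hQ := antidiff_mem_quasiPolyFun hq
    rcases hr with rfl | ⟨a, c, δ, hc, hδ, rfl⟩
    · refine ⟨_, mul_mem hg' (quasiPolyFun_le_pwFun hQ), fun e t => ?_⟩
      simp [antidiff_succ]
      ring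
    · have hray : (fun x : E × ℤ => ind (a x.1 + δ ≤ c * x.2)) ∈ pwFun (E × ℤ) := by
        have h1 := ind_le_mem (a.comp (AddMonoidHom.fst E ℤ)) (c • AddMonoidHom.snd E ℤ)
        have h2 := ind_lt_mem (a.comp (AddMonoidHom.fst E ℤ)) (c • AddMonoidHom.snd E ℤ)
        rcases hδ with rfl | rfl
        · simpa using h1
        · exact h2
      have hτ := quasiPolyFun_comp (quasiPolyFun_comp_ceilDiv hQ a hc δ) (AddMonoidHom.fst E ℤ)
      -- The antiderivative of `q` is normalized to vanish at the first point `τ` of the ray and cut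
      -- off below `τ`; the normalization removes the jump at `τ`.
      refine ⟨_, mul_mem (mul_mem hg' hray) (Subalgebra.sub_mem (pwFun (E × ℤ))
        (quasiPolyFun_le_pwFun hQ) (quasiPolyFun_le_pwFun hτ)), fun e t => ?_⟩
      simp only [Pi.mul_apply, Pi.sub_apply, AddMonoidHom.coe_fst, antidiff_succ,
        ← ceilDiv_le_iff hc]
      set τ := -((-(a e + δ)) / c)
      rcases lt_trichotomy (t + 1) τ with h | h | h
      · rw [ind_false (by omega), ind_false (by omega)]; simp
      · rw [ind_true (by omega), ind_false (by omega), ← h, antidiff_succ]; simp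
      · rw [ind_true (by omega), ind_true (by omega)]; ring
  · exact ⟨0, zero_mem _, by simp⟩
  · rintro f g _ _ ⟨F, hF, h⟩ ⟨G, hG, h'⟩
    refine ⟨F + G, add_mem hF hG, fun e t => ?_⟩
    simp only [Pi.add_apply, ← h, ← h']; ring
  · rintro c f _ ⟨F, hF, h⟩
    refine ⟨c • F, Subalgebra.smul_mem _ hF c, fun e t => ?_⟩
    simp only [Pi.smul_apply, ← h, smul_eq_mul]; ring

/-- Sums of piecewise quasi-polynomial functions over boxes whose size is given by a linear form
are piecewise quasi-polynomial. -/
lemma exists_pwFun_sum_box {d : ℕ} {E : Type*} [AddCommGroup E] {f : E × (Fin d → ℤ) → ℚ}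
    (hf : f ∈ pwFun (E × (Fin d → ℤ))) (B : E →+ ℤ) :
    ∃ g ∈ pwFun E, ∀ e, 0 ≤ B e →
      ∑ x ∈ Fintype.piFinset (fun _ : Fin d => Finset.Ico (-B e) (B e)), f (e, x) = g e := by
  induction d with
  | zero =>
    refine ⟨_, pwFun_comp hf (AddMonoidHom.inl E (Fin 0 → ℤ)), fun e _ => ?_⟩
    rw [Fintype.piFinset_of_isEmpty]
    simp only [Finset.univ_unique, Finset.sum_singleton, AddMonoidHom.inl_apply]
    congr 2
    exact Subsingleton.elim _ _
  | succ d ih =>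
    let cons : (E × (Fin d → ℤ)) × ℤ →+ E × (Fin (d + 1) → ℤ) :=
      { toFun := fun x => (x.1.1, Fin.cons x.2 x.1.2)
        map_zero' := by
          ext i
          · rfl
          · refine Fin.cases ?_ (fun j => ?_) i <;> simp
        map_add' := fun x y => by
          ext i
          · rfl
          · refine Fin.cases ?_ (fun j => ?_) i <;> simp }
    -- Summation over the first coordinate evaluates an antiderivative at `±B(e)`. The result is
    -- piecewise quasi-polynomial in the parameter and the other coordinates, so the induction
    -- continues.
    obtain ⟨F, hF, hdiff⟩ := exists_antidiff_pwFun (pwFun_comp hf cons)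
    have hB : ∀ s : ℤ, (fun y : E × (Fin d → ℤ) => F (y, s * B y.1)) ∈ pwFun (E × (Fin d → ℤ)) :=
      fun s => pwFun_comp hF
        ((AddMonoidHom.id _).prod (s • B.comp (AddMonoidHom.fst E (Fin d → ℤ))))
    obtain ⟨g, hg, hsum⟩ := ih (sub_mem (hB 1) (hB (-1)))
    refine ⟨g, hg, fun e he => ?_⟩
    rw [← hsum e he]
    have h1 : ∀ y : Fin d → ℤ, ((fun y : E × (Fin d → ℤ) => F (y, 1 * B y.1)) -
        fun y : E × (Fin d → ℤ) => F (y, (-1) * B y.1)) (e, y) =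
        ∑ t ∈ Finset.Ico (-B e) (B e), f (e, Fin.cons t y) := by
      intro y
      rw [sum_Ico_eq_sub (u := fun t => f (e, Fin.cons t y)) (F := fun t => F ((e, y), t))
        (fun t => hdiff (e, y) t) (by omega)]
      simp
    simp only [h1]
    rw [Finset.sum_comm, ← Finset.sum_product']
    refine Finset.sum_bij' (fun x _ => (x 0, Fin.tail x)) (fun p _ => Fin.cons p.1 p.2) ?_ ?_ ?_ ?_ ?_
    · intro x hx
      rw [Fintype.mem_piFinset] at hx
      simp only [Finset.mem_product, Fintype.mem_piFinset]
      exact ⟨hx 0, fun i => hx i.succ⟩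
    · intro p hp
      simp only [Finset.mem_product, Fintype.mem_piFinset] at hp
      rw [Fintype.mem_piFinset]
      exact fun i => Fin.cases hp.1 hp.2 i
    · intro x _; simp
    · intro p _; simp
    · intro x _; simp

/-- On positive integers, piecewise quasi-polynomial functions are quasi-polynomial. -/
lemma pwFun_int_eq {f : ℤ → ℚ} (hf : f ∈ pwFun ℤ) :
    ∃ q ∈ quasiPolyFun ℤ, ∀ n : ℤ, 0 < n → f n = q n := by
  refine Algebra.adjoin_induction (p := fun f _ => ∃ q ∈ quasiPolyFun ℤ, ∀ n : ℤ, 0 < n → f n = q n)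
    ?_ ?_ ?_ ?_ hf
  · rintro _ (hf | ⟨l, rfl⟩)
    · exact ⟨_, hf, fun _ _ => rfl⟩
    · refine ⟨fun _ => ind (0 ≤ l 1), (quasiPolyFun ℤ).algebraMap_mem _, fun n hn => ?_⟩
      have : l n = n * l 1 := by
        rw [← smul_eq_mul, ← map_zsmul]; simp
      simp only [this, mul_nonneg_iff_of_pos_left hn]
  · intro c
    exact ⟨_, (quasiPolyFun ℤ).algebraMap_mem c, fun _ _ => rfl⟩
  · rintro f g _ _ ⟨q, hq, h⟩ ⟨q', hq', h'⟩
    exact ⟨q + q', add_mem hq hq', fun n hn => by simp [h n hn, h' n hn]⟩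
  · rintro f g _ _ ⟨q, hq, h⟩ ⟨q', hq', h'⟩
    exact ⟨q * q', mul_mem hq hq', fun n hn => by simp [h n hn, h' n hn]⟩

end Piecewise

end ConicHK
end

/-! ### Coefficients of quasi-polynomials -/

noncomputable section
namespace ConicHK

section QuasiPolynomials

lemma exists_poly_of_polyFun {f : ℤ → ℚ} (hf : f ∈ polyFun ℤ) :
    ∃ P : ℚ[X], ∀ n : ℤ, f n = P.eval (n : ℚ) := by
  refine Algebra.adjoin_induction (p := fun f _ => ∃ P : ℚ[X], ∀ n : ℤ, f n = P.eval (n : ℚ))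
    ?_ ?_ ?_ ?_ hf
  · rintro _ ⟨l, rfl⟩
    refine ⟨C (l 1 : ℚ) * X, fun n => ?_⟩
    have : l n = n * l 1 := by
      rw [← smul_eq_mul, ← map_zsmul]; simp
    simp [this, mul_comm]
  · intro c
    exact ⟨C c, fun n => by simp⟩
  · rintro f g _ _ ⟨P, h⟩ ⟨Q, h'⟩
    exact ⟨P + Q, fun n => by simp [h, h']⟩
  · rintro f g _ _ ⟨P, h⟩ ⟨Q, h'⟩
    exact ⟨P * Q, fun n => by simp [h, h']⟩

lemma exists_quasiPolynomial {f : ℤ → ℚ} (hf : f ∈ quasiPolyFun ℤ) :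
    ∃ q : QuasiPolynomial, ∀ n, q.value n = f n := by
  obtain ⟨N, hN, hf⟩ := hf
  choose P hP using fun e₀ => exists_poly_of_polyFun (hf e₀)
  -- On the class of `r` modulo `N` the function is a polynomial in `k`, where `n = r + N k`;
  -- substituting `k = (n - r)/N` gives a polynomial in `n`.
  refine ⟨⟨fun n => (P (n % N)).comp (C ((N : ℚ)⁻¹) * (X - C ((n % N : ℤ) : ℚ))), N, hN,
    fun n => by simp⟩, fun n => ?_⟩
  have h := hP (n % N) (n / N)
  have hN' : (N : ℚ) ≠ 0 := by positivity
  have h1 : n % N + N • (n / (N : ℤ)) = n := by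
    rw [nsmul_eq_mul]; exact Int.emod_add_mul_ediv n N
  rw [h1] at h
  rw [h]
  have h2 : (n : ℚ) = (n % N : ℤ) + N * (n / N : ℤ) := by
    exact_mod_cast (Int.emod_add_mul_ediv n N).symm
  simp only [QuasiPolynomial.value, eval_comp, eval_mul, eval_C, eval_sub, eval_X]
  congr 1
  nth_rewrite 1 [h2]
  field_simp
  ring

/-- The limit is only needed along one sequence tending to infinity. This allows arithmetic
progressions, on which a quasi-polynomial is given by a single polynomial. -/
lemma poly_of_tendsto {P : ℚ[X]} {d : ℕ} {u : ℕ → ℕ} (hu : Tendsto u atTop atTop) {v : ℝ}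
    (h : Tendsto (fun k => ((P.eval (u k : ℚ) : ℚ) : ℝ) / (u k : ℝ) ^ d) atTop (𝓝 v)) :
    P.natDegree ≤ d ∧ (P.coeff d : ℝ) = v := by
  set Q : ℝ[X] := P.map (algebraMap ℚ ℝ) with hQ
  have hev : ∀ k, ((P.eval (u k : ℚ) : ℚ) : ℝ) = Q.eval (u k : ℝ) := by
    intro k
    rw [hQ, eval_map_algebraMap, ← map_natCast (algebraMap ℚ ℝ) (u k), aeval_algebraMap_apply]
    simp
  have hu' : Tendsto (fun k => (u k : ℝ)) atTop atTop := tendsto_natCast_atTop_atTop.comp hu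
  have hdeg : Q.natDegree = P.natDegree := natDegree_map _
  have hcoeff : Q.coeff d = (P.coeff d : ℝ) := coeff_map _ _
  simp only [hev] at h
  rw [← hdeg, ← hcoeff]
  have hX : ∀ x : ℝ, x ^ d = (X ^ d : ℝ[X]).eval x := by simp
  simp only [hX] at h
  rcases lt_trichotomy Q.degree d with hlt | heq | hgt
  · have h0 := (div_tendsto_atTop_zero_of_degree_lt Q (X ^ d) (by simpa using hlt)).comp hu'
    exact ⟨natDegree_le_of_degree_le hlt.le,
      by rw [coeff_eq_zero_of_degree_lt hlt, tendsto_nhds_unique h h0]⟩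
  · have h0 := (div_tendsto_atTop_leadingCoeff_div_of_degree_eq Q (X ^ d) (by simpa using heq)).comp
      hu'
    refine ⟨natDegree_le_of_degree_le heq.le, ?_⟩
    rw [tendsto_nhds_unique h h0]
    simp [leadingCoeff, natDegree_eq_of_degree_eq_some heq]
  · have h0 := (abs_div_tendsto_atTop_atTop_of_degree_gt Q (X ^ d) (by simpa using hgt)
      (pow_ne_zero _ X_ne_zero)).comp hu'
    exact absurd (h.abs) (not_tendsto_nhds_of_tendsto_atTop h0 _)

lemma QuasiPolynomial.poly_add_mul (q : QuasiPolynomial) {N : ℕ}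
    (hq : ∀ n : ℤ, q.poly (n + N) = q.poly n) (n : ℤ) (k : ℕ) :
    q.poly (n + N * k) = q.poly n := by
  induction k with
  | zero => simp
  | succ k ih => rw [← ih, ← hq (n + N * k)]; congr 1; push_cast; ring

lemma tendsto_arith_prog {N : ℕ} (hN : 0 < N) (r : ℕ) :
    Tendsto (fun k => r + N * k) atTop atTop :=
  tendsto_atTop_mono (fun k => (Nat.le_mul_of_pos_left k hN).trans (Nat.le_add_left _ _)) tendsto_id

lemma QuasiPolynomial.exists_nat_rep (q : QuasiPolynomial) {N : ℕ} (hN : 0 < N)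
    (hq : ∀ n : ℤ, q.poly (n + N) = q.poly n) (n : ℤ) :
    ∃ r : ℕ, q.poly r = q.poly n ∧ q.poly (r + 1) = q.poly (n + 1) := by
  refine ⟨(n + N * n.natAbs).toNat, ?_, ?_⟩
  all_goals
    have h : 0 ≤ n + N * n.natAbs := by
      have h1 : (1 : ℤ) ≤ N := by exact_mod_cast hN
      have h2 : (0 : ℤ) ≤ n.natAbs := by positivity
      have h3 : -n ≤ (n.natAbs : ℤ) := by omega
      nlinarith
    rw [Int.toNat_of_nonneg h]
  · exact q.poly_add_mul hq n _
  · rw [add_right_comm]; exact q.poly_add_mul hq (n + 1) _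

lemma QuasiPolynomial.of_tendsto (q : QuasiPolynomial) {d : ℕ} {v : ℝ}
    (h : Tendsto (fun n : ℕ => (q.value n : ℝ) / (n : ℝ) ^ d) atTop (𝓝 v)) (n : ℤ) :
    (q.poly n).natDegree ≤ d ∧ ((q.poly n).coeff d : ℝ) = v := by
  obtain ⟨N, hN, hq⟩ := q.periodic
  obtain ⟨r, hr, -⟩ := q.exists_nat_rep hN hq n
  refine poly_of_tendsto (tendsto_arith_prog hN r) ?_
  convert h.comp (tendsto_arith_prog hN r) using 3 with k
  simp only [Function.comp, QuasiPolynomial.value]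
  push_cast
  rw [q.poly_add_mul hq, hr]

lemma coeff_comp_X_add_one {P : ℚ[X]} {m : ℕ} (hP : P.natDegree ≤ m + 1) :
    (P.comp (X + 1)).coeff m = P.coeff m + (m + 1) * P.coeff (m + 1) := by
  rw [comp, eval₂_eq_sum_range' C (Nat.lt_succ_of_le hP), finsetSum_coeff,
    Finset.sum_range_succ, Finset.sum_range_succ, Finset.sum_eq_zero]
  · simp only [coeff_C_mul, coeff_X_add_one_pow]
    simp
    ring
  · intro i hi
    rw [coeff_C_mul, coeff_X_add_one_pow, Nat.choose_eq_zero_of_lt (Finset.mem_range.1 hi)]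
    simp

/-- The coefficient of degree `m` of the difference is `a_m(n + 1) - a_m(n) + (m + 1) e`, and it
equals `L` for all `n`. So `a_m` grows by a constant `δ` at every step, and periodicity forces `δ =
0`. -/
lemma QuasiPolynomial.second_coeff (q : QuasiPolynomial) {m : ℕ} {e : ℚ} {L : ℝ}
    (hdeg : ∀ n, (q.poly n).natDegree ≤ m + 1) (hlead : ∀ n, (q.poly n).coeff (m + 1) = e)
    (h : Tendsto (fun n : ℕ => ((q.value (n + 1) : ℝ) - q.value n) / (n : ℝ) ^ m) atTop (𝓝 L))
    (n : ℤ) : (q.poly n).coeff m = (q.poly 0).coeff m := by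
  obtain ⟨N, hN, hq⟩ := q.periodic
  have key : ∀ n : ℤ, (((q.poly (n + 1)).coeff m : ℚ) : ℝ) - ((q.poly n).coeff m : ℚ) =
      L - (m + 1) * e := by
    intro n
    obtain ⟨r, hr, hr'⟩ := q.exists_nat_rep hN hq n
    have := poly_of_tendsto (P := (q.poly (n + 1)).comp (X + 1) - q.poly n) (d := m) (v := L)
      (tendsto_arith_prog hN r) ?_
    · have h2 := this.2
      rw [coeff_sub, coeff_comp_X_add_one (hdeg _), hlead] at h2
      push_cast at h2
      linarith
    · convert h.comp (tendsto_arith_prog hN r) using 3 with k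
      simp only [Function.comp, QuasiPolynomial.value]
      push_cast
      rw [q.poly_add_mul hq, hr, add_right_comm (r : ℤ), q.poly_add_mul hq, hr']
      simp only [eval_sub, eval_comp, eval_add, eval_X, eval_one]
      push_cast
      rfl
  set δ := L - (m + 1) * e
  have hmul : ∀ k : ℕ, ∀ n : ℤ, (((q.poly (n + k)).coeff m : ℚ) : ℝ) =
      ((q.poly n).coeff m : ℚ) + k * δ := by
    intro k n
    induction k with
    | zero => simp
    | succ k ih =>
      have := key (n + k)
      push_cast
      rw [← add_assoc]
      linarith
  have hδ : δ = 0 := by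
    have := hmul N 0
    rw [hq] at this
    have hN' : (N : ℝ) ≠ 0 := by positivity
    have h0 : N * δ = 0 := by linarith
    exact (mul_eq_zero.1 h0).resolve_left hN'
  rw [hδ] at hmul
  rcases Int.le_total 0 n with hn | hn
  · obtain ⟨k, rfl⟩ := Int.eq_ofNat_of_zero_le hn
    have := hmul k 0
    rw [zero_add, mul_zero, add_zero] at this
    exact_mod_cast this
  · have := hmul n.natAbs n
    rw [show n + n.natAbs = 0 by omega, mul_zero, add_zero] at this
    exact_mod_cast this.symm

/-- The number of lattice points in the dilations of a bounded rational polytope, some of whose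
facets may be removed, is a quasi-polynomial function. -/
lemma exists_quasiPolyFun_card {d : ℕ} {I J : Type*} [Fintype I] [Fintype J]
    (ρ : I → (Fin d → ℤ) →+ ℤ) (β : I → ℤ) (τ : J → (Fin d → ℤ) →+ ℤ) (η : J → ℤ)
    (B : ℕ) (hB : ∀ (n : ℤ) (x : Fin d → ℤ), 0 < n → (∀ i, ρ i x ≤ n * β i) →
      (∀ j, τ j x < n * η j) → ∀ k, -(n * B) ≤ x k ∧ x k < n * B) :
    ∃ q ∈ quasiPolyFun ℤ, ∀ n : ℤ, 0 < n →
      q n = ({x : Fin d → ℤ | (∀ i, ρ i x ≤ n * β i) ∧ ∀ j, τ j x < n * η j}.ncard : ℚ) := by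
  classical
  -- The indicator of the cone over the polytope, with the dilation factor as an additional
  -- coordinate; summing over the second factor counts the points of one dilation.
  let f : ℤ × (Fin d → ℤ) → ℚ := fun y =>
    (∏ i, ind (ρ i y.2 ≤ y.1 * β i)) * ∏ j, ind (τ j y.2 < y.1 * η j)
  have hf : f ∈ pwFun (ℤ × (Fin d → ℤ)) := by
    have h1 : f = (∏ i, fun y : ℤ × (Fin d → ℤ) => ind (ρ i y.2 ≤ y.1 * β i)) *
        ∏ j, fun y : ℤ × (Fin d → ℤ) => ind (τ j y.2 < y.1 * η j) := by
      funext y; simp [f]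
    rw [h1]
    refine mul_mem (prod_mem fun i _ => ?_) (prod_mem fun j _ => ?_)
    · simpa [mul_comm] using ind_le_mem ((ρ i).comp (AddMonoidHom.snd ℤ (Fin d → ℤ)))
        (β i • AddMonoidHom.fst ℤ (Fin d → ℤ))
    · simpa [mul_comm] using ind_lt_mem ((τ j).comp (AddMonoidHom.snd ℤ (Fin d → ℤ)))
        (η j • AddMonoidHom.fst ℤ (Fin d → ℤ))
  obtain ⟨g, hg, hsum⟩ := exists_pwFun_sum_box hf ((B : ℤ) • AddMonoidHom.id ℤ)
  obtain ⟨q, hq, hgq⟩ := pwFun_int_eq hg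
  refine ⟨q, hq, fun n hn => ?_⟩
  have hfind : ∀ x, f (n, x) = if ((∀ i, ρ i x ≤ n * β i) ∧ ∀ j, τ j x < n * η j) then 1 else 0 := by
    intro x
    split_ifs with h
    · simp only [f]
      rw [Finset.prod_eq_one fun i _ => ind_true (h.1 i),
        Finset.prod_eq_one fun i _ => ind_true (h.2 i), one_mul]
    · rw [not_and_or] at h
      simp only [f]
      rcases h with h | h
      · push Not at h
        obtain ⟨i, hi⟩ := h
        rw [Finset.prod_eq_zero (Finset.mem_univ i) (ind_false (not_le.2 hi)), zero_mul]
      · push Not at h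
        obtain ⟨i, hi⟩ := h
        rw [mul_comm, Finset.prod_eq_zero (Finset.mem_univ i) (ind_false (not_lt.2 hi)), zero_mul]
  rw [← hgq n hn, ← hsum n (by simp; positivity)]
  simp only [hfind]
  rw [Finset.sum_boole, ← Set.ncard_coe_finset]
  congr 2
  ext x
  simp only [Finset.coe_filter, Fintype.mem_piFinset, Set.mem_ofPred_eq, Finset.mem_Ico]
  constructor
  · exact fun h => h.2
  · intro h
    refine ⟨fun k => ?_, h⟩
    have := hB n x hn h.1 h.2 k
    simpa [mul_comm] using this

end QuasiPolynomials

end ConicHK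
end

/-! ### Lattice points and volume -/

noncomputable section
namespace ConicHK

section RiemannSums

variable {m : ℕ}

/-- The `ℝ`-linear extension of an integral linear form. -/
def realForm (l : (Fin m → ℤ) →+ ℤ) (y : Fin m → ℝ) : ℝ := ∑ j, (l (Pi.single j 1) : ℝ) * y j

lemma int_form_eq (l : (Fin m → ℤ) →+ ℤ) (x : Fin m → ℤ) :
    l x = ∑ j, l (Pi.single j 1) * x j := by
  conv_lhs => rw [← Finset.univ_sum_single x, map_sum]
  refine Finset.sum_congr rfl fun j _ => ?_
  rw [mul_comm, ← smul_eq_mul, ← map_zsmul]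
  congr 1
  ext k
  simp [Pi.single_apply]

lemma realForm_castHom (l : (Fin m → ℤ) →+ ℤ) (x : Fin m → ℤ) :
    realForm l (castHom m x) = l x := by
  rw [int_form_eq l x, realForm]
  push_cast
  rfl

lemma continuous_realForm (l : (Fin m → ℤ) →+ ℤ) : Continuous (realForm l) := by
  unfold realForm; fun_prop

/-- The boxes of points with given integral part after dilation by `n`. -/
lemma floor_fiber_eq {n : ℕ} (hn : 0 < n) (k : Fin m → ℤ) :
    {y : Fin m → ℝ | (fun j => ⌊(n : ℝ) * y j⌋) = k} =
      Set.univ.pi fun j => Set.Ico ((k j : ℝ) / n) (((k j : ℝ) + 1) / n) := by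
  have hn' : (0 : ℝ) < n := by exact_mod_cast hn
  ext y
  simp only [Set.mem_ofPred_eq, Set.mem_pi, Set.mem_univ, true_imp_iff, Set.mem_Ico, funext_iff,
    Int.floor_eq_iff, div_le_iff₀ hn', lt_div_iff₀ hn', mul_comm (n : ℝ)]

/-- The set is a disjoint union of cubes of side `1/n`, one for each element of `A`. It turns a
normalized count into the measure of a set. -/
lemma volume_floor_preimage {n : ℕ} (hn : 0 < n) {A : Set (Fin m → ℤ)} (hA : A.Finite) :
    volume.real {y : Fin m → ℝ | (fun j => ⌊(n : ℝ) * y j⌋) ∈ A} = A.ncard / (n : ℝ) ^ m := by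
  have hn' : (0 : ℝ) < n := by exact_mod_cast hn
  have h1 : {y : Fin m → ℝ | (fun j => ⌊(n : ℝ) * y j⌋) ∈ A} =
      ⋃ k ∈ hA.toFinset, {y : Fin m → ℝ | (fun j => ⌊(n : ℝ) * y j⌋) = k} := by
    ext y; simp
  have hvol : ∀ k : Fin m → ℤ, volume {y : Fin m → ℝ | (fun j => ⌊(n : ℝ) * y j⌋) = k} =
      ENNReal.ofReal ((1 / (n : ℝ)) ^ m) := by
    intro k
    rw [floor_fiber_eq hn, Real.volume_pi_Ico]
    have : ∀ j, ((k j : ℝ) + 1) / n - k j / n = 1 / n := fun j => by ring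
    simp only [this, Finset.prod_const, Finset.card_univ, Fintype.card_fin]
    rw [ENNReal.ofReal_pow (by positivity)]
  rw [h1, measureReal_biUnion_finset (h := fun k _ => by rw [hvol]; exact ENNReal.ofReal_ne_top)]
  · simp only [Measure.real, hvol, Finset.sum_const, nsmul_eq_mul]
    rw [ENNReal.toReal_ofReal (by positivity), Set.ncard_eq_toFinset_card A hA]
    rw [one_div, inv_pow, div_eq_mul_inv]
  · intro k _ k' _ hk
    rw [Function.onFun, Set.disjoint_left]
    rintro y rfl h
    exact hk h
  · intro k _
    rw [floor_fiber_eq hn]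
    exact MeasurableSet.univ_pi fun j => measurableSet_Ico

lemma tendsto_floor_mul_div (y : ℝ) :
    Tendsto (fun n : ℕ => (⌊(n : ℝ) * y⌋ : ℝ) / n) atTop (𝓝 y) := by
  have h1 : Tendsto (fun n : ℕ => y - 1 / (n : ℝ)) atTop (𝓝 y) := by
    simpa using tendsto_const_nhds.sub (tendsto_one_div_atTop_nhds_zero_nat (𝕜 := ℝ))
  refine tendsto_of_tendsto_of_tendsto_of_le_of_le' h1 tendsto_const_nhds ?_ ?_
  all_goals
    filter_upwards [eventually_gt_atTop 0] with n hn
    have hn' : (0 : ℝ) < n := by exact_mod_cast hn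
  · rw [le_div_iff₀ hn', sub_mul, one_div, inv_mul_cancel₀ hn'.ne']
    linarith [Int.lt_floor_add_one ((n : ℝ) * y)]
  · rw [div_le_iff₀ hn', mul_comm y]
    exact Int.floor_le _

lemma finite_of_forall_abs_le {A : Set (Fin m → ℤ)} {B : ℤ} (h : ∀ x ∈ A, ∀ k, |x k| ≤ B) :
    A.Finite :=
  (Set.finite_Icc (fun _ : Fin m => -B) (fun _ => B)).subset fun x hx =>
    ⟨fun k => (abs_le.1 (h x hx k)).1, fun k => (abs_le.1 (h x hx k)).2⟩

/-- For `l ≠ 0` the set is a proper affine subspace, for `l = 0 ≠ b` it is empty. The zero form has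
to be admitted because forms restricted to a slice may vanish. -/
lemma volume_realForm_eq {l : (Fin m → ℤ) →+ ℤ} {b : ℤ} (h : l ≠ 0 ∨ b ≠ 0) :
    volume {y : Fin m → ℝ | realForm l y = b} = 0 := by
  by_cases hl : l = 0
  · have : {y : Fin m → ℝ | realForm l y = b} = ∅ := by
      ext y
      have hb : (0 : ℝ) ≠ b := by exact_mod_cast (h.resolve_left (not_not.2 hl)).symm
      simpa [realForm, hl] using hb
    rw [this, measure_empty]
  · let L : (Fin m → ℝ) →ₗ[ℝ] ℝ := ∑ j, (l (Pi.single j 1) : ℝ) • LinearMap.proj j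
    have hL : ∀ y, L y = realForm l y := fun y => by simp [L, realForm]
    let S : AffineSubspace ℝ (Fin m → ℝ) := (AffineSubspace.mk' (b : ℝ) ⊥).comap L.toAffineMap
    have hS : (S : Set (Fin m → ℝ)) = {y | realForm l y = b} := by
      ext y
      simp [S, AffineSubspace.mem_mk', hL, sub_eq_zero]
    rw [← hS]
    refine Measure.addHaar_affineSubspace _ _ fun htop => ?_
    have hall : ∀ y, realForm l y = b := fun y => by
      have : y ∈ (S : Set (Fin m → ℝ)) := by rw [htop]; trivial
      rw [hS] at this
      exact this
    refine hl (AddMonoidHom.ext fun x => ?_)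
    have h0 := hall (castHom m 0)
    have hx := hall (castHom m x)
    rw [realForm_castHom] at h0 hx
    have : l x = l 0 := by exact_mod_cast hx.trans h0.symm
    simpa using this

/-- The number of lattice points in the dilations of a polytope, with the facets displaced by bounded
amounts, is asymptotic to the volume. -/
lemma tendsto_card_polyhedron {I : Type*} [Fintype I] (ρ : I → (Fin m → ℤ) →+ ℤ) (β c : I → ℤ)
    (hne : ∀ i, ρ i ≠ 0 ∨ β i ≠ 0) (B : ℕ)
    (hB : ∀ n : ℕ, 0 < n → ∀ x, (∀ i, ρ i x ≤ n * β i + c i) → ∀ k, |x k| ≤ B * n) :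
    Tendsto (fun n : ℕ => ({x | ∀ i, ρ i x ≤ n * β i + c i}.ncard : ℝ) / (n : ℝ) ^ m) atTop
      (𝓝 (volume.real {y | ∀ i, realForm (ρ i) y ≤ β i})) := by
  have hfin : ∀ n : ℕ, 0 < n → {x | ∀ i, ρ i x ≤ n * β i + c i}.Finite := fun n hn =>
    finite_of_forall_abs_le (hB n hn)
  have hmeas : ∀ n : ℕ, MeasurableSet {y : Fin m → ℝ | (fun j => ⌊(n : ℝ) * y j⌋) ∈
      {x | ∀ i, ρ i x ≤ n * β i + c i}} := by
    intro n
    have : Measurable fun y : Fin m → ℝ => fun j => ⌊(n : ℝ) * y j⌋ := by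
      refine measurable_pi_lambda _ fun j => ?_
      exact Int.measurable_floor.comp ((measurable_pi_apply j).const_mul _)
    exact this (Set.to_countable _).measurableSet
  have hbox : MeasurableSet (Set.Icc (fun _ : Fin m => -(B : ℝ)) (fun _ => (B : ℝ) + 1)) :=
    measurableSet_Icc
  have hsub : ∀ᶠ n : ℕ in atTop, {y : Fin m → ℝ | (fun j => ⌊(n : ℝ) * y j⌋) ∈
      {x | ∀ i, ρ i x ≤ n * β i + c i}} ⊆
      Set.Icc (fun _ : Fin m => -(B : ℝ)) (fun _ => (B : ℝ) + 1) := by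
    filter_upwards [eventually_gt_atTop 0] with n hn
    have hn' : (0 : ℝ) < n := by exact_mod_cast hn
    intro y hy
    have h := hB n hn _ hy
    refine ⟨fun k => ?_, fun k => ?_⟩
    all_goals
      have h1 : |(⌊(n : ℝ) * y k⌋ : ℝ)| ≤ B * n := by exact_mod_cast h k
      rw [abs_le] at h1
      have h2 := Int.floor_le ((n : ℝ) * y k)
      have h3 := Int.lt_floor_add_one ((n : ℝ) * y k)
      have h4 : (1 : ℝ) ≤ n := by exact_mod_cast hn
    · by_contra hcon
      push Not at hcon
      nlinarith
    · by_contra hcon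
      push Not at hcon
      nlinarith
  have key : Tendsto (fun n : ℕ => volume {y : Fin m → ℝ | (fun j => ⌊(n : ℝ) * y j⌋) ∈
      {x | ∀ i, ρ i x ≤ n * β i + c i}}) atTop (𝓝 (volume {y | ∀ i, realForm (ρ i) y ≤ β i})) := by
    -- The unions of cubes stay in a fixed box, and their indicators converge almost everywhere to
    -- that of the limit polytope.
    refine tendsto_measure_of_ae_tendsto_indicator atTop ?_ hmeas hbox
      isCompact_Icc.measure_lt_top.ne hsub ?_
    · have : {y | ∀ i, realForm (ρ i) y ≤ β i} = ⋂ i, {y | realForm (ρ i) y ≤ β i} := by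
        ext y; simp
      rw [this]
      exact MeasurableSet.iInter fun i =>
        (isClosed_le (continuous_realForm _) continuous_const).measurableSet
    -- Off the boundary hyperplanes every inequality is strict in one direction or the other. It is
    -- then decided correctly for large `n`, because rounding and the displacement `c i` contribute
    -- only `O(1/n)` after division by `n`.
    · have hae : ∀ᵐ y : Fin m → ℝ, ∀ i, realForm (ρ i) y ≠ β i :=
        ae_all_iff.2 fun i => by
          rw [ae_iff]
          simpa using volume_realForm_eq (hne i)
      filter_upwards [hae] with y hy
      have hlim : ∀ i, Tendsto (fun n : ℕ => (((ρ i fun j => ⌊(n : ℝ) * y j⌋) - c i : ℤ) : ℝ) / n)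
          atTop (𝓝 (realForm (ρ i) y)) := by
        intro i
        have h1 : Tendsto (fun n : ℕ => ∑ j, (ρ i (Pi.single j 1) : ℝ) *
            ((⌊(n : ℝ) * y j⌋ : ℝ) / n)) atTop (𝓝 (realForm (ρ i) y)) :=
          tendsto_finsetSum _ fun j _ => (tendsto_floor_mul_div (y j)).const_mul _
        have h2 : Tendsto (fun n : ℕ => (c i : ℝ) / n) atTop (𝓝 0) :=
          tendsto_const_div_atTop_nhds_zero_nat _
        have h3 := h1.sub h2
        rw [sub_zero] at h3
        refine h3.congr fun n => ?_
        rw [int_form_eq (ρ i)]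
        push_cast
        rw [sub_div, Finset.sum_div]
        simp only [mul_div_assoc]
      have hev : ∀ i, ∀ᶠ n : ℕ in atTop, ((ρ i fun j => ⌊(n : ℝ) * y j⌋) ≤ n * β i + c i ↔
          realForm (ρ i) y ≤ β i) := by
        intro i
        have hrw : ∀ n : ℕ, 0 < n → ((ρ i fun j => ⌊(n : ℝ) * y j⌋) ≤ n * β i + c i ↔
            (((ρ i fun j => ⌊(n : ℝ) * y j⌋) - c i : ℤ) : ℝ) / n ≤ β i) := by
          intro n hn
          have hn' : (0 : ℝ) < n := by exact_mod_cast hn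
          rw [div_le_iff₀ hn', ← sub_le_iff_le_add, mul_comm]
          exact_mod_cast Iff.rfl
        rcases lt_or_gt_of_ne (hy i) with h | h
        · filter_upwards [eventually_gt_atTop 0, (hlim i).eventually (gt_mem_nhds h)] with n hn h'
          rw [hrw n hn]
          exact ⟨fun _ => h.le, fun _ => h'.le⟩
        · filter_upwards [eventually_gt_atTop 0, (hlim i).eventually (lt_mem_nhds h)] with n hn h'
          rw [hrw n hn]
          exact ⟨fun h2 => absurd h2 (not_le.2 h'), fun h2 => absurd h2 (not_le.2 h)⟩
      filter_upwards [eventually_all.2 hev] with n hn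
      exact forall_congr' hn
  have hfinvol : volume {y : Fin m → ℝ | ∀ i, realForm (ρ i) y ≤ β i} ≠ ⊤ := by
    refine ne_top_of_le_ne_top (b := volume (Set.Icc (fun _ : Fin m => -(B : ℝ)) (fun _ => (B : ℝ) + 1)))
      isCompact_Icc.measure_lt_top.ne (le_of_tendsto key ?_)
    filter_upwards [hsub] with n hn
    exact measure_mono hn
  refine ((ENNReal.tendsto_toReal hfinvol).comp key).congr' ?_
  filter_upwards [eventually_gt_atTop 0] with n hn
  exact volume_floor_preimage hn (hfin n hn)

end RiemannSums

end ConicHK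
end

/-! ### Lattice slices and consecutive dilations -/

noncomputable section
namespace ConicHK

section Slices

lemma abs_form_le {m : ℕ} (l : (Fin m → ℤ) →+ ℤ) {x : Fin m → ℤ} {C : ℤ} (hx : ∀ k, |x k| ≤ C) :
    |l x| ≤ (∑ j, |l (Pi.single j 1)|) * C := by
  rw [int_form_eq l x, Finset.sum_mul]
  refine (Finset.abs_sum_le_sum_abs _ _).trans (Finset.sum_le_sum fun j _ => ?_)
  rw [abs_mul]
  exact mul_le_mul_of_nonneg_left (hx j) (abs_nonneg _)

/-- A surjective integral linear form is a coordinate with respect to a basis of the lattice. -/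
lemma exists_coordinates {m : ℕ} (l : (Fin (m + 1) → ℤ) →+ ℤ) {w : Fin (m + 1) → ℤ} (hw : l w = 1) :
    ∃ (φ : (Fin m → ℤ) →+ (Fin (m + 1) → ℤ)) (ψ : (Fin (m + 1) → ℤ) →+ (Fin m → ℤ)),
      (∀ u, l (φ u) = 0) ∧ (∀ u (t : ℤ), ψ (φ u + t • w) = u) ∧ ∀ x, φ (ψ x) + l x • w = x := by
  let L : (Fin (m + 1) → ℤ) →ₗ[ℤ] ℤ := l.toIntLinearMap
  have hsurj : Function.Surjective L := fun t => ⟨t • w, by rw [map_smul]; simp [L, hw]⟩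
  have hrank : Module.finrank ℤ (LinearMap.ker L) = m := by
    have h := Submodule.finrank_quotient_add_finrank (LinearMap.ker L)
    rw [(L.quotKerEquivOfSurjective hsurj).finrank_eq] at h
    simp at h
    omega
  let b := Module.finBasisOfFinrankEq ℤ (LinearMap.ker L) hrank
  let proj : (Fin (m + 1) → ℤ) →ₗ[ℤ] LinearMap.ker L :=
    LinearMap.codRestrict (LinearMap.ker L) (LinearMap.id - L.smulRight w)
      (fun x => by
        change l (x - l x • w) = 0
        rw [map_sub, map_zsmul, hw]; simp)
  have hproj : ∀ x, ((proj x : LinearMap.ker L) : Fin (m + 1) → ℤ) = x - l x • w := fun x => rfl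
  let φ : (Fin m → ℤ) →ₗ[ℤ] (Fin (m + 1) → ℤ) :=
    (LinearMap.ker L).subtype.comp b.equivFun.symm.toLinearMap
  let ψ : (Fin (m + 1) → ℤ) →ₗ[ℤ] (Fin m → ℤ) := b.equivFun.toLinearMap.comp proj
  have hφ : ∀ u, l (φ u) = 0 := fun u => (b.equivFun.symm u).2
  refine ⟨φ.toAddMonoidHom, ψ.toAddMonoidHom, hφ, fun u t => ?_, fun x => ?_⟩
  · have : proj (φ u + t • w) = b.equivFun.symm u := by
      apply Subtype.ext
      rw [hproj, map_add, map_zsmul, hw, hφ]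
      simp [φ]
    change b.equivFun (proj (φ u + t • w)) = u
    rw [this, LinearEquiv.apply_symm_apply]
  · change ((b.equivFun.symm (b.equivFun (proj x)) : LinearMap.ker L) : Fin (m + 1) → ℤ) + _ = x
    rw [LinearEquiv.symm_apply_apply, hproj]
    simp

/-- The number of lattice points of a polyhedron. -/
def latticeCount {d : ℕ} {I : Type*} (ρ : I → (Fin d → ℤ) →+ ℤ) (b : I → ℤ) : ℕ :=
  {x | ∀ i, ρ i x ≤ b i}.ncard

variable {m : ℕ} {I : Type*} [Fintype I] {ρ : I → (Fin (m + 1) → ℤ) →+ ℤ} {β : I → ℤ}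
  {C : ℕ}

lemma abs_le_of_mul_add {d : ℕ} {ρ : I → (Fin d → ℤ) →+ ℤ}
    (hC : ∀ (b : I → ℤ) x, (∀ i, ρ i x ≤ b i) → ∀ k, |x k| ≤ C * ∑ i, |b i|)
    {n : ℕ} (hn : 0 < n) (c : I → ℤ) {x : Fin d → ℤ} (hx : ∀ i, ρ i x ≤ n * β i + c i) (k) :
    |x k| ≤ (C * ∑ i, (|β i| + |c i|)) * n := by
  refine (hC _ x hx k).trans ?_
  rw [mul_assoc, Finset.sum_mul]
  refine mul_le_mul_of_nonneg_left (Finset.sum_le_sum fun i _ => ?_) (by positivity)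
  refine (abs_add_le _ _).trans ?_
  have hn' : (1 : ℤ) ≤ n := by exact_mod_cast hn
  rw [abs_mul, Nat.abs_cast]
  nlinarith [abs_nonneg (c i), abs_nonneg (β i)]

lemma finite_polyhedron {d : ℕ} {ρ : I → (Fin d → ℤ) →+ ℤ}
    (hC : ∀ (b : I → ℤ) x, (∀ i, ρ i x ≤ b i) → ∀ k, |x k| ≤ C * ∑ i, |b i|) (b : I → ℤ) :
    {x | ∀ i, ρ i x ≤ b i}.Finite :=
  finite_of_forall_abs_le (hC b)

/-- The forms take integral values, so raising one bound by `1` adds a single lattice slice. This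
relates changes of the count to counts in dimension one less. -/
lemma latticeCount_add_single [DecidableEq I]
    (hC : ∀ (b : I → ℤ) x, (∀ i, ρ i x ≤ b i) → ∀ k, |x k| ≤ C * ∑ i, |b i|) (b : I → ℤ) (i : I) :
    latticeCount ρ (b + Pi.single i 1) =
      latticeCount ρ b + {x | ρ i x = b i + 1 ∧ ∀ j, j ≠ i → ρ j x ≤ b j}.ncard := by
  have hsub : {x | ρ i x = b i + 1 ∧ ∀ j, j ≠ i → ρ j x ≤ b j} ⊆
      {x | ∀ j, ρ j x ≤ (b + Pi.single i 1 : I → ℤ) j} := by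
    rintro x ⟨h1, h2⟩ j
    by_cases h : j = i
    · subst h; simp [h1]
    · simpa [h] using h2 j h
  rw [latticeCount, latticeCount, ← Set.ncard_union_eq ?_ (finite_polyhedron hC b)
    ((finite_polyhedron hC _).subset hsub)]
  · congr 1
    ext x
    simp only [Set.mem_union, Set.mem_ofPred_eq, Pi.add_apply]
    constructor
    · intro h
      by_cases hi : ρ i x ≤ b i
      · left
        intro j
        by_cases hj : j = i
        · subst hj; exact hi
        · simpa [hj] using h j
      · right
        refine ⟨?_, fun j hj => by simpa [hj] using h j⟩
        have := h i
        simp at this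
        omega
    · rintro (h | h)
      · intro j
        have := h j
        by_cases hj : j = i
        · subst hj; simp; omega
        · simpa [hj] using this
      · exact hsub h
  · rw [Set.disjoint_left]
    rintro x h ⟨h1, -⟩
    have := h i
    omega

/-- The number of lattice points in a facet of a dilated polytope. -/
lemma tendsto_facet_card
    (hC : ∀ (b : I → ℤ) x, (∀ i, ρ i x ≤ b i) → ∀ k, |x k| ≤ C * ∑ i, |b i|) (i : I)
    (hprim : ∃ w, ρ i w = 1)
    (hne : ∀ j, j ≠ i → (∃ u, ρ i u = 0 ∧ ρ j u ≠ 0) ∨ (ρ j = -ρ i ∧ β i + β j ≠ 0)) :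
    ∃ L : ℝ, ∀ c : I → ℤ, Tendsto (fun n : ℕ =>
      ({x | ρ i x = n * β i + c i + 1 ∧ ∀ j, j ≠ i → ρ j x ≤ n * β j + c j}.ncard : ℝ) / (n : ℝ) ^ m)
      atTop (𝓝 L) := by
  classical
  obtain ⟨w, hw⟩ := hprim
  obtain ⟨φ, ψ, hφ, hψ, hφψ⟩ := exists_coordinates (ρ i) hw
  let ρ' : {j // j ≠ i} → (Fin m → ℤ) →+ ℤ := fun j => (ρ j).comp φ
  let β' : {j // j ≠ i} → ℤ := fun j => β j - β i * ρ j w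
  -- The limit does not depend on `c`, which enters the coordinates of the slice only through the
  -- bounded displacement `c'`.
  refine ⟨volume.real {y | ∀ j, realForm (ρ' j) y ≤ β' j}, fun c => ?_⟩
  let c' : {j // j ≠ i} → ℤ := fun j => c j - (c i + 1) * ρ j w
  have hiff : ∀ (n : ℕ) (u : Fin m → ℤ), (∀ j, ρ' j u ≤ n * β' j + c' j) ↔
      φ u + ((n : ℤ) * β i + c i + 1) • w ∈
        {x | ρ i x = n * β i + c i + 1 ∧ ∀ j, j ≠ i → ρ j x ≤ n * β j + c j} := by
    intro n u
    simp only [Set.mem_ofPred_eq, map_add, map_zsmul, hφ, hw, Subtype.forall, ρ', β', c',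
      AddMonoidHom.comp_apply, smul_eq_mul, zero_add, mul_one, true_and]
    refine forall₂_congr fun j hj => ?_
    constructor <;> intro h <;> linarith
  have hcard : ∀ n : ℕ,
      {x | ρ i x = n * β i + c i + 1 ∧ ∀ j, j ≠ i → ρ j x ≤ n * β j + c j}.ncard =
        {u | ∀ j, ρ' j u ≤ n * β' j + c' j}.ncard := by
    intro n
    symm
    refine Set.ncard_congr (fun u _ => φ u + ((n : ℤ) * β i + c i + 1) • w) ?_ ?_ ?_
    · intro u hu
      exact (hiff n u).1 hu
    · intro u v _ _ h
      have h1 := congrArg ψ h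
      rwa [hψ, hψ] at h1
    · intro x hx
      have h1 := hφψ x
      rw [hx.1] at h1
      refine ⟨ψ x, ?_, h1⟩
      rw [Set.mem_ofPred_eq, hiff, h1]
      exact hx
  simp only [hcard]
  let D : ℤ := ∑ k, ∑ j, |ψ (Pi.single j 1) k|
  let c₁ : I → ℤ := fun j => |c j| + 1
  refine tendsto_card_polyhedron ρ' β' c' (fun j => ?_)
    ((D * (C * ∑ i, (|β i| + |c₁ i|))).toNat) (fun n hn u hu k => ?_)
  -- If `ρ j = -ρ i`, the restricted form is zero and its bound is `β j + β i`, which is nonzero by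
  -- assumption.
  · rcases hne j j.2 with ⟨u, hu, hju⟩ | ⟨hj, hβ⟩
    · left
      intro h0
      have h1 := hφψ u
      rw [hu, zero_smul, add_zero] at h1
      apply hju
      rw [← h1]
      exact DFunLike.congr_fun h0 (ψ u)
    · right
      simp only [β', hj, AddMonoidHom.neg_apply, hw]
      intro h
      apply hβ
      linarith
  · have hx := (hiff n u).1 hu
    have hb := abs_le_of_mul_add (β := β) hC hn c₁ (x := φ u + ((n : ℤ) * β i + c i + 1) • w)
      (fun j => ?_)
    · have h1 := abs_form_le ((Pi.evalAddMonoidHom (fun _ : Fin m => ℤ) k).comp ψ) hb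
      have h2 : ((Pi.evalAddMonoidHom (fun _ : Fin m => ℤ) k).comp ψ)
          (φ u + ((n : ℤ) * β i + c i + 1) • w) = u k := by
        simp only [AddMonoidHom.comp_apply, hψ]
        rfl
      rw [h2] at h1
      refine h1.trans ?_
      have h3 : ∑ j, |((Pi.evalAddMonoidHom (fun _ : Fin m => ℤ) k).comp ψ) (Pi.single j 1)| ≤ D :=
        Finset.single_le_sum (f := fun k => ∑ j, |ψ (Pi.single j 1) k|)
          (fun k _ => Finset.sum_nonneg fun j _ => abs_nonneg _) (Finset.mem_univ k)
      have h4 : 0 ≤ (C * ∑ i, (|β i| + |c₁ i|)) * (n : ℤ) := by positivity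
      refine (mul_le_mul_of_nonneg_right h3 h4).trans ?_
      rw [← mul_assoc]
      exact mul_le_mul_of_nonneg_right (Int.self_le_toNat _) (by positivity)
    · by_cases hj : j = i
      · subst hj
        rw [hx.1]
        simp only [c₁]
        linarith [le_abs_self (c j)]
      · refine (hx.2 j hj).trans ?_
        simp only [c₁]
        linarith [le_abs_self (c j)]

/-- If every facet of a rational polytope is cut out by a primitive form with integral right hand
side, the numbers of lattice points in the `n`-th and `n + 1`-st dilation differ by
`L n ^ m + o(n ^ m)`. -/
lemma exists_tendsto_latticeCount_diff
    (hC : ∀ (b : I → ℤ) x, (∀ i, ρ i x ≤ b i) → ∀ k, |x k| ≤ C * ∑ i, |b i|)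
    (hprim : ∀ i, ∃ w, ρ i w = 1)
    (hne : ∀ i j, j ≠ i → (∃ u, ρ i u = 0 ∧ ρ j u ≠ 0) ∨ (ρ j = -ρ i ∧ β i + β j ≠ 0))
    (c c' : I → ℤ) :
    ∃ L : ℝ, Tendsto (fun n : ℕ => ((latticeCount ρ (fun i => n * β i + c' i) : ℝ) -
      latticeCount ρ (fun i => n * β i + c i)) / (n : ℝ) ^ m) atTop (𝓝 L) := by
  classical
  -- The relation `P` is an equivalence relation on displacements. It holds for displacements that
  -- differ by a unit vector, hence for all pairs.
  let P : (I → ℤ) → (I → ℤ) → Prop := fun c c' =>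
    ∃ L : ℝ, Tendsto (fun n : ℕ => ((latticeCount ρ (fun i => n * β i + c' i) : ℝ) -
      latticeCount ρ (fun i => n * β i + c i)) / (n : ℝ) ^ m) atTop (𝓝 L)
  have hrefl : ∀ c, P c c := fun c => ⟨0, by simp⟩
  have htrans : ∀ c c' c'', P c c' → P c' c'' → P c c'' := by
    rintro c c' c'' ⟨L, hL⟩ ⟨L', hL'⟩
    refine ⟨L + L', (hL.add hL').congr fun n => ?_⟩
    ring
  have hsymm : ∀ c c', P c c' → P c' c := by
    rintro c c' ⟨L, hL⟩
    refine ⟨-L, hL.neg.congr fun n => ?_⟩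
    ring
  have hstep : ∀ c i, P c (c + Pi.single i 1) := by
    intro c i
    obtain ⟨L, hL⟩ := tendsto_facet_card (β := β) hC i (hprim i) (hne i)
    refine ⟨L, (hL c).congr fun n => ?_⟩
    have h1 : (fun j => n * β j + (c + Pi.single i 1 : I → ℤ) j) =
        (fun j => (n : ℤ) * β j + c j) + Pi.single i 1 := by
      funext j; simp [add_assoc]
    rw [h1, latticeCount_add_single hC]
    push_cast
    ring
  have hmul : ∀ c i (k : ℤ), P c (c + Pi.single i k) := by
    intro c i k
    induction k using Int.induction_on with
    | zero => simpa using hrefl c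
    | succ k ih =>
      refine htrans _ _ _ ih ?_
      rw [Pi.single_add, ← add_assoc]
      exact hstep _ i
    | pred k ih =>
      refine htrans _ _ _ ih (hsymm _ _ ?_)
      have := hstep (c + Pi.single i (-(k : ℤ) - 1)) i
      rwa [add_assoc, ← Pi.single_add, sub_add_cancel] at this
  have hsum : ∀ (s : Finset I) (v : I → ℤ), P c (c + ∑ i ∈ s, Pi.single i (v i)) := by
    intro s v
    induction s using Finset.induction_on with
    | empty => simpa using hrefl c
    | insert i s hi ih =>
      rw [Finset.sum_insert hi, add_comm _ (∑ _ ∈ s, _), ← add_assoc]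
      exact htrans _ _ _ ih (hmul _ _ _)
  have := hsum Finset.univ (c' - c)
  rwa [Finset.univ_sum_single, add_sub_cancel] at this

end Slices

end ConicHK
end

/-! ### From real to integral solutions of linear systems -/

noncomputable section
namespace ConicHK

section Lattice

/-- A system of strict homogeneous rational inequalities with a real solution has an integral one. -/
lemma exists_int_of_pos {m : ℕ} {I : Type*} [Finite I] (ρ : I → (Fin m → ℤ) →+ ℤ)
    (y : Fin m → ℝ) (hy : ∀ i, 0 < realForm (ρ i) y) : ∃ x : Fin m → ℤ, ∀ i, 0 < ρ i x := by
  have hopen : IsOpen {y : Fin m → ℝ | ∀ i, 0 < realForm (ρ i) y} := by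
    simp only [Set.ofPred_forall]
    exact isOpen_iInter_of_finite fun i => isOpen_lt continuous_const (continuous_realForm _)
  -- A rational point is found in the open solution set; multiplication by a common denominator
  -- preserves the homogeneous inequalities.
  have hdense : DenseRange (Pi.map fun (_ : Fin m) (q : ℚ) => (q : ℝ)) :=
    DenseRange.piMap fun _ => Rat.denseRange_cast
  obtain ⟨r, hr⟩ := hdense.exists_mem_open hopen ⟨y, hy⟩
  let D : ℕ := ∏ j, (r j).den
  have hD : 0 < D := Finset.prod_pos fun j _ => (r j).den_pos
  have hint : ∀ j, ∃ k : ℤ, (D : ℚ) * r j = k := by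
    intro j
    obtain ⟨e, he⟩ := Finset.dvd_prod_of_mem (fun j => (r j).den) (Finset.mem_univ j)
    refine ⟨e * (r j).num, ?_⟩
    have h1 : (D : ℚ) = (r j).den * e := by exact_mod_cast he
    have h2 : (r j).den * r j = (r j).num := by
      rw [mul_comm]; exact Rat.mul_den_eq_num (r j)
    rw [h1]; push_cast; linear_combination (e : ℚ) * h2
  choose x hx using hint
  refine ⟨x, fun i => ?_⟩
  have h1 : ((ρ i x : ℤ) : ℝ) = D * realForm (ρ i) (Pi.map (fun (_ : Fin m) (q : ℚ) => (q : ℝ)) r) := by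
    rw [← realForm_castHom, realForm, realForm, Finset.mul_sum]
    refine Finset.sum_congr rfl fun j _ => ?_
    have : ((x j : ℤ) : ℝ) = D * r j := by exact_mod_cast (hx j).symm
    change _ * ((x j : ℤ) : ℝ) = _ * (_ * ((r j : ℚ) : ℝ))
    rw [this]; ring
  have h2 : (0 : ℝ) < (ρ i x : ℤ) := by
    rw [h1]
    have := hr i
    positivity
  exact_mod_cast h2

/-- A linear relation with nonnegative real coefficients between integral vectors can be replaced by
one with natural coefficients that are positive where the real coefficients are. -/
lemma exists_nat_relation {d : ℕ} {ι : Type*} [Fintype ι] (h : ι → Fin d → ℤ) (μ : ι → ℝ)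
    (hμ : ∀ j, 0 ≤ μ j) (hrel : ∑ j, μ j • castHom d (h j) = 0) :
    ∃ n : ι → ℕ, (∀ j, 0 < μ j → 0 < n j) ∧ ∑ j, n j • h j = 0 := by
  classical
  -- The `μ j` are expanded in a `ℚ`-basis `b` of their span. Since the `h j` are integral, the
  -- relation holds for each coordinate separately, and so it survives when `b` is replaced by an
  -- arbitrary integral vector.
  let V : Submodule ℚ ℝ := Submodule.span ℚ (Set.range μ)
  have : FiniteDimensional ℚ V := FiniteDimensional.span_of_finite ℚ (Set.finite_range μ)
  let b := Module.finBasis ℚ V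
  have hmem : ∀ j, μ j ∈ V := fun j => Submodule.subset_span ⟨j, rfl⟩
  let q : ι → Fin (Module.finrank ℚ V) → ℚ := fun j k => b.repr ⟨μ j, hmem j⟩ k
  have hq : ∀ j, μ j = ∑ k, (q j k : ℝ) * (b k : ℝ) := by
    intro j
    have := congrArg (fun v : V => (v : ℝ)) (b.sum_repr ⟨μ j, hmem j⟩)
    simp only [AddSubmonoidClass.coe_finsetSum, Submodule.coe_smul] at this
    rw [← this]
    refine Finset.sum_congr rfl fun k _ => ?_
    rw [Rat.smul_def]
  have hq0 : ∀ j, μ j = 0 → q j = 0 := by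
    intro j hj
    funext k
    have : (⟨μ j, hmem j⟩ : V) = 0 := Subtype.ext hj
    simp [q, this]
  have hrel' : ∀ k i, ∑ j, q j k * (h j i : ℚ) = 0 := by
    intro k i
    have h1 : ∑ j, (h j i : ℚ) • (⟨μ j, hmem j⟩ : V) = 0 := by
      apply Subtype.ext
      have := congrFun hrel i
      simp only [Finset.sum_apply, Pi.smul_apply, smul_eq_mul, Pi.zero_apply] at this
      simp only [AddSubmonoidClass.coe_finsetSum, Submodule.coe_smul, ZeroMemClass.coe_zero]
      rw [← this]
      refine Finset.sum_congr rfl fun j _ => ?_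
      rw [Rat.smul_def, mul_comm]
      simp [castHom]
    have h2 := congrArg (fun v => b.repr v k) h1
    simp only [map_sum, map_smul, Finsupp.coe_finsetSum, Finset.sum_apply, Finsupp.smul_apply,
      smul_eq_mul, map_zero, Finsupp.coe_zero, Pi.zero_apply] at h2
    rw [← h2]
    exact Finset.sum_congr rfl fun j _ => mul_comm _ _
  let D : ℕ := ∏ j, ∏ k, (q j k).den
  have hD : 0 < D := Finset.prod_pos fun j _ => Finset.prod_pos fun k _ => (q j k).den_pos
  have hint : ∀ j k, ∃ a : ℤ, (D : ℚ) * q j k = a := by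
    intro j k
    obtain ⟨e, he⟩ := (Finset.dvd_prod_of_mem (fun k => (q j k).den) (Finset.mem_univ k)).trans
      (Finset.dvd_prod_of_mem (fun j => ∏ k, (q j k).den) (Finset.mem_univ j))
    refine ⟨e * (q j k).num, ?_⟩
    have h1 : (D : ℚ) = (q j k).den * e := by exact_mod_cast he
    have h2 : (q j k).den * q j k = (q j k).num := by
      rw [mul_comm]; exact Rat.mul_den_eq_num (q j k)
    rw [h1]; push_cast; linear_combination (e : ℚ) * h2
  choose a ha using hint
  let ρ : ι → (Fin (Module.finrank ℚ V) → ℤ) →+ ℤ := fun j =>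
    ∑ k, a j k • Pi.evalAddMonoidHom (fun _ => ℤ) k
  have hρ : ∀ j x, ρ j x = ∑ k, a j k * x k := by
    intro j x
    simp [ρ, AddMonoidHom.finsetSum_apply]
  have hρb : ∀ j, realForm (ρ j) (fun k => (b k : ℝ)) = D * μ j := by
    intro j
    rw [realForm, hq, Finset.mul_sum]
    refine Finset.sum_congr rfl fun k _ => ?_
    have h1 : ρ j (Pi.single k 1) = a j k := by
      rw [hρ]; simp [Pi.single_apply]
    have h2 : ((a j k : ℤ) : ℝ) = D * q j k := by exact_mod_cast (ha j k).symm
    rw [h1, h2]; ring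
  -- The vector `b` itself makes these forms positive; an integral `x` with this property replaces
  -- it. The remaining forms are zero.
  obtain ⟨x, hx⟩ := exists_int_of_pos (fun j : {j // 0 < μ j} => ρ j) (fun k => (b k : ℝ))
    (fun j => by rw [hρb]; have := j.2; positivity)
  have hnonneg : ∀ j, 0 ≤ ρ j x := by
    intro j
    rcases (hμ j).lt_or_eq with h | h
    · exact (hx ⟨j, h⟩).le
    · have h0 : ∀ k, a j k = 0 := by
        intro k
        have := ha j k
        rw [hq0 j h.symm] at this
        simp at this
        exact_mod_cast this.symm
      simp [hρ, h0]
  refine ⟨fun j => (ρ j x).toNat, fun j hj => Int.lt_toNat.2 (hx ⟨j, hj⟩), ?_⟩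
  funext i
  have hz : ∑ j, ρ j x * h j i = 0 := by
    have h1 : ∀ k, ∑ j, a j k * h j i = 0 := by
      intro k
      have : ((∑ j, a j k * h j i : ℤ) : ℚ) = D * ∑ j, q j k * (h j i : ℚ) := by
        push_cast
        rw [Finset.mul_sum]
        refine Finset.sum_congr rfl fun j _ => ?_
        rw [← ha]; ring
      rw [hrel', mul_zero] at this
      exact_mod_cast this
    simp only [hρ, Finset.sum_mul]
    rw [Finset.sum_comm]
    refine Finset.sum_eq_zero fun k _ => ?_
    have := h1 k
    simp only [mul_right_comm, ← Finset.sum_mul, this, zero_mul]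
  rw [Finset.sum_apply, Pi.zero_apply, ← hz]
  refine Finset.sum_congr rfl fun j _ => ?_
  rw [Pi.smul_apply, nsmul_eq_mul, Int.toNat_of_nonneg (hnonneg _)]

end Lattice

/-! ### The cone, its lattice points and its support forms -/

section Cone

variable {d s : ℕ} {M : AddSubmonoid (Fin d → ℤ)} {σ : Fin s → Fin d → ℤ}

lemma mem_realCone_iff {y : Fin d → ℝ} : y ∈ realCone M ↔
    ∃ (n : ℕ) (c : Fin n → ℝ) (g : Fin n → M), (∀ i, 0 ≤ c i) ∧
      ∑ i, c i • castHom d (g i) = y := by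
  rw [realCone, PointedCone.hull, Submodule.mem_span_set']
  constructor
  · rintro ⟨n, f, g, rfl⟩
    choose g' hg' hgg using fun i => (g i).2
    refine ⟨n, fun i => f i, fun i => ⟨g' i, hg' i⟩, fun i => (f i).2, ?_⟩
    refine Finset.sum_congr rfl fun i _ => ?_
    rw [← hgg i]; rfl
  · rintro ⟨n, c, g, hc, rfl⟩
    refine ⟨n, fun i => ⟨c i, hc i⟩, fun i => ⟨castHom d (g i), g i, (g i).2, rfl⟩, ?_⟩
    rfl

lemma castHom_injective (d : ℕ) : Function.Injective (castHom d) := by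
  intro x y h
  funext i
  have : ((x i : ℤ) : ℝ) = y i := congrFun h i
  exact_mod_cast this

/-- A representation of `x` by nonnegative real coefficients becomes a relation `N x = ∑ n_i g_i`
with natural coefficients and `N > 0`, to which normality applies. -/
lemma castHom_mem_realCone_iff (hM : IsPositiveNormalAffine M) {x : Fin d → ℤ} :
    castHom d x ∈ realCone M ↔ x ∈ M := by
  refine ⟨fun h => ?_, fun h => Submodule.subset_span ⟨x, h, rfl⟩⟩
  obtain ⟨n, c, g, hc, hx⟩ := mem_realCone_iff.1 h
  obtain ⟨N, hN, hrel⟩ := exists_nat_relation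
    (fun o : Option (Fin n) => o.elim (-x) fun i => (g i : Fin d → ℤ))
    (fun o => o.elim 1 c) (by rintro (_ | i) <;> simp [hc]) (by
      rw [Fintype.sum_option]
      simp [hx])
  have hN0 : 0 < N none := hN none (by simp)
  rw [Fintype.sum_option] at hrel
  simp only [Option.elim_none, Option.elim_some, smul_neg] at hrel
  refine hM.normal x (N none) hN0 ?_
  rw [neg_add_eq_zero.1 hrel]
  exact sum_mem fun i _ => M.nsmul_mem (g i).2 _

/-- Adding representations of `y` and `-y` gives a relation between elements of `M`. After passing
to natural coefficients, every element that occurs with a positive coefficient has an invertible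
multiple, so it is `0` by positivity. -/
lemma realCone_pointed (hM : IsPositiveNormalAffine M) {y : Fin d → ℝ} (h : y ∈ realCone M)
    (h' : -y ∈ realCone M) : y = 0 := by
  obtain ⟨n, c, g, hc, hx⟩ := mem_realCone_iff.1 h
  obtain ⟨n', c', g', hc', hx'⟩ := mem_realCone_iff.1 h'
  obtain ⟨N, hN, hrel⟩ := exists_nat_relation
    (Sum.elim (fun i => (g i : Fin d → ℤ)) fun i => (g' i : Fin d → ℤ))
    (Sum.elim c c') (by rintro (i | i) <;> simp [hc, hc']) (by
      rw [Fintype.sum_sum_type]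
      simp [hx, hx'])
  rw [← hx]
  refine Finset.sum_eq_zero fun i _ => ?_
  rcases (hc i).lt_or_eq with hi | hi
  · have hNi : 0 < N (Sum.inl i) := hN _ hi
    classical
    have h1 : -(N (Sum.inl i) • (g i : Fin d → ℤ)) ∈ M := by
      rw [Fintype.sum_sum_type, ← Finset.add_sum_erase _ _ (Finset.mem_univ i), add_assoc] at hrel
      simp only [Sum.elim_inl, Sum.elim_inr] at hrel
      rw [neg_eq_of_add_eq_zero_right hrel]
      exact add_mem (sum_mem fun i _ => M.nsmul_mem (g i).2 _)
        (sum_mem fun i _ => M.nsmul_mem (g' i).2 _)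
    have h2 := hM.positive _ (M.nsmul_mem (g i).2 _) h1
    have h3 : (g i : Fin d → ℤ) = 0 := by
      rcases smul_eq_zero.1 h2 with h | h
      · omega
      · exact h
    rw [h3]; simp
  · rw [← hi, zero_smul]

/-- The linear form on `ℤ^d` with coefficient vector `a`. -/
def intForm (a : Fin d → ℤ) : (Fin d → ℤ) →+ ℤ :=
  ∑ j, a j • Pi.evalAddMonoidHom (fun _ => ℤ) j

lemma intForm_apply (a x : Fin d → ℤ) : intForm a x = ∑ j, a j * x j := by
  simp [intForm, AddMonoidHom.finsetSum_apply]

lemma realForm_intForm (a : Fin d → ℤ) : realForm (intForm a) = evalForm a := by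
  funext y
  refine Finset.sum_congr rfl fun j _ => ?_
  rw [intForm_apply]
  simp [Pi.single_apply]

lemma evalForm_castHom (a x : Fin d → ℤ) : evalForm a (castHom d x) = intForm a x := by
  rw [← realForm_intForm, realForm_castHom]

/-- The real linear form with coefficient vector `a`, as a linear map. -/
def evalLin (a : Fin d → ℤ) : (Fin d → ℝ) →ₗ[ℝ] ℝ := ∑ j, (a j : ℝ) • LinearMap.proj j

lemma evalLin_apply (a : Fin d → ℤ) (y : Fin d → ℝ) : evalLin a y = evalForm a y := by
  simp [evalLin, evalForm]

lemma evalForm_add (a : Fin d → ℤ) (x y : Fin d → ℝ) :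
    evalForm a (x + y) = evalForm a x + evalForm a y := by
  simp only [← evalLin_apply, map_add]

lemma evalForm_sub (a : Fin d → ℤ) (x y : Fin d → ℝ) :
    evalForm a (x - y) = evalForm a x - evalForm a y := by
  simp only [← evalLin_apply, map_sub]

lemma evalForm_smul (a : Fin d → ℤ) (c : ℝ) (y : Fin d → ℝ) :
    evalForm a (c • y) = c * evalForm a y := by
  simp only [← evalLin_apply, map_smul, smul_eq_mul]

lemma mem_monoid_iff (hM : IsPositiveNormalAffine M) (hσ : IsSupportForms M σ) {x : Fin d → ℤ} :
    x ∈ M ↔ ∀ i, 0 ≤ intForm (σ i) x := by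
  rw [← castHom_mem_realCone_iff hM, hσ.mem_iff]
  simp only [evalForm_castHom]
  exact_mod_cast Iff.rfl

lemma eq_zero_of_evalForm (hM : IsPositiveNormalAffine M) (hσ : IsSupportForms M σ)
    {y : Fin d → ℝ} (h : ∀ i, evalForm (σ i) y = 0) : y = 0 := by
  refine realCone_pointed hM ((hσ.mem_iff _).2 fun i => (h i).ge) ((hσ.mem_iff _).2 fun i => ?_)
  rw [← evalLin_apply, map_neg, evalLin_apply, h i, neg_zero]

lemma eq_zero_of_intForm (hM : IsPositiveNormalAffine M) (hσ : IsSupportForms M σ)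
    {x : Fin d → ℤ} (h : ∀ i, intForm (σ i) x = 0) : x = 0 := by
  apply castHom_injective d
  rw [map_zero]
  refine eq_zero_of_evalForm hM hσ fun i => ?_
  rw [evalForm_castHom, h i, Int.cast_zero]

/-- The image of the form is a subgroup `gℤ`, and `g` divides all coefficients. -/
lemma exists_intForm_eq_one (hσ : IsSupportForms M σ) (i : Fin s) :
    ∃ w, intForm (σ i) w = 1 := by
  obtain ⟨g, hg⟩ := Int.subgroup_cyclic (intForm (σ i)).range
  have hdvd : ∀ x, g ∣ intForm (σ i) x := by
    intro x
    have : intForm (σ i) x ∈ (intForm (σ i)).range := ⟨x, rfl⟩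
    rw [hg, AddSubgroup.mem_closure_singleton] at this
    obtain ⟨k, hk⟩ := this
    exact ⟨k, by rw [← hk, smul_eq_mul, mul_comm]⟩
  have h1 : g ∣ Finset.univ.gcd (σ i) := by
    refine Finset.dvd_gcd fun j _ => ?_
    have := hdvd (Pi.single j 1)
    rw [intForm_apply] at this
    simpa [Pi.single_apply] using this
  rw [hσ.primitive i] at h1
  have h2 : (1 : ℤ) ∈ (intForm (σ i)).range := by
    rw [hg, AddSubgroup.mem_closure_singleton]
    obtain ⟨k, hk⟩ := h1
    exact ⟨k, by rw [hk, smul_eq_mul, mul_comm]⟩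
  exact h2

/-- An interior lattice point of the cone. -/
lemma exists_interior (hM : IsPositiveNormalAffine M) (hσ : IsSupportForms M σ) :
    ∃ v, ∀ i, 0 < intForm (σ i) v := by
  have h1 : ∀ i, ∃ g ∈ M, 0 < intForm (σ i) g := by
    intro i
    by_contra hcon
    push Not at hcon
    have h0 : AddSubgroup.closure (M : Set (Fin d → ℤ)) ≤ (intForm (σ i)).ker := by
      rw [AddSubgroup.closure_le]
      intro g hg
      exact le_antisymm (hcon g hg) ((mem_monoid_iff hM hσ).1 hg i)
    rw [hM.gp] at h0
    obtain ⟨w, hw⟩ := exists_intForm_eq_one hσ i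
    have : intForm (σ i) w = 0 := h0 (AddSubgroup.mem_top w)
    omega
  choose g hg hpos using h1
  refine ⟨∑ i, g i, fun i => ?_⟩
  rw [map_sum]
  exact Finset.sum_pos' (fun j _ => (mem_monoid_iff hM hσ).1 (hg j) i) ⟨i, Finset.mem_univ i, hpos i⟩

/-- A lattice point in the relative interior of the `i`-th facet of the cone. -/
lemma exists_facet_interior (hM : IsPositiveNormalAffine M) (hσ : IsSupportForms M σ) (i : Fin s) :
    ∃ u, intForm (σ i) u = 0 ∧ ∀ j, j ≠ i → 0 < intForm (σ j) u := by
  obtain ⟨v, hv⟩ := exists_interior hM hσ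
  obtain ⟨x, hxi, hxj⟩ := hσ.irredundant i
  have hvi : (0 : ℝ) < intForm (σ i) v := by exact_mod_cast hv i
  -- With this choice `σ_i(x + ε v) = σ_i(x)/2` is still negative, while all other forms become
  -- positive. An integral `y` with the same signs exists.
  set ε : ℝ := -evalForm (σ i) x / (2 * intForm (σ i) v) with hε
  have hε0 : 0 < ε := by
    rw [hε]
    apply div_pos <;> linarith
  obtain ⟨y, hy⟩ := exists_int_of_pos
    (fun j => if j = i then -intForm (σ j) else intForm (σ j)) (x + ε • castHom d v) (by
      intro j
      by_cases hj : j = i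
      · subst hj
        have h1 : realForm (-intForm (σ j)) (x + ε • castHom d v) =
            -evalForm (σ j) (x + ε • castHom d v) := by
          rw [← realForm_intForm]; simp [realForm]
        simp only [if_true]
        rw [h1, evalForm_add, evalForm_smul, evalForm_castHom, hε]
        field_simp
        linarith
      · simp only [hj, if_false]
        rw [realForm_intForm, evalForm_add, evalForm_smul, evalForm_castHom]
        have h1 := hxj j hj
        have h2 : (0 : ℝ) < intForm (σ j) v := by exact_mod_cast hv j
        positivity)
  have hyi : intForm (σ i) y < 0 := by simpa using hy i
  -- The positive combination of `v` and `y` in which the values of `σ_i` cancel.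
  refine ⟨(-intForm (σ i) y) • v + intForm (σ i) v • y, ?_, fun j hj => ?_⟩
  · rw [map_add, map_zsmul, map_zsmul, smul_eq_mul, smul_eq_mul]; ring
  · have hyj : 0 < intForm (σ j) y := by simpa [hj] using hy j
    rw [map_add, map_zsmul, map_zsmul, smul_eq_mul, smul_eq_mul]
    have := hv i
    have := hv j
    have : 0 < -intForm (σ i) y := by omega
    positivity

/-- The half-spaces `σ_i ≥ a_i` are all needed to describe the lattice points of their
intersection. -/
lemma exists_attaining (hM : IsPositiveNormalAffine M) (hσ : IsSupportForms M σ) (a : Fin s → ℤ)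
    (i : Fin s) : ∃ x, intForm (σ i) x = a i ∧ ∀ j, a j ≤ intForm (σ j) x := by
  obtain ⟨u, hui, huj⟩ := exists_facet_interior hM hσ i
  obtain ⟨w, hw⟩ := exists_intForm_eq_one hσ i
  -- `a_i w` lies on the required hyperplane; moving it by a large multiple of `u` keeps it there
  -- and makes all other forms large.
  let N : ℤ := ∑ j, |a j - a i * intForm (σ j) w|
  have h1 : intForm (σ i) (a i • w + N • u) = a i := by
    rw [map_add, map_zsmul, map_zsmul, hw, hui]; simp
  refine ⟨a i • w + N • u, h1, fun j => ?_⟩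
  by_cases hj : j = i
  · subst hj; exact h1.ge
  · rw [map_add, map_zsmul, map_zsmul, smul_eq_mul, smul_eq_mul]
    have h2 : |a j - a i * intForm (σ j) w| ≤ N :=
      Finset.single_le_sum (f := fun j => |a j - a i * intForm (σ j) w|)
        (fun _ _ => abs_nonneg _) (Finset.mem_univ j)
    have h3 := le_abs_self (a j - a i * intForm (σ j) w)
    have h4 : 1 ≤ intForm (σ j) u := huj j hj
    have h5 : 0 ≤ N := (abs_nonneg _).trans h2
    nlinarith

/-- The values of the support forms bound the coordinates. -/
lemma exists_coordinate_bound (hM : IsPositiveNormalAffine M) (hσ : IsSupportForms M σ) :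
    ∃ C : ℕ, ∀ (y : Fin d → ℝ) k, |y k| ≤ C * ∑ i, |evalForm (σ i) y| := by
  let L : (Fin d → ℝ) →ₗ[ℝ] (Fin s → ℝ) := LinearMap.pi fun i => evalLin (σ i)
  have hL : LinearMap.ker L = ⊥ := by
    rw [LinearMap.ker_eq_bot']
    intro y hy
    exact eq_zero_of_evalForm hM hσ fun i => by
      rw [← evalLin_apply]; exact congrFun hy i
  obtain ⟨g, hg⟩ := LinearMap.exists_leftInverse_of_injective L hL
  obtain ⟨C, hC⟩ := exists_nat_ge (∑ k, ∑ i, |g (Pi.single i 1) k|)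
  refine ⟨C, fun y k => ?_⟩
  have h1 : y k = ∑ i, evalForm (σ i) y * g (Pi.single i 1) k := by
    have h2 : g (L y) = y := LinearMap.congr_fun hg y
    have h3 : L y = ∑ i, (evalForm (σ i) y) • Pi.single i 1 := by
      funext i
      simp [L, evalLin_apply, Finset.sum_apply, Pi.single_apply]
    conv_lhs => rw [← h2, h3, map_sum]
    simp [Finset.sum_apply]
  rw [h1, Finset.mul_sum]
  refine (Finset.abs_sum_le_sum_abs _ _).trans (Finset.sum_le_sum fun i _ => ?_)
  rw [abs_mul, mul_comm]
  refine mul_le_mul_of_nonneg_right (le_trans ?_ hC) (abs_nonneg _)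
  refine (Finset.single_le_sum (f := fun i => |g (Pi.single i 1) k|) (fun _ _ => abs_nonneg _)
    (Finset.mem_univ i)).trans ?_
  exact Finset.single_le_sum (f := fun k => ∑ i, |g (Pi.single i 1) k|)
    (fun _ _ => Finset.sum_nonneg fun _ _ => abs_nonneg _) (Finset.mem_univ k)

end Cone

end ConicHK
end

/-! ### Cells and the number of lattice points in their dilations -/

noncomputable section
namespace ConicHK

section Cells

variable {d s : ℕ} {M : AddSubmonoid (Fin d → ℤ)} {σ : Fin s → Fin d → ℤ}

/-- The open cell with upper bounds `z`. -/
def openCell (σ : Fin s → Fin d → ℤ) (z : Fin s → ℤ) : Set (Fin d → ℝ) :=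
  {x | ∀ i, (z i : ℝ) - 1 < evalForm (σ i) x ∧ evalForm (σ i) x < z i}

/-- The values of the forms at a lattice point. -/
def formValues (σ : Fin s → Fin d → ℤ) : (Fin d → ℤ) →+ (Fin s → ℤ) :=
  AddMonoidHom.mk' (fun x i => intForm (σ i) x) fun x y => by funext i; simp

lemma formValues_apply (x : Fin d → ℤ) (i : Fin s) : formValues σ x i = intForm (σ i) x := rfl

lemma ceil_of_mem_openCell {z : Fin s → ℤ} {y : Fin d → ℝ} (hy : y ∈ openCell σ z) (i : Fin s) :
    ⌈evalForm (σ i) y⌉ = z i :=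
  Int.ceil_eq_iff.2 ⟨(hy i).1, (hy i).2.le⟩

lemma openCell_injective {z z' : Fin s → ℤ} (h : (openCell σ z).Nonempty)
    (hz : openCell σ z = openCell σ z') : z = z' := by
  obtain ⟨y, hy⟩ := h
  funext i
  rw [← ceil_of_mem_openCell hy, ceil_of_mem_openCell (hz ▸ hy)]

lemma cellUpperClosure_openCell {z : Fin s → ℤ} (h : (openCell σ z).Nonempty) :
    cellUpperClosure σ (openCell σ z) = {x | ∀ i, ⌈evalForm (σ i) x⌉ = z i} := by
  obtain ⟨y, hy⟩ := h
  ext x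
  constructor
  · intro hx i
    rw [hx y hy i, ceil_of_mem_openCell hy]
  · intro hx y' hy' i
    rw [hx i, ceil_of_mem_openCell hy']

lemma translate_openCell (z : Fin s → ℤ) (t : Fin d → ℤ) :
    (fun x => castHom d t + x) '' openCell σ z = openCell σ (z + formValues σ t) := by
  ext x
  simp only [Set.mem_image, openCell, Set.mem_ofPred_eq, Pi.add_apply, formValues_apply, Int.cast_add]
  constructor
  · rintro ⟨y, hy, rfl⟩ i
    rw [evalForm_add, evalForm_castHom]
    constructor <;> linarith [(hy i).1, (hy i).2]
  · intro hx
    refine ⟨x - castHom d t, fun i => ?_, by simp⟩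
    rw [evalForm_sub, evalForm_castHom]
    constructor <;> linarith [(hx i).1, (hx i).2]

/-- Every point lies in the upper closure of an open cell. -/
lemma openCell_ceil_nonempty (hM : IsPositiveNormalAffine M) (hσ : IsSupportForms M σ)
    (y : Fin d → ℝ) : (openCell σ fun i => ⌈evalForm (σ i) y⌉).Nonempty := by
  obtain ⟨v, hv⟩ := exists_interior hM hσ
  -- Moving `y` slightly in the direction `-v` decreases all forms strictly, but not down to the
  -- next lower integer, so integral values are left and the ceilings stay the same.
  have hev : ∀ i, ∀ᶠ ε : ℝ in 𝓝[>] 0, (⌈evalForm (σ i) y⌉ : ℝ) - 1 <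
      evalForm (σ i) (y - ε • castHom d v) ∧ evalForm (σ i) (y - ε • castHom d v) <
        ⌈evalForm (σ i) y⌉ := by
    intro i
    have hvi : (0 : ℝ) < intForm (σ i) v := by exact_mod_cast hv i
    have h1 : (⌈evalForm (σ i) y⌉ : ℝ) - 1 < evalForm (σ i) y := by
      linarith [Int.ceil_lt_add_one (evalForm (σ i) y)]
    have h2 : Tendsto (fun ε : ℝ => evalForm (σ i) y - ε * intForm (σ i) v) (𝓝[>] 0)
        (𝓝 (evalForm (σ i) y)) := by
      have : Tendsto (fun ε : ℝ => evalForm (σ i) y - ε * intForm (σ i) v) (𝓝 0)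
          (𝓝 (evalForm (σ i) y - 0 * intForm (σ i) v)) := by
        apply Continuous.tendsto; fun_prop
      rw [zero_mul, sub_zero] at this
      exact this.mono_left nhdsWithin_le_nhds
    filter_upwards [h2.eventually (lt_mem_nhds h1), self_mem_nhdsWithin] with ε hε hε0
    rw [evalForm_sub, evalForm_smul, evalForm_castHom]
    refine ⟨hε, ?_⟩
    have : 0 < ε * intForm (σ i) v := mul_pos hε0 hvi
    linarith [Int.le_ceil (evalForm (σ i) y)]
  obtain ⟨ε, hε⟩ := (eventually_all.2 hev).exists
  exact ⟨_, hε⟩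

/-- The number of points of `(1/n)ℤ^d` in the upper closure of the cell with upper bounds `z`. -/
def cellCount (σ : Fin s → Fin d → ℤ) (z : Fin s → ℤ) (n : ℕ) : ℕ :=
  {x : Fin d → ℤ | ∀ i, (n : ℤ) * (z i - 1) < intForm (σ i) x ∧ intForm (σ i) x ≤ n * z i}.ncard

/-- The forms `σ_i` and `-σ_i`. -/
def signedForms (σ : Fin s → Fin d → ℤ) : Fin s ⊕ Fin s → (Fin d → ℤ) →+ ℤ :=
  Sum.elim (fun i => intForm (σ i)) fun i => -intForm (σ i)

/-- The bounds of the forms `σ_i` and `-σ_i` on the closed cell. -/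
def signedBounds (z : Fin s → ℤ) : Fin s ⊕ Fin s → ℤ := Sum.elim z fun i => 1 - z i

/-- The displacement of the bounds that removes the lower facets. -/
def signedShift (s : ℕ) : Fin s ⊕ Fin s → ℤ := Sum.elim (fun _ => 0) fun _ => -1

lemma cellCount_eq (z : Fin s → ℤ) (n : ℕ) : cellCount σ z n =
    latticeCount (signedForms σ) fun i => n * signedBounds z i + signedShift s i := by
  unfold cellCount latticeCount
  congr 1
  ext x
  simp only [Set.mem_ofPred_eq, Sum.forall, signedForms, signedBounds, signedShift, Sum.elim_inl,
    Sum.elim_inr, AddMonoidHom.neg_apply, forall_and]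
  rw [and_comm]
  refine and_congr (forall_congr' fun i => by rw [add_zero]) (forall_congr' fun i => ?_)
  rw [mul_sub, mul_sub]
  constructor <;> intro h <;> linarith

lemma signedForms_bound (hM : IsPositiveNormalAffine M) (hσ : IsSupportForms M σ) :
    ∃ C : ℕ, ∀ (b : Fin s ⊕ Fin s → ℤ) x, (∀ i, signedForms σ i x ≤ b i) →
      ∀ k, |x k| ≤ C * ∑ i, |b i| := by
  obtain ⟨C, hC⟩ := exists_coordinate_bound hM hσ
  refine ⟨C, fun b x hx k => ?_⟩
  have h1 := hC (castHom d x) k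
  simp only [evalForm_castHom] at h1
  have h2 : |x k| ≤ C * ∑ i, |intForm (σ i) x| := by
    have : (castHom d x) k = (x k : ℝ) := rfl
    rw [this] at h1
    exact_mod_cast h1
  refine h2.trans (mul_le_mul_of_nonneg_left ?_ (by positivity))
  rw [Fintype.sum_sum_type, ← Finset.sum_add_distrib]
  refine Finset.sum_le_sum fun i _ => ?_
  have h3 : intForm (σ i) x ≤ b (Sum.inl i) := hx (Sum.inl i)
  have h4 : -intForm (σ i) x ≤ b (Sum.inr i) := hx (Sum.inr i)
  rw [abs_le]
  constructor <;> linarith [le_abs_self (b (Sum.inl i)), le_abs_self (b (Sum.inr i)),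
    abs_nonneg (b (Sum.inl i)), abs_nonneg (b (Sum.inr i))]

lemma intForm_ne_zero (hσ : IsSupportForms M σ) (i : Fin s) : intForm (σ i) ≠ 0 := by
  obtain ⟨w, hw⟩ := exists_intForm_eq_one hσ i
  intro h
  rw [h] at hw
  simp at hw

lemma signedForms_ne_zero (hσ : IsSupportForms M σ) (i : Fin s ⊕ Fin s) : signedForms σ i ≠ 0 := by
  rcases i with i | i
  · exact intForm_ne_zero hσ i
  · exact neg_ne_zero.2 (intForm_ne_zero hσ i)

/-- The open and the closed cell differ by pieces of hyperplanes. The closed cell is the limit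
polytope for the half-open one that is counted. -/
lemma volume_openCell (hσ : IsSupportForms M σ) (z : Fin s → ℤ) :
    volume (openCell σ z) =
      volume {y | ∀ i, realForm (signedForms σ i) y ≤ signedBounds z i} := by
  refine measure_congr ?_
  have hae : ∀ᵐ y : Fin d → ℝ, ∀ i, realForm (signedForms σ i) y ≠ signedBounds z i :=
    ae_all_iff.2 fun i => by
      rw [ae_iff]
      simpa using volume_realForm_eq (Or.inl (signedForms_ne_zero hσ i))
  filter_upwards [hae] with y hy
  rw [eq_iff_iff]
  have hneg : ∀ i, realForm (-intForm (σ i)) y = -evalForm (σ i) y := fun i => by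
    rw [← realForm_intForm]; simp [realForm]
  simp only [Sum.forall, signedForms, signedBounds, Sum.elim_inl, Sum.elim_inr, realForm_intForm,
    hneg] at hy
  change y ∈ openCell σ z ↔ ∀ i, realForm (signedForms σ i) y ≤ signedBounds z i
  simp only [Sum.forall, signedForms, signedBounds, Sum.elim_inl, Sum.elim_inr, realForm_intForm,
    hneg, openCell, Set.mem_ofPred_eq]
  constructor
  · intro h
    refine ⟨fun i => (h i).2.le, fun i => ?_⟩
    push_cast
    linarith [(h i).1]
  · rintro ⟨h1, h2⟩ i
    have h3 := lt_of_le_of_ne (h2 i) (hy.2 i)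
    push_cast at h3
    exact ⟨by linarith, lt_of_le_of_ne (h1 i) (hy.1 i)⟩

lemma tendsto_cellCount (hM : IsPositiveNormalAffine M) (hσ : IsSupportForms M σ)
    (z : Fin s → ℤ) :
    Tendsto (fun n : ℕ => (cellCount σ z n : ℝ) / (n : ℝ) ^ d) atTop
      (𝓝 (volume.real (openCell σ z))) := by
  obtain ⟨C, hC⟩ := signedForms_bound hM hσ
  simp only [cellCount_eq]
  rw [Measure.real, volume_openCell hσ]
  refine tendsto_card_polyhedron _ _ _ (fun i => Or.inl (signedForms_ne_zero hσ i))
    (C * ∑ i, (|signedBounds z i| + |signedShift s i|)).toNat fun n hn x hx k => ?_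
  refine (abs_le_of_mul_add hC hn _ hx k).trans ?_
  exact mul_le_mul_of_nonneg_right (Int.self_le_toNat _) (by positivity)

lemma exists_quasiPolyFun_cellCount (hM : IsPositiveNormalAffine M) (hσ : IsSupportForms M σ)
    (z : Fin s → ℤ) : ∃ q ∈ quasiPolyFun ℤ, ∀ n : ℕ, 0 < n → q n = cellCount σ z n := by
  obtain ⟨C, hC⟩ := signedForms_bound hM hσ
  obtain ⟨q, hq, h⟩ := exists_quasiPolyFun_card (fun i => intForm (σ i)) z
    (fun i => -intForm (σ i)) (fun i => 1 - z i)
    -- The summand `1` makes the estimate strict, as the summation box is half-open.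
    ((C * ∑ i, |signedBounds z i|).toNat + 1) (by
      intro n x hn h1 h2 k
      have h3 := hC (fun i => n * signedBounds z i) x (by
        rintro (i | i)
        · exact h1 i
        · exact (h2 i).le) k
      have h4 : |x k| < n * ((C * ∑ i, |signedBounds z i|).toNat + 1 : ℕ) := by
        refine h3.trans_lt ?_
        simp only [abs_mul, ← Finset.mul_sum, abs_of_pos hn]
        push_cast
        have := Int.self_le_toNat (C * ∑ i, |signedBounds z i|)
        nlinarith
      rw [abs_lt] at h4
      exact ⟨h4.1.le, h4.2⟩)
  refine ⟨q, hq, fun n hn => ?_⟩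
  rw [h n (by exact_mod_cast hn), cellCount]
  congr 2
  ext x
  simp only [Set.mem_ofPred_eq, forall_and, AddMonoidHom.neg_apply]
  rw [and_comm]
  refine and_congr_left' (forall_congr' fun i => ?_)
  rw [mul_sub, mul_sub]
  constructor <;> intro h <;> linarith

/-- The cell is bounded by primitive forms with integral right hand sides. The forms of two facets
are independent, except for `σ_i` and `-σ_i`, whose bounds `z_i` and `1 - z_i` have sum `1 ≠ 0`. -/
lemma exists_tendsto_cellCount_diff {m : ℕ} {M : AddSubmonoid (Fin (m + 1) → ℤ)}
    {σ : Fin s → Fin (m + 1) → ℤ} (hM : IsPositiveNormalAffine M) (hσ : IsSupportForms M σ)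
    (z : Fin s → ℤ) :
    ∃ L : ℝ, Tendsto (fun n : ℕ => ((cellCount σ z (n + 1) : ℝ) - cellCount σ z n) / (n : ℝ) ^ m)
      atTop (𝓝 L) := by
  obtain ⟨C, hC⟩ := signedForms_bound hM hσ
  have hprim : ∀ i, ∃ w, signedForms σ i w = 1 := by
    rintro (i | i)
    · exact exists_intForm_eq_one hσ i
    · obtain ⟨w, hw⟩ := exists_intForm_eq_one hσ i
      exact ⟨-w, by simp [signedForms, hw]⟩
  have hne : ∀ i j, j ≠ i → (∃ u, signedForms σ i u = 0 ∧ signedForms σ j u ≠ 0) ∨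
      (signedForms σ j = -signedForms σ i ∧ signedBounds z i + signedBounds z j ≠ 0) := by
    have hfacet : ∀ i j : Fin s, j ≠ i → ∃ u, intForm (σ i) u = 0 ∧ intForm (σ j) u ≠ 0 := by
      intro i j hij
      obtain ⟨u, hu, hu'⟩ := exists_facet_interior hM hσ i
      exact ⟨u, hu, (hu' j hij).ne'⟩
    rintro (i | i) (j | j) hij
    · left
      exact hfacet i j (by simpa using hij)
    · by_cases h : j = i
      · right
        subst h
        simp [signedForms, signedBounds]
      · left
        obtain ⟨u, hu, hu'⟩ := hfacet i j h
        exact ⟨u, hu, by simpa [signedForms] using hu'⟩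
    · by_cases h : j = i
      · right
        subst h
        simp [signedForms, signedBounds]
      · left
        obtain ⟨u, hu, hu'⟩ := hfacet i j h
        exact ⟨u, by simpa [signedForms] using hu, by simpa [signedForms] using hu'⟩
    · left
      obtain ⟨u, hu, hu'⟩ := hfacet i j (by simpa using hij)
      exact ⟨u, by simpa [signedForms] using hu, by simpa [signedForms] using hu'⟩
  -- Displacing all bounds by `signedBounds z` replaces `n` by `n + 1`.
  obtain ⟨L, hL⟩ := exists_tendsto_latticeCount_diff hC hprim hne (signedShift s)
    (fun i => signedBounds z i + signedShift s i)
  refine ⟨L, hL.congr fun n => ?_⟩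
  rw [cellCount_eq, cellCount_eq]
  congr 5
  funext i
  push_cast
  ring

variable {T : Set (Set (Fin d → ℝ))}

lemma isOpenCell_openCell {z : Fin s → ℤ} (h : (openCell σ z).Nonempty) :
    IsOpenCell σ (openCell σ z) := ⟨h, z, rfl⟩

/-- There are only finitely many orbits of open cells under translation. -/
lemma finite_of_isCellRepresentatives (hT : IsCellRepresentatives σ T) : T.Finite := by
  have key : ∀ γ ∈ T, ∃ (z : Fin s → ℤ) (t : Fin d → ℤ), (openCell σ z).Nonempty ∧
      openCell σ z = (fun x => castHom d t + x) '' γ ∧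
      ∀ i, |z i| ≤ (∑ j, |σ i j|) + 1 := by
    intro γ hγ
    obtain ⟨⟨y, hy⟩, z, hz⟩ := hT.isOpenCell γ hγ
    have hz' : γ = openCell σ z := hz
    -- The translation by `t` moves `y` into the unit cube, which leaves only finitely many
    -- possibilities for the bounds of the translated cell.
    let t : Fin d → ℤ := fun j => -⌊y j⌋
    refine ⟨z + formValues σ t, t, ?_, ?_, fun i => ?_⟩
    · rw [← translate_openCell, ← hz']
      exact ⟨_, y, hy, rfl⟩
    · rw [← translate_openCell, ← hz']
    · have hmem : castHom d t + y ∈ openCell σ (z + formValues σ t) := by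
        rw [← translate_openCell, ← hz']
        exact ⟨y, hy, rfl⟩
      have hyf : ∀ j, |(castHom d t + y) j| ≤ 1 := by
        intro j
        have h1 : (castHom d t + y) j = Int.fract (y j) := by
          rw [Int.fract]
          change (((-⌊y j⌋ : ℤ) : ℝ)) + y j = _
          push_cast
          ring
        rw [h1, abs_of_nonneg (Int.fract_nonneg _)]
        exact (Int.fract_lt_one _).le
      have h2 : |evalForm (σ i) (castHom d t + y)| ≤ ∑ j, |(σ i j : ℝ)| := by
        refine (Finset.abs_sum_le_sum_abs _ _).trans (Finset.sum_le_sum fun j _ => ?_)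
        rw [abs_mul]
        exact mul_le_of_le_one_right (abs_nonneg _) (hyf j)
      have h3 := hmem i
      have h4 : |((z + formValues σ t) i : ℝ)| ≤ (∑ j, |(σ i j : ℝ)|) + 1 := by
        rw [abs_le] at h2 ⊢
        constructor <;> linarith [h3.1, h3.2]
      exact_mod_cast h4
  choose! z t h1 h2 h3 using key
  have hinj : Set.InjOn z T := by
    intro γ hγ γ' hγ' hzz
    obtain ⟨γ₀, -, huniq⟩ := hT.existsUnique _ (isOpenCell_openCell (h1 γ hγ))
    rw [huniq γ ⟨hγ, t γ, h2 γ hγ⟩, huniq γ' ⟨hγ', t γ', hzz ▸ h2 γ' hγ'⟩]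
  refine Set.Finite.of_finite_image ?_ hinj
  refine (Set.finite_Icc (fun i => -((∑ j, |σ i j|) + 1)) fun i => (∑ j, |σ i j|) + 1).subset ?_
  rintro _ ⟨γ, hγ, rfl⟩
  exact ⟨fun i => (abs_le.1 (h3 γ hγ i)).1, fun i => (abs_le.1 (h3 γ hγ i)).2⟩

/-- The upper bounds of an open cell. -/
def cellBounds (σ : Fin s → Fin d → ℤ) (γ : Set (Fin d → ℝ)) : Fin s → ℤ :=
  open Classical in if h : IsOpenCell σ γ then h.2.choose else 0

lemma openCell_cellBounds {γ : Set (Fin d → ℝ)} (h : IsOpenCell σ γ) :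
    openCell σ (cellBounds σ γ) = γ := by
  rw [cellBounds, dif_pos h]
  exact h.2.choose_spec.symm

lemma existsUnique_representative (hT : IsCellRepresentatives σ T) {z : Fin s → ℤ}
    (h : (openCell σ z).Nonempty) :
    ∃! γ, γ ∈ T ∧ ∃ t, z = cellBounds σ γ + formValues σ t := by
  have hiff : ∀ γ ∈ T, (∃ t, openCell σ z = (fun x => castHom d t + x) '' γ) ↔
      ∃ t, z = cellBounds σ γ + formValues σ t := by
    intro γ hγ
    refine exists_congr fun t => ?_
    conv_lhs => rw [← openCell_cellBounds (hT.isOpenCell γ hγ), translate_openCell]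
    exact ⟨fun he => openCell_injective h he, fun he => by rw [← he]⟩
  obtain ⟨γ, ⟨hγ, ht⟩, huniq⟩ := hT.existsUnique _ (isOpenCell_openCell h)
  exact ⟨γ, ⟨hγ, (hiff γ hγ).1 ht⟩, fun γ' hγ' => huniq γ' ⟨hγ'.1, (hiff γ' hγ'.1).2 hγ'.2⟩⟩

end Cells

end ConicHK
end

/-! ### Modules spanned by monomials -/

noncomputable section
namespace ConicHK

section Supported

variable {K : Type*} [Field K] {N P P' : Type*} [AddCommMonoid N] [AddCommMonoid P]
  [AddCommMonoid P'] [Algebra (AddMonoidAlgebra K N) (AddMonoidAlgebra K P)]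
  [Algebra (AddMonoidAlgebra K N) (AddMonoidAlgebra K P')]

lemma single_smul_single {φ : N →+ P} (hφ : algebraMap (AddMonoidAlgebra K N) (AddMonoidAlgebra K P) =
    AddMonoidAlgebra.mapDomainRingHom K φ) (m : N) (r : K) (x : P) (c : K) :
    (AddMonoidAlgebra.single m r : AddMonoidAlgebra K N) • (AddMonoidAlgebra.single x c) =
      AddMonoidAlgebra.single (φ m + x) (r * c) := by
  rw [Algebra.smul_def, hφ]
  simp [AddMonoidAlgebra.single_mul_single]

lemma mem_supportedSubmodule {φ : N →+ P}
    (hφ : algebraMap (AddMonoidAlgebra K N) (AddMonoidAlgebra K P) =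
      AddMonoidAlgebra.mapDomainRingHom K φ) {A : Set P} {hA : ∀ m, ∀ x ∈ A, φ m + x ∈ A}
    {f : AddMonoidAlgebra K P} :
    f ∈ supportedSubmodule K φ hφ A hA ↔ ∀ x ∈ f.coeff.support, x ∈ A := Iff.rfl

lemma single_mem_supportedSubmodule {φ : N →+ P}
    (hφ : algebraMap (AddMonoidAlgebra K N) (AddMonoidAlgebra K P) =
      AddMonoidAlgebra.mapDomainRingHom K φ) {A : Set P} {hA : ∀ m, ∀ x ∈ A, φ m + x ∈ A}
    {x : P} (hx : x ∈ A) (c : K) :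
    AddMonoidAlgebra.single x c ∈ supportedSubmodule K φ hφ A hA := by
  intro y hy
  rw [AddMonoidAlgebra.coeff_single] at hy
  rw [Finset.mem_singleton.1 (Finsupp.support_single_subset hy)]
  exact hx

lemma sum_single_coeff {P : Type*} (f : AddMonoidAlgebra K P) :
    ∑ x ∈ f.coeff.support, AddMonoidAlgebra.single x (f.coeff x) = f := by
  apply AddMonoidAlgebra.coeff_injective
  rw [AddMonoidAlgebra.coeff_sum]
  exact f.coeff.sum_single

/-- The linear map given on monomials by a map of exponents that is equivariant under `N`. -/
def equivariantMap {φ : N →+ P} {φ' : N →+ P'}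
    (hφ : algebraMap (AddMonoidAlgebra K N) (AddMonoidAlgebra K P) =
      AddMonoidAlgebra.mapDomainRingHom K φ)
    (hφ' : algebraMap (AddMonoidAlgebra K N) (AddMonoidAlgebra K P') =
      AddMonoidAlgebra.mapDomainRingHom K φ') (τ : P → P')
    (hτ : ∀ m x, τ (φ m + x) = φ' m + τ x) :
    AddMonoidAlgebra K P →ₗ[AddMonoidAlgebra K N] AddMonoidAlgebra K P' where
  toFun f := AddMonoidAlgebra.ofCoeff (f.coeff.mapDomain τ)
  map_add' f g := by
    rw [AddMonoidAlgebra.coeff_add, Finsupp.mapDomain_add]; rfl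
  map_smul' r f := by
    have hadd : ∀ f g : AddMonoidAlgebra K P,
        AddMonoidAlgebra.ofCoeff ((f + g).coeff.mapDomain τ) =
        AddMonoidAlgebra.ofCoeff (f.coeff.mapDomain τ) +
        AddMonoidAlgebra.ofCoeff (g.coeff.mapDomain τ) := fun f g => by
      rw [AddMonoidAlgebra.coeff_add, Finsupp.mapDomain_add]; rfl
    have hsingle : ∀ x (c : K), AddMonoidAlgebra.ofCoeff
        ((AddMonoidAlgebra.single x c : AddMonoidAlgebra K P).coeff.mapDomain τ) =
        (AddMonoidAlgebra.single (τ x) c : AddMonoidAlgebra K P') := fun x c => by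
      rw [AddMonoidAlgebra.coeff_single, Finsupp.mapDomain_single]; rfl
    simp only [RingHom.id_apply]
    induction r using AddMonoidAlgebra.induction_linear with
    | zero => simp [Finsupp.mapDomain_zero]
    | add r r' h h' => rw [add_smul, hadd, h, h', add_smul]
    | single m r =>
      induction f using AddMonoidAlgebra.induction_linear with
      | zero => simp [Finsupp.mapDomain_zero]
      | add f g h h' => rw [smul_add, hadd, hadd, h, h', smul_add]
      | single x c =>
        rw [single_smul_single hφ, hsingle, hsingle, single_smul_single hφ', hτ]

/-- `τ` is required to be bijective only from `A` to `A'`. This admits maps defined by rounding,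
which identify exponents outside `A`. -/
lemma nonempty_supportedEquiv {φ : N →+ P} {φ' : N →+ P'}
    (hφ : algebraMap (AddMonoidAlgebra K N) (AddMonoidAlgebra K P) =
      AddMonoidAlgebra.mapDomainRingHom K φ)
    (hφ' : algebraMap (AddMonoidAlgebra K N) (AddMonoidAlgebra K P') =
      AddMonoidAlgebra.mapDomainRingHom K φ') {A : Set P} (hA : ∀ m, ∀ x ∈ A, φ m + x ∈ A)
    {A' : Set P'} (hA' : ∀ m, ∀ x ∈ A', φ' m + x ∈ A') (τ : P → P')
    (hτ : ∀ m x, τ (φ m + x) = φ' m + τ x) (hbij : Set.BijOn τ A A') :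
    Nonempty (supportedSubmodule K φ hφ A hA ≃ₗ[AddMonoidAlgebra K N]
      supportedSubmodule K φ' hφ' A' hA') := by
  classical
  let E := equivariantMap hφ hφ' τ hτ
  have hmap : ∀ f ∈ supportedSubmodule K φ hφ A hA, E f ∈ supportedSubmodule K φ' hφ' A' hA' := by
    intro f hf y hy
    obtain ⟨x, hx, rfl⟩ := Finset.mem_image.1 (Finsupp.mapDomain_support hy)
    exact hbij.mapsTo (hf x hx)
  refine ⟨LinearEquiv.ofBijective (E.restrict hmap) ⟨?_, ?_⟩⟩
  · rintro ⟨f, hf⟩ ⟨g, hg⟩ h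
    apply Subtype.ext
    apply AddMonoidAlgebra.coeff_injective
    have h1 : E f = E g := congrArg Subtype.val h
    have h2 : f.coeff.mapDomain τ = g.coeff.mapDomain τ := congrArg AddMonoidAlgebra.coeff h1
    exact Finsupp.mapDomain_injOn A hbij.injOn hf hg h2
  · rintro ⟨g, hg⟩
    have hs : ∀ y ∈ A', ∃ x ∈ A, τ x = y := hbij.surjOn
    choose! x hxA hx using hs
    refine ⟨∑ y ∈ g.coeff.support.attach, ⟨AddMonoidAlgebra.single (x y.1) (g.coeff y.1),
      single_mem_supportedSubmodule hφ (hxA _ (hg y.1 y.2)) _⟩, ?_⟩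
    apply Subtype.ext
    rw [map_sum, AddSubmonoidClass.coe_finsetSum]
    refine Eq.trans ?_ ((Finset.sum_attach _ _).trans (sum_single_coeff g))
    refine Finset.sum_congr rfl fun y _ => ?_
    change AddMonoidAlgebra.ofCoeff (Finsupp.mapDomain τ (Finsupp.single (x y.1) (g.coeff y.1))) = _
    rw [Finsupp.mapDomain_single, hx _ (hg y.1 y.2)]
    rfl

end Supported

/-! ### Conic and divisorial ideals and their isomorphism classes -/

section Conic

variable {K : Type*} [Field K] {d s : ℕ} {M : AddSubmonoid (Fin d → ℤ)} {σ : Fin s → Fin d → ℤ}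

/-- The lattice points with `σ_i(x) ≥ z_i`. -/
def upperSet (σ : Fin s → Fin d → ℤ) (z : Fin s → ℤ) : Set (Fin d → ℤ) :=
  {x | ∀ i, z i ≤ intForm (σ i) x}

lemma upperSet_stable (hM : IsPositiveNormalAffine M) (hσ : IsSupportForms M σ) (z : Fin s → ℤ)
    (m : M) (x) (hx : x ∈ upperSet σ z) : M.subtype m + x ∈ upperSet σ z := by
  intro i
  rw [map_add]
  have h1 : 0 ≤ intForm (σ i) (M.subtype m) := (mem_monoid_iff hM hσ).1 m.2 i
  linarith [hx i]

variable (K) in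
/-- The divisorial ideal spanned by the monomials `x` with `σ_i(x) ≥ z_i`. -/
def divisorialIdeal (hM : IsPositiveNormalAffine M) (hσ : IsSupportForms M σ) (z : Fin s → ℤ) :
    Submodule (AddMonoidAlgebra K M) (AddMonoidAlgebra K (Fin d → ℤ)) :=
  supportedSubmodule K M.subtype rfl (upperSet σ z) (upperSet_stable hM hσ z)

/-- For a lattice point `x` the value `σ_i(x)` is an integer, so `σ_i(x) ≥ σ_i(y)` is the same as
`σ_i(x) ≥ ⌈σ_i(y)⌉`. -/
lemma conicIdeal_eq (hM : IsPositiveNormalAffine M) (hσ : IsSupportForms M σ) {y : Fin d → ℝ}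
    {z : Fin s → ℤ} (hy : ∀ i, ⌈evalForm (σ i) y⌉ = z i) :
    conicIdeal K M y = divisorialIdeal K hM hσ z := by
  have h : {x : Fin d → ℤ | castHom d x - y ∈ realCone M} = upperSet σ z := by
    ext x
    simp only [Set.mem_ofPred_eq, upperSet, hσ.mem_iff, evalForm_sub, evalForm_castHom, sub_nonneg,
      ← hy, Int.ceil_le]
  ext f
  simp only [conicIdeal, divisorialIdeal, mem_supportedSubmodule, h]

lemma conicOfCell_eq (hM : IsPositiveNormalAffine M) (hσ : IsSupportForms M σ)
    {γ : Set (Fin d → ℝ)} (hγ : IsOpenCell σ γ) :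
    conicOfCell K M σ γ = divisorialIdeal K hM hσ (cellBounds σ γ) := by
  have hne : (openCell σ (cellBounds σ γ)).Nonempty := by
    rw [openCell_cellBounds hγ]; exact hγ.1
  have hcl := cellUpperClosure_openCell hne
  rw [openCell_cellBounds hγ] at hcl
  rw [conicOfCell]
  apply le_antisymm
  · refine iSup₂_le fun x hx => ?_
    rw [hcl] at hx
    rw [conicIdeal_eq hM hσ hx]
  · obtain ⟨y, hy⟩ := hne
    have hy' : y ∈ cellUpperClosure σ γ := by
      rw [hcl]; exact ceil_of_mem_openCell hy
    rw [← conicIdeal_eq hM hσ (ceil_of_mem_openCell hy)]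
    exact le_iSup₂_of_le y hy' le_rfl

/-- A homomorphism between divisorial ideals is multiplication by a Laurent polynomial. -/
lemma exists_eq_mul (hM : IsPositiveNormalAffine M) (hσ : IsSupportForms M σ) {z z' : Fin s → ℤ}
    (F : divisorialIdeal K hM hσ z →ₗ[AddMonoidAlgebra K M] divisorialIdeal K hM hσ z') :
    ∃ f : AddMonoidAlgebra K (Fin d → ℤ), ∀ g, (F g : AddMonoidAlgebra K (Fin d → ℤ)) = f * g := by
  obtain ⟨v, hv⟩ := exists_interior hM hσ
  let N : ℤ := ∑ j, |z j|
  have hN : ∀ j, z j ≤ N := fun j => (le_abs_self _).trans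
    (Finset.single_le_sum (f := fun j => |z j|) (fun _ _ => abs_nonneg _) (Finset.mem_univ j))
  have hN0 : 0 ≤ N := Finset.sum_nonneg fun _ _ => abs_nonneg _
  have hx₀ : N • v ∈ upperSet σ z := by
    intro i
    rw [map_zsmul, smul_eq_mul]
    have := hN i
    have : 1 ≤ intForm (σ i) v := hv i
    nlinarith
  let mono : ∀ x, x ∈ upperSet σ z → K → divisorialIdeal K hM hσ z := fun x hx c =>
    ⟨AddMonoidAlgebra.single x c, single_mem_supportedSubmodule _ hx c⟩
  -- The multiplier is `F(x₀)/x₀` for one monomial `x₀ = N v` of the ideal.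
  let f : AddMonoidAlgebra K (Fin d → ℤ) :=
    (F (mono _ hx₀ 1)).1 * AddMonoidAlgebra.single (-(N • v)) 1
  have hmono : ∀ x (hx : x ∈ upperSet σ z) (c : K),
      (F (mono x hx c) : AddMonoidAlgebra K (Fin d → ℤ)) = f * AddMonoidAlgebra.single x c := by
    intro x hx c
    obtain ⟨k, hk⟩ : ∃ k : ℕ, ∀ i, 0 ≤ intForm (σ i) (N • v + k • v - x) := by
      refine ⟨(∑ i, |intForm (σ i) x|).toNat, fun i => ?_⟩
      have h1 : |intForm (σ i) x| ≤ ∑ i, |intForm (σ i) x| :=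
        Finset.single_le_sum (f := fun i => |intForm (σ i) x|) (fun _ _ => abs_nonneg _)
          (Finset.mem_univ i)
      have h2 := le_abs_self (intForm (σ i) x)
      have h3 := Int.self_le_toNat (∑ i, |intForm (σ i) x|)
      have h4 : 1 ≤ intForm (σ i) v := hv i
      rw [map_sub, map_add, map_zsmul, map_nsmul, smul_eq_mul, nsmul_eq_mul]
      nlinarith
    -- Any monomial `x` of the ideal has a common multiple with `x₀`: both `m₁` and `m₂` lie in `M`
    -- and `m₁ + x = m₂ + x₀`. Linearity over `K[M]` then determines `F(x)`.
    let m₁ : M := ⟨N • v + k • v - x, (mem_monoid_iff hM hσ).2 hk⟩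
    let m₂ : M := ⟨k • v, (mem_monoid_iff hM hσ).2 fun i => by
      rw [map_nsmul, nsmul_eq_mul]; have := (hv i).le; positivity⟩
    have heq : (AddMonoidAlgebra.single m₁ 1 : AddMonoidAlgebra K M) • mono x hx c =
        (AddMonoidAlgebra.single m₂ c : AddMonoidAlgebra K M) • mono _ hx₀ 1 := by
      apply Subtype.ext
      change (AddMonoidAlgebra.single m₁ 1 : AddMonoidAlgebra K M) •
          (AddMonoidAlgebra.single x c : AddMonoidAlgebra K (Fin d → ℤ)) =
        (AddMonoidAlgebra.single m₂ c : AddMonoidAlgebra K M) •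
          (AddMonoidAlgebra.single (N • v) 1 : AddMonoidAlgebra K (Fin d → ℤ))
      rw [single_smul_single (φ := M.subtype) rfl, single_smul_single (φ := M.subtype) rfl]
      congr 1
      · change N • v + k • v - x + x = k • v + N • v
        abel
      · ring
    have h1 := congrArg (fun g => (F g : AddMonoidAlgebra K (Fin d → ℤ))) heq
    simp only [map_smul, Submodule.coe_smul] at h1
    have hsm : ∀ (m : M) (r : K) (g : AddMonoidAlgebra K (Fin d → ℤ)),
        (AddMonoidAlgebra.single m r : AddMonoidAlgebra K M) • g =
          AddMonoidAlgebra.single (m : Fin d → ℤ) r * g := by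
      intro m r g
      rw [Algebra.smul_def]
      congr 1
      change AddMonoidAlgebra.mapDomainRingHom K M.subtype _ = _
      simp
    rw [hsm, hsm] at h1
    have h2 := congrArg (fun g => AddMonoidAlgebra.single (-(N • v + k • v - x)) 1 * g) h1
    simp only [← mul_assoc, AddMonoidAlgebra.single_mul_single] at h2
    have e1 : -(N • v + k • v - x) + ((m₁ : M) : Fin d → ℤ) = 0 := neg_add_cancel _
    have e2 : -(N • v + k • v - x) + ((m₂ : M) : Fin d → ℤ) = -(N • v) + x := by
      change -(N • v + k • v - x) + k • v = _
      abel
    rw [e1, e2, one_mul, one_mul, ← AddMonoidAlgebra.one_def, one_mul] at h2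
    rw [h2]
    simp only [f]
    rw [mul_assoc, AddMonoidAlgebra.single_mul_single, mul_comm, one_mul]
  refine ⟨f, fun g => ?_⟩
  obtain ⟨g, hg⟩ := g
  have hsum : (⟨g, hg⟩ : divisorialIdeal K hM hσ z) =
      ∑ x ∈ g.coeff.support.attach, mono x.1 (hg x.1 x.2) (g.coeff x.1) := by
    apply Subtype.ext
    rw [AddSubmonoidClass.coe_finsetSum]
    exact ((Finset.sum_attach _ _).trans (sum_single_coeff g)).symm
  rw [hsum, map_sum, AddSubmonoidClass.coe_finsetSum, AddSubmonoidClass.coe_finsetSum,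
    Finset.mul_sum]
  exact Finset.sum_congr rfl fun x _ => hmono x.1 (hg x.1 x.2) _

/-- Divisorial ideals are isomorphic only if they differ by a monomial. -/
lemma eq_add_formValues_of_equiv (hM : IsPositiveNormalAffine M) (hσ : IsSupportForms M σ)
    {z z' : Fin s → ℤ}
    (F : divisorialIdeal K hM hσ z ≃ₗ[AddMonoidAlgebra K M] divisorialIdeal K hM hσ z') :
    ∃ t, z' = z + formValues σ t := by
  classical
  obtain ⟨f, hf⟩ := exists_eq_mul hM hσ F.toLinearMap
  obtain ⟨g, hg⟩ := exists_eq_mul hM hσ F.symm.toLinearMap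
  -- A monomial on the hyperplane `σ_i = w_i` is multiplied into the second ideal, so no exponent of
  -- the multiplier can have `σ_i` smaller than `w'_i - w_i`.
  have hsub : ∀ {w w' : Fin s → ℤ} {f : AddMonoidAlgebra K (Fin d → ℤ)},
      (∀ g ∈ divisorialIdeal K hM hσ w, f * g ∈ divisorialIdeal K hM hσ w') →
      ∀ t ∈ f.coeff.support, ∀ i, w' i ≤ w i + intForm (σ i) t := by
    intro w w' f hf t ht i
    obtain ⟨x, hxi, hx⟩ := exists_attaining hM hσ w i
    replace hx : x ∈ upperSet σ w := hx
    have h1 := hf (AddMonoidAlgebra.single x 1) (single_mem_supportedSubmodule _ hx 1)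
    have h2 := h1 (t + x) (by
      rw [Finsupp.mem_support_iff, AddMonoidAlgebra.coeff_mul_single_apply]
      simpa using ht) i
    rw [map_add, hxi] at h2
    linarith
  obtain ⟨x, hx⟩ : (upperSet σ z).Nonempty := by
    rcases Nat.eq_zero_or_pos s with rfl | hs
    · exact ⟨0, fun i => i.elim0⟩
    · obtain ⟨x, -, hx⟩ := exists_attaining hM hσ z ⟨0, hs⟩
      exact ⟨x, hx⟩
  have hgf : g * f = 1 := by
    let e : divisorialIdeal K hM hσ z :=
      ⟨AddMonoidAlgebra.single x 1, single_mem_supportedSubmodule _ hx 1⟩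
    have h1 := hg (F e)
    have h2 := hf e
    simp only [LinearEquiv.coe_coe, LinearEquiv.symm_apply_apply] at h1 h2
    rw [h2, ← mul_assoc] at h1
    have h3 := congrArg (fun h => h * AddMonoidAlgebra.single (-x) 1) h1
    simp only [e, mul_assoc, AddMonoidAlgebra.single_mul_single, add_neg_cancel, mul_one,
      ← AddMonoidAlgebra.one_def] at h3
    exact h3.symm
  have h0 : (0 : Fin d → ℤ) ∈ (g * f).coeff.support := by
    rw [hgf, AddMonoidAlgebra.one_def, AddMonoidAlgebra.coeff_single]
    simp
  -- From `g f = 1` there are opposite exponents `t` of `f` and `t' = -t` of `g`. The bounds that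
  -- they give are opposite to each other, so equality holds.
  obtain ⟨t', ht', t, ht, hsum⟩ := Finset.mem_add.1 (AddMonoidAlgebra.support_coeff_mul_subset _ _ h0)
  refine ⟨t, funext fun i => ?_⟩
  have h1 := hsub (w := z) (w' := z') (f := f) (fun h hh => by
    have := (F ⟨h, hh⟩).2
    have h3 := hf ⟨h, hh⟩
    simp only [LinearEquiv.coe_coe] at h3
    rwa [h3] at this) t ht i
  have h2 := hsub (w := z') (w' := z) (f := g) (fun h hh => by
    have := (F.symm ⟨h, hh⟩).2
    have h3 := hg ⟨h, hh⟩
    simp only [LinearEquiv.coe_coe] at h3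
    rwa [h3] at this) t' ht' i
  rw [eq_neg_of_add_eq_zero_left hsum, map_neg] at h2
  rw [Pi.add_apply, formValues_apply]
  linarith

lemma nonempty_equiv_divisorialIdeal (hM : IsPositiveNormalAffine M) (hσ : IsSupportForms M σ)
    (z : Fin s → ℤ) (t : Fin d → ℤ) :
    Nonempty (divisorialIdeal K hM hσ z ≃ₗ[AddMonoidAlgebra K M]
      divisorialIdeal K hM hσ (z + formValues σ t)) := by
  refine nonempty_supportedEquiv rfl rfl _ _ (· + t) (fun m x => add_assoc _ _ _)
    ⟨fun x hx i => ?_, fun x _ y _ h => by simpa using h, fun x hx => ⟨x - t, fun i => ?_, by simp⟩⟩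
  · simp only [Pi.add_apply, formValues_apply, map_add]
    linarith [hx i]
  · have := hx i
    simp only [Pi.add_apply, formValues_apply] at this
    rw [map_sub]
    linarith

end Conic

end ConicHK
end

/-! ### The summands of `R^(n)` and their multiplicities -/

noncomputable section
namespace ConicHK

section Residues

variable {K : Type*} [Field K] {d s : ℕ} {M : AddSubmonoid (Fin d → ℤ)} {σ : Fin s → Fin d → ℤ}
  {n : ℕ}

/-- The residue class of `-x/n`. -/
def rootClass (n : ℕ) (x : Fin d → ℤ) : Torus d :=
  QuotientAddGroup.mk (-((n : ℝ)⁻¹ • castHom d x))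

/-- The vector of the rounded up values of the forms at `x/n`. -/
def ceilVec (σ : Fin s → Fin d → ℤ) (n : ℕ) (x : Fin d → ℤ) : Fin s → ℤ :=
  fun i => ⌈evalForm (σ i) ((n : ℝ)⁻¹ • castHom d x)⌉

lemma ceilVec_eq_iff (hn : 0 < n) {x : Fin d → ℤ} {z : Fin s → ℤ} : ceilVec σ n x = z ↔
    ∀ i, (n : ℤ) * (z i - 1) < intForm (σ i) x ∧ intForm (σ i) x ≤ n * z i := by
  have hn' : (0 : ℝ) < n := by exact_mod_cast hn
  rw [funext_iff]
  refine forall_congr' fun i => ?_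
  rw [ceilVec, Int.ceil_eq_iff, evalForm_smul, evalForm_castHom, inv_mul_eq_div, lt_div_iff₀ hn',
    div_le_iff₀ hn', mul_comm _ (n : ℝ), mul_comm _ (n : ℝ)]
  exact_mod_cast Iff.rfl

lemma ceilVec_add_smul (hn : 0 < n) (x t : Fin d → ℤ) :
    ceilVec σ n (x + n • t) = ceilVec σ n x + formValues σ t := by
  have hn' : (n : ℝ) ≠ 0 := by positivity
  funext i
  have h : (n : ℝ)⁻¹ • castHom d (x + n • t) = (n : ℝ)⁻¹ • castHom d x + castHom d t := by
    rw [map_add, map_nsmul, smul_add, ← Nat.cast_smul_eq_nsmul ℝ n, smul_smul, inv_mul_cancel₀ hn',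
      one_smul]
  rw [ceilVec, h, evalForm_add, evalForm_castHom, Int.ceil_add_intCast]
  rfl

lemma rootClass_eq_iff (hn : 0 < n) {x x' : Fin d → ℤ} :
    rootClass n x = rootClass n x' ↔ ∃ t, x = x' + n • t := by
  have hn' : (n : ℝ) ≠ 0 := by positivity
  rw [rootClass, rootClass, QuotientAddGroup.eq]
  constructor
  · rintro ⟨t, ht⟩
    refine ⟨t, castHom_injective d ?_⟩
    rw [map_add, map_nsmul, ht, ← Nat.cast_smul_eq_nsmul ℝ n, neg_neg, smul_add, smul_neg,
      smul_smul, smul_smul, mul_inv_cancel₀ hn', one_smul, one_smul]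
    abel
  · rintro ⟨t, rfl⟩
    refine ⟨t, ?_⟩
    rw [map_add, map_nsmul, smul_add, ← Nat.cast_smul_eq_nsmul ℝ n, smul_smul, inv_mul_cancel₀ hn']
    simp

lemma mem_rootClasses_iff (hn : 0 < n) {c : Torus d} :
    c ∈ rootClasses d n ↔ ∃ x, c = rootClass n x := by
  have hn' : (n : ℝ) ≠ 0 := by positivity
  rw [rootClasses, AddSubgroup.mem_map]
  constructor
  · rintro ⟨y, ⟨x, hx⟩, rfl⟩
    refine ⟨-x, ?_⟩
    rw [rootClass, map_neg, hx]
    simp only [nsmulAddMonoidHom_apply, ← Nat.cast_smul_eq_nsmul ℝ n, smul_neg, neg_neg, smul_smul,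
      inv_mul_cancel₀ hn', one_smul]
    rfl
  · rintro ⟨x, rfl⟩
    refine ⟨-((n : ℝ)⁻¹ • castHom d x), ⟨-x, ?_⟩, rfl⟩
    simp only [nsmulAddMonoidHom_apply, ← Nat.cast_smul_eq_nsmul ℝ n, smul_smul,
      mul_inv_cancel₀ hn', one_smul, map_neg]

lemma finite_rootClasses (hn : 0 < n) : (rootClasses d n : Set (Torus d)).Finite := by
  refine ((Set.finite_Icc (fun _ : Fin d => (0 : ℤ)) (fun _ => (n : ℤ))).image
    (rootClass n)).subset ?_
  intro c hc
  obtain ⟨x, rfl⟩ := (mem_rootClasses_iff hn).1 hc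
  refine ⟨fun j => x j % n, ⟨fun j => ?_, fun j => ?_⟩, ?_⟩
  · exact Int.emod_nonneg _ (by positivity)
  · exact (Int.emod_lt_of_pos _ (by exact_mod_cast hn)).le
  · rw [rootClass_eq_iff hn]
    refine ⟨fun j => -(x j / n), funext fun j => ?_⟩
    rw [Pi.add_apply, Pi.smul_apply, nsmul_eq_mul]
    linarith [Int.emod_add_mul_ediv (x j) n]

lemma mem_rootMonoid_iff {y : Fin d → ℝ} :
    y ∈ rootMonoid M n ↔ ∃ m ∈ M, castHom d m = n • y := Iff.rfl

/-- The summands of `R^(n)` are conic ideals. -/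
lemma nonempty_residueSummand_equiv (hM : IsPositiveNormalAffine M) (hσ : IsSupportForms M σ)
    (hn : 0 < n) (x : Fin d → ℤ) :
    Nonempty (residueSummand K M n (rootClass n x) ≃ₗ[AddMonoidAlgebra K M]
      divisorialIdeal K hM hσ (ceilVec σ n x)) := by
  have hn' : (n : ℝ) ≠ 0 := by positivity
  have hn0 : (0 : ℝ) < n := by positivity
  -- Adding `x/n` makes the exponents of this class integral. On the class rounding changes nothing;
  -- it only extends the map to all exponents.
  have hτ : ∀ (u : Fin d → ℤ) (y : Fin d → ℝ), castHom d u = y + (n : ℝ)⁻¹ • castHom d x →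
      (fun j => ⌊(y + (n : ℝ)⁻¹ • castHom d x) j⌋) = u := by
    intro u y h
    funext j
    rw [← h]
    exact Int.floor_intCast _
  have hclass : ∀ y : Fin d → ℝ, (QuotientAddGroup.mk y : Torus d) = rootClass n x →
      ∃ u, castHom d u = y + (n : ℝ)⁻¹ • castHom d x := by
    intro y h
    rw [rootClass, QuotientAddGroup.eq] at h
    obtain ⟨u, hu⟩ := h
    refine ⟨-u, ?_⟩
    rw [map_neg, hu]
    abel
  -- For `y = u - x/n`, membership in `(1/n)M` means `σ(u) ≥ σ(x/n)`. This is why the class of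
  -- `-x/n`, and not that of `x/n`, belongs to the ceilings at `x/n`.
  have hmem : ∀ (u : Fin d → ℤ) (y : Fin d → ℝ), castHom d u = y + (n : ℝ)⁻¹ • castHom d x →
      (y ∈ rootMonoid M n ↔ u ∈ upperSet σ (ceilVec σ n x)) := by
    intro u y h
    have h1 : n • y = castHom d (n • u - x) := by
      rw [map_sub, map_nsmul, h, smul_add, ← Nat.cast_smul_eq_nsmul ℝ n, ← Nat.cast_smul_eq_nsmul ℝ n,
        smul_smul, mul_inv_cancel₀ hn', one_smul, add_sub_cancel_right]
    have h2 : y ∈ rootMonoid M n ↔ n • u - x ∈ M := by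
      rw [mem_rootMonoid_iff, h1]
      constructor
      · rintro ⟨m, hm, hmx⟩
        rwa [← castHom_injective d hmx]
      · intro hm
        exact ⟨_, hm, rfl⟩
    rw [h2, mem_monoid_iff hM hσ]
    refine forall_congr' fun i => ?_
    rw [ceilVec, Int.ceil_le, evalForm_smul, evalForm_castHom, inv_mul_le_iff₀ hn0, map_sub, map_nsmul,
      sub_nonneg, nsmul_eq_mul]
    exact_mod_cast Iff.rfl
  refine nonempty_supportedEquiv (φ := toRoot M n) (φ' := M.subtype) rfl rfl _ _
    (fun y j => ⌊((y : Fin d → ℝ) + (n : ℝ)⁻¹ • castHom d x) j⌋) ?_ ⟨?_, ?_, ?_⟩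
  · intro m y
    funext j
    have : (((toRoot M n m + y : rootMonoid M n) : Fin d → ℝ) + (n : ℝ)⁻¹ • castHom d x) j =
        ((m : Fin d → ℤ) j : ℝ) + ((y : Fin d → ℝ) + (n : ℝ)⁻¹ • castHom d x) j :=
      add_assoc _ _ _
    rw [this, Int.floor_intCast_add]
    rfl
  · rintro y hy
    obtain ⟨u, hu⟩ := hclass _ hy
    simp only [hτ u _ hu]
    exact (hmem u _ hu).1 y.2
  · rintro y hy y' hy' h
    obtain ⟨u, hu⟩ := hclass _ hy
    obtain ⟨u', hu'⟩ := hclass _ hy'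
    simp only [hτ u _ hu, hτ u' _ hu'] at h
    subst h
    exact Subtype.ext (add_right_cancel (hu.symm.trans hu'))
  · intro u hu
    have h : castHom d u = (castHom d u - (n : ℝ)⁻¹ • castHom d x) + (n : ℝ)⁻¹ • castHom d x := by
      abel
    refine ⟨⟨_, (hmem u _ h).2 hu⟩, ?_, hτ u _ h⟩
    change (QuotientAddGroup.mk _ : Torus d) = rootClass n x
    rw [rootClass, QuotientAddGroup.eq]
    refine ⟨-u, ?_⟩
    rw [map_neg]
    change -castHom d u = -(castHom d u - (n : ℝ)⁻¹ • castHom d x) + -((n : ℝ)⁻¹ • castHom d x)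
    abel

/-- Both modules are divisorial ideals, so the isomorphism is decided by their bounds modulo the
values of `σ` on `ℤ^d`. -/
lemma residueSummand_equiv_conicOfCell_iff (hM : IsPositiveNormalAffine M)
    (hσ : IsSupportForms M σ) (hn : 0 < n) (x : Fin d → ℤ) {γ : Set (Fin d → ℝ)}
    (hγ : IsOpenCell σ γ) :
    Nonempty (residueSummand K M n (rootClass n x) ≃ₗ[AddMonoidAlgebra K M] conicOfCell K M σ γ) ↔
      ∃ t, ceilVec σ n x = cellBounds σ γ + formValues σ t := by
  rw [conicOfCell_eq hM hσ hγ]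
  obtain ⟨e⟩ := nonempty_residueSummand_equiv (K := K) hM hσ hn x
  constructor
  · rintro ⟨f⟩
    exact eq_add_formValues_of_equiv hM hσ (f.symm.trans e)
  · rintro ⟨t, ht⟩
    obtain ⟨f⟩ := nonempty_equiv_divisorialIdeal (K := K) hM hσ (cellBounds σ γ) t
    rw [← ht] at f
    exact ⟨e.trans f.symm⟩

/-- The multiplicities count the lattice points in dilations of the upper closure of a cell. -/
lemma multiplicity_eq (hM : IsPositiveNormalAffine M) (hσ : IsSupportForms M σ) (hn : 0 < n)
    {γ : Set (Fin d → ℝ)} (hγ : IsOpenCell σ γ) :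
    multiplicity K M σ γ n = cellCount σ (cellBounds σ γ) n := by
  rw [multiplicity, cellCount]
  symm
  refine Set.ncard_congr (fun x _ => rootClass n x) ?_ ?_ ?_
  · intro x hx
    refine ⟨(mem_rootClasses_iff hn).2 ⟨x, rfl⟩, ?_⟩
    rw [residueSummand_equiv_conicOfCell_iff hM hσ hn x hγ]
    exact ⟨0, by rw [map_zero, add_zero]; exact (ceilVec_eq_iff hn).2 hx⟩
  · intro x x' hx hx' h
    obtain ⟨t, rfl⟩ := (rootClass_eq_iff hn).1 h
    have h1 := (ceilVec_eq_iff hn).2 hx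
    rw [ceilVec_add_smul hn, (ceilVec_eq_iff hn).2 hx'] at h1
    have h2 : t = 0 := eq_zero_of_intForm hM hσ fun i => by
      have := congrFun h1 i
      rw [Pi.add_apply, formValues_apply] at this
      linarith
    rw [h2]; simp
  · rintro c ⟨hc, hiso⟩
    obtain ⟨x, rfl⟩ := (mem_rootClasses_iff hn).1 hc
    obtain ⟨t, ht⟩ := (residueSummand_equiv_conicOfCell_iff hM hσ hn x hγ).1 hiso
    -- Changing `x` by `-n t` keeps the residue class and moves `x/n` into the upper closure of the
    -- chosen representative.
    refine ⟨x + n • (-t), ?_, ?_⟩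
    · rw [Set.mem_ofPred_eq, ← ceilVec_eq_iff hn, ceilVec_add_smul hn, ht, map_neg]
      abel
    · rw [rootClass_eq_iff hn]
      exact ⟨-t, rfl⟩

/-- Every summand of `R^(n)` is isomorphic to exactly one of the chosen conic ideals. -/
lemma existsUnique_residueSummand_equiv (hM : IsPositiveNormalAffine M)
    (hσ : IsSupportForms M σ) {T : Set (Set (Fin d → ℝ))} (hT : IsCellRepresentatives σ T)
    (hn : 0 < n) {c : Torus d} (hc : c ∈ rootClasses d n) :
    ∃! γ, γ ∈ T ∧ Nonempty (residueSummand K M n c ≃ₗ[AddMonoidAlgebra K M]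
      conicOfCell K M σ γ) := by
  obtain ⟨x, rfl⟩ := (mem_rootClasses_iff hn).1 hc
  obtain ⟨γ, ⟨hγ, ht⟩, huniq⟩ := existsUnique_representative hT
    (openCell_ceil_nonempty hM hσ ((n : ℝ)⁻¹ • castHom d x))
  refine ⟨γ, ⟨hγ, (residueSummand_equiv_conicOfCell_iff hM hσ hn x (hT.isOpenCell γ hγ)).2 ht⟩, ?_⟩
  rintro γ' ⟨hγ', hiso⟩
  exact huniq γ' ⟨hγ', (residueSummand_equiv_conicOfCell_iff hM hσ hn x
    (hT.isOpenCell γ' hγ')).1 hiso⟩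

end Residues

end ConicHK
end

/-! ### A graded Nakayama lemma -/

noncomputable section
namespace ConicHK

section Nakayama

/-- Graded Nakayama lemma: the minimal number of generators is the dimension of `N / I N`. -/
theorem minGens_eq_finrank_quotient {K A N : Type*} [Field K] [CommRing A] [Algebra K A]
    [AddCommGroup N] [Module A N] [Module K N] [IsScalarTower K A N] {I : Ideal A} {G : Set A}
    (hI : I = Ideal.span G) (hA : ∀ a : A, ∃ k : K, a - algebraMap K A k ∈ I) {ι : Type*}
    (b : ι → N) (hb : Submodule.span K (Set.range b) = ⊤) (D : ι → ℕ) (π : ℕ → N →ₗ[K] N)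
    (hπ : ∀ k i, π k (b i) = if D i = k then b i else 0)
    (hG : ∀ g ∈ G, ∃ e, 0 < e ∧ ∀ k v, π k (g • v) = if e ≤ k then g • π (k - e) v else 0)
    [Module.Finite K (N ⧸ (I • ⊤ : Submodule A N))] :
    minGens A N = Module.finrank K (N ⧸ (I • ⊤ : Submodule A N)) := by
  classical
  let mkK : N →ₗ[K] N ⧸ (I • ⊤ : Submodule A N) :=
    LinearMap.restrictScalars K (I • ⊤ : Submodule A N).mkQ
  have hmk : Function.Surjective mkK := by
    intro x
    obtain ⟨v, rfl⟩ := Submodule.mkQ_surjective (I • ⊤ : Submodule A N) x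
    exact ⟨v, rfl⟩
  -- A subfamily of the homogeneous spanning elements `b` is chosen that maps to a basis of `N/IN`.
  obtain ⟨κ, a, -, hspan, hli⟩ := exists_linearIndependent' K (mkK ∘ b)
  have htop : Submodule.span K (Set.range ((mkK ∘ b) ∘ a)) = ⊤ := by
    rw [hspan, Set.range_comp, ← Submodule.map_span, hb, Submodule.map_top,
      LinearMap.range_eq_top.2 hmk]
  let B := Module.Basis.mk hli htop.ge
  have hfinκ : Finite κ := Module.Finite.finite_basis B
  have := Fintype.ofFinite κ
  set N' : Submodule A N := Submodule.span A (Set.range (b ∘ a)) with hN'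
  have hKN' : Submodule.span K (Set.range (b ∘ a)) ≤ N'.restrictScalars K :=
    Submodule.span_le.2 Submodule.subset_span
  have hπspan : ∀ n, ∀ w ∈ Submodule.span K (Set.range (b ∘ a)),
      π n w ∈ Submodule.span K (Set.range (b ∘ a)) := by
    intro n w hw
    refine (Submodule.span_le.2 ?_ : Submodule.span K (Set.range (b ∘ a)) ≤
      (Submodule.span K (Set.range (b ∘ a))).comap (π n)) hw
    rintro _ ⟨j, rfl⟩
    change π n (b (a j)) ∈ Submodule.span K (Set.range (b ∘ a))
    rw [hπ]
    split_ifs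
    · exact Submodule.subset_span ⟨j, rfl⟩
    · exact zero_mem _
  -- Induction on the degree `n`. Modulo `I N` the element `b i` is a combination `w` of the chosen
  -- ones. The degree `n` part of the remainder is a combination of products of elements of positive
  -- degree with elements of lower degree, and those lie in `N'` by induction.
  have key : ∀ n i, D i = n → b i ∈ N' := by
    intro n
    induction n using Nat.strong_induction_on with
    | _ n ih =>
      intro i hi
      have hlow : ∀ k, k < n → ∀ v, π k v ∈ N' := by
        intro k hk v
        have hv : v ∈ Submodule.span K (Set.range b) := by rw [hb]; trivial
        refine (Submodule.span_le.2 ?_ : Submodule.span K (Set.range b) ≤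
          (N'.restrictScalars K).comap (π k)) hv
        rintro _ ⟨j, rfl⟩
        change π k (b j) ∈ N'
        rw [hπ]
        split_ifs with hj
        · exact ih k hk j hj
        · exact zero_mem _
      have hI' : ∀ u ∈ (I • ⊤ : Submodule A N), π n u ∈ N' := by
        intro u hu
        refine Submodule.smul_induction_on hu ?_ ?_
        · intro r hr v _
          rw [hI] at hr
          revert v
          refine Submodule.span_induction (p := fun r _ => ∀ v ∈ (⊤ : Submodule A N), π n (r • v) ∈ N')
            ?_ ?_ ?_ ?_ hr
          · intro g hg v _
            obtain ⟨e, he, h⟩ := hG g hg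
            rw [h]
            split_ifs
            · exact N'.smul_mem _ (hlow _ (by omega) _)
            · exact zero_mem _
          · intro v _
            simp
          · intro r r' _ _ h h' v hv
            rw [add_smul, map_add]
            exact add_mem (h v hv) (h' v hv)
          · intro c r _ h v _
            rw [smul_eq_mul, mul_comm, mul_smul]
            exact h _ trivial
        · intro x y hx hy
          rw [map_add]
          exact add_mem hx hy
      have h1 : mkK (b i) ∈ Submodule.span K (Set.range ((mkK ∘ b) ∘ a)) := by
        rw [htop]; trivial
      rw [Function.comp_assoc, Set.range_comp, ← Submodule.map_span] at h1
      obtain ⟨w, hw, hwi⟩ := h1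
      have h2 : b i - w ∈ (I • ⊤ : Submodule A N) := by
        rw [← Submodule.Quotient.mk_eq_zero, Submodule.Quotient.mk_sub]
        exact sub_eq_zero.2 hwi.symm
      have h3 : b i = π n w + π n (b i - w) := by
        rw [map_sub, hπ, if_pos hi]; abel
      rw [h3]
      exact add_mem (hKN' (hπspan n w hw)) (hI' _ h2)
  have hN'top : N' = ⊤ := by
    rw [eq_top_iff]
    intro v _
    have hv : v ∈ Submodule.span K (Set.range b) := by rw [hb]; trivial
    refine (Submodule.span_le.2 ?_ : Submodule.span K (Set.range b) ≤ N'.restrictScalars K) hv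
    rintro _ ⟨j, rfl⟩
    exact key _ j rfl
  have hfg : (⊤ : Submodule A N).FG := by
    rw [← hN'top]
    exact Submodule.fg_span (Set.finite_range _)
  apply le_antisymm
  · rw [Module.finrank_eq_card_basis B, minGens, ← hN'top]
    refine (Submodule.spanFinrank_span_le_ncard_of_finite (Set.finite_range _)).trans ?_
    rw [← Nat.card_eq_fintype_card, ← Set.ncard_univ,
      ← Set.image_univ]
    exact Set.ncard_image_le Set.finite_univ
  -- Conversely, as `A = K + I`, the ring acts on `N/IN` through `K`, so the images of any
  -- generators span this space over `K`.
  · obtain ⟨t, htc, ht⟩ := hfg.exists_span_finset_card_eq_spanFinrank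
    rw [minGens, ← htc]
    have hQ : Submodule.span K ((t.image mkK : Finset (N ⧸ (I • ⊤ : Submodule A N))) :
        Set (N ⧸ (I • ⊤ : Submodule A N))) = ⊤ := by
      rw [eq_top_iff]
      intro q _
      obtain ⟨v, rfl⟩ := hmk q
      have hv : v ∈ Submodule.span A (t : Set N) := by rw [ht]; trivial
      refine Submodule.span_induction (p := fun v _ =>
        mkK v ∈ Submodule.span K ((t.image mkK : Finset (N ⧸ (I • ⊤ : Submodule A N))) :
        Set (N ⧸ (I • ⊤ : Submodule A N)))) ?_ ?_ ?_ ?_ hv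
      · intro x hx
        exact Submodule.subset_span (Finset.mem_coe.2 (Finset.mem_image_of_mem _ hx))
      · rw [map_zero]; exact zero_mem _
      · intro x y _ _ hx hy
        rw [map_add]; exact add_mem hx hy
      · intro c x _ hx
        obtain ⟨k, hk⟩ := hA c
        have h1 : mkK (c • x) = k • mkK x := by
          rw [← map_smul, ← sub_eq_zero, ← map_sub, ← algebraMap_smul A k x, ← sub_smul]
          exact (Submodule.Quotient.mk_eq_zero _).2 (Submodule.smul_mem_smul hk trivial)
        rw [h1]
        exact Submodule.smul_mem _ _ hx
    refine (finrank_le_of_span_eq_top (R := K) (v := fun x : (t.image mkK : Finset _) => (x : N ⧸ (I • ⊤ : Submodule A N))) ?_).trans ?_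
    · rw [Subtype.range_coe_subtype]
      exact hQ
    · rw [Fintype.card_coe]
      exact Finset.card_image_le

end Nakayama

section Graded

variable {K : Type*} [Field K] {N P : Type*} [AddCommMonoid N] [AddCommMonoid P]

/-- The projection to the component of degree `k`. -/
def gradeProj (K : Type*) [Field K] {P : Type*} (D : P → ℤ) (k : ℤ) :
    AddMonoidAlgebra K P →ₗ[K] AddMonoidAlgebra K P where
  toFun f := AddMonoidAlgebra.ofCoeff (open Classical in f.coeff.filter fun x => D x = k)
  map_add' f g := by
    rw [AddMonoidAlgebra.coeff_add, Finsupp.filter_add]; rfl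
  map_smul' c f := by
    rw [AddMonoidAlgebra.coeff_smul, Finsupp.filter_smul]; rfl

lemma gradeProj_single {P : Type*} (D : P → ℤ) (k : ℤ) (x : P) (c : K) :
    gradeProj K D k (AddMonoidAlgebra.single x c) =
      if D x = k then AddMonoidAlgebra.single x c else 0 := by
  classical
  apply AddMonoidAlgebra.coeff_injective
  change Finsupp.filter _ (Finsupp.single x c) = _
  split_ifs with h
  · rw [Finsupp.filter_single_of_pos (fun x => D x = k) h]; rfl
  · rw [Finsupp.filter_single_of_neg (fun x => D x = k) h]; rfl

lemma support_gradeProj {P : Type*} {D : P → ℤ} {k : ℤ} {f : AddMonoidAlgebra K P} {x : P}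
    (hx : x ∈ (gradeProj K D k f).coeff.support) : x ∈ f.coeff.support ∧ D x = k := by
  classical
  change x ∈ (Finsupp.filter _ f.coeff).support at hx
  rw [Finsupp.support_filter, Finset.mem_filter] at hx
  exact hx

variable [Algebra (AddMonoidAlgebra K N) (AddMonoidAlgebra K P)]

lemma gradeProj_smul {φ : N →+ P}
    (hφ : algebraMap (AddMonoidAlgebra K N) (AddMonoidAlgebra K P) =
      AddMonoidAlgebra.mapDomainRingHom K φ) {deg : N →+ ℕ} {D : P → ℤ}
    (hD : ∀ m x, D (φ m + x) = deg m + D x) {e : ℕ} {r : AddMonoidAlgebra K N}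
    (hr : r ∈ AddMonoidAlgebra.gradeBy K deg e) (k : ℤ) (f : AddMonoidAlgebra K P) :
    gradeProj K D k (r • f) = r • gradeProj K D (k - e) f := by
  have hsingle : ∀ m, deg m = e → ∀ c, gradeProj K D k ((AddMonoidAlgebra.single m c :
      AddMonoidAlgebra K N) • f) = (AddMonoidAlgebra.single m c : AddMonoidAlgebra K N) •
      gradeProj K D (k - e) f := by
    intro m hm c
    induction f using AddMonoidAlgebra.induction_linear with
    | zero => simp
    | add f g h h' => rw [smul_add, map_add, h, h', map_add, smul_add]
    | single x a =>
      rw [single_smul_single hφ, gradeProj_single, gradeProj_single, hD, hm]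
      by_cases h : D x = k - e
      · rw [if_pos h, if_pos (by omega), single_smul_single hφ]
      · rw [if_neg h, if_neg (by omega), smul_zero]
  conv_lhs => rw [← sum_single_coeff r]
  conv_rhs => rw [← sum_single_coeff r]
  rw [Finset.sum_smul, Finset.sum_smul, map_sum]
  exact Finset.sum_congr rfl fun m hm => hsingle m (hr m hm) _

variable [IsScalarTower K (AddMonoidAlgebra K N) (AddMonoidAlgebra K P)]

/-- The number of generators over a graded algebra `A → K[N]` of a module spanned by monomials. -/
theorem minGens_supportedSubmodule {φ : N →+ P}
    (hφ : algebraMap (AddMonoidAlgebra K N) (AddMonoidAlgebra K P) =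
      AddMonoidAlgebra.mapDomainRingHom K φ) (A : Set P) (hA : ∀ m, ∀ x ∈ A, φ m + x ∈ A)
    {deg : N →+ ℕ} {D : P → ℤ} (hD : ∀ m x, D (φ m + x) = deg m + D x) {D₀ : ℤ}
    (hD₀ : ∀ x ∈ A, D₀ ≤ D x) {S : Type*} [CommRing S] [Algebra K S]
    [Algebra S (AddMonoidAlgebra K N)]
    [Module S (AddMonoidAlgebra K P)]
    [IsScalarTower S (AddMonoidAlgebra K N) (AddMonoidAlgebra K P)]
    [IsScalarTower K S (AddMonoidAlgebra K P)]
    {I : Ideal S} {G : Set S} (hI : I = Ideal.span G)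
    (hS : ∀ a : S, ∃ k : K, a - algebraMap K S k ∈ I)
    (hG : ∀ g ∈ G, ∃ e, 0 < e ∧ algebraMap S (AddMonoidAlgebra K N) g ∈
      AddMonoidAlgebra.gradeBy K deg e)
    [Module.Finite K (supportedSubmodule K φ hφ A hA ⧸
      (I • ⊤ : Submodule S (supportedSubmodule K φ hφ A hA)))] :
    minGens S (supportedSubmodule K φ hφ A hA) =
      Module.finrank K (supportedSubmodule K φ hφ A hA ⧸
        (I • ⊤ : Submodule S (supportedSubmodule K φ hφ A hA))) := by
  classical
  set V := supportedSubmodule K φ hφ A hA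
  let b : A → V := fun x => ⟨AddMonoidAlgebra.single x.1 1, single_mem_supportedSubmodule hφ x.2 1⟩
  have hproj : ∀ k : ℤ, ∀ f ∈ V.restrictScalars K, gradeProj K D k f ∈ V.restrictScalars K :=
    fun k f hf x hx => hf x (support_gradeProj hx).1
  -- The degrees on `A` are integers bounded below by `D₀`; the shift by `D₀` makes them natural
  -- numbers, as the induction on degrees requires.
  let π : ℕ → V →ₗ[K] V := fun k => (gradeProj K D (D₀ + k)).restrict (hproj _)
  have hπ : ∀ k (v : V), ((π k v : V) : AddMonoidAlgebra K P) = gradeProj K D (D₀ + k) v :=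
    fun _ _ => rfl
  refine minGens_eq_finrank_quotient (A := S) (N := V) hI hS b ?_ (fun x => (D x.1 - D₀).toNat) π ?_ ?_
  · rw [eq_top_iff]
    rintro ⟨f, hf⟩ _
    have : (⟨f, hf⟩ : V) = ∑ x ∈ f.coeff.support.attach, f.coeff x.1 • b ⟨x.1, hf x.1 x.2⟩ := by
      apply Subtype.ext
      rw [AddSubmonoidClass.coe_finsetSum]
      refine ((Finset.sum_attach f.coeff.support
        (fun x => AddMonoidAlgebra.single x (f.coeff x))).trans (sum_single_coeff f)).symm.trans
        (Finset.sum_congr rfl fun x _ => ?_)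
      change _ = f.coeff x.1 • AddMonoidAlgebra.single x.1 1
      rw [AddMonoidAlgebra.smul_single, smul_eq_mul, mul_one]
    rw [this]
    exact Submodule.sum_mem _ fun x _ => Submodule.smul_mem _ _ (Submodule.subset_span ⟨_, rfl⟩)
  · intro k x
    apply Subtype.ext
    rw [hπ]
    change gradeProj K D (D₀ + k) (AddMonoidAlgebra.single x.1 1) = _
    rw [gradeProj_single]
    have h0 := hD₀ x.1 x.2
    by_cases h : D x.1 = D₀ + k
    · rw [if_pos h, if_pos (by omega)]
    · rw [if_neg h, if_neg (by omega)]; rfl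
  · intro g hg
    obtain ⟨e, he, hge⟩ := hG g hg
    refine ⟨e, he, fun k v => Subtype.ext ?_⟩
    have h1 : ∀ w : V, ((g • w : V) : AddMonoidAlgebra K P) =
        algebraMap S (AddMonoidAlgebra K N) g • (w : AddMonoidAlgebra K P) := by
      intro w
      rw [← algebraMap_smul (AddMonoidAlgebra K N) g w]
      rfl
    rw [hπ, h1, gradeProj_smul hφ hD hge]
    split_ifs with hk
    · rw [h1, hπ, show D₀ + (k : ℤ) - e = D₀ + ((k - e : ℕ) : ℤ) by omega]
    · have : gradeProj K D (D₀ + k - e) (v : AddMonoidAlgebra K P) = 0 := by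
        apply AddMonoidAlgebra.coeff_injective
        rw [AddMonoidAlgebra.coeff_zero, ← Finsupp.support_eq_empty, Finset.eq_empty_iff_forall_notMem]
        intro x hx
        have h2 := support_gradeProj hx
        have h3 := hD₀ x (v.2 x h2.1)
        omega
      rw [this, smul_zero]; rfl

end Graded

end ConicHK
end

/-! ### The functor `N ↦ N / J N` -/

noncomputable section
namespace ConicHK

section QuotientFunctor

open scoped TensorProduct

variable {A : Type*} [CommRing A] (J : Ideal A)

/-- `N / J N` for a module `N` isomorphic to a finite product. -/
def quotientPiEquiv {ι : Type*} [Fintype ι] [DecidableEq ι] {N : Type*} [AddCommGroup N]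
    [Module A N] {V : ι → Type*} [∀ i, AddCommGroup (V i)] [∀ i, Module A (V i)]
    (e : N ≃ₗ[A] ∀ i, V i) :
    (N ⧸ (J • ⊤ : Submodule A N)) ≃ₗ[A] ∀ i, V i ⧸ (J • ⊤ : Submodule A (V i)) :=
  (TensorProduct.quotTensorEquivQuotSMul N J).symm ≪≫ₗ e.lTensor (A ⧸ J) ≪≫ₗ
    TensorProduct.piRight A A (A ⧸ J) V ≪≫ₗ
    LinearEquiv.piCongrRight fun i => TensorProduct.quotTensorEquivQuotSMul (V i) J

/-- `N / J N` for isomorphic modules. -/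
def quotientCongr {N N' : Type*} [AddCommGroup N] [Module A N] [AddCommGroup N'] [Module A N']
    (e : N ≃ₗ[A] N') :
    (N ⧸ (J • ⊤ : Submodule A N)) ≃ₗ[A] N' ⧸ (J • ⊤ : Submodule A N') :=
  (TensorProduct.quotTensorEquivQuotSMul N J).symm ≪≫ₗ e.lTensor (A ⧸ J) ≪≫ₗ
    TensorProduct.quotTensorEquivQuotSMul N' J

/-- `N/JN` is `(A/J) ⊗ N`, which is finite over `A/J` and hence over `K`. -/
theorem finite_quotient_smul_top (K : Type*) [Field K] [Algebra K A] {N : Type*} [AddCommGroup N]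
    [Module A N] [Module K N] [IsScalarTower K A N] [Module.Finite A N] [Module.Finite K (A ⧸ J)] :
    Module.Finite K (N ⧸ (J • ⊤ : Submodule A N)) := by
  have : Module.Finite K ((A ⧸ J) ⊗[A] N) := Module.Finite.trans (A ⧸ J) _
  exact Module.Finite.equiv ((TensorProduct.quotTensorEquivQuotSMul N J).restrictScalars K)

/-- `B / J B` as a module and as a ring. -/
def quotientSmulTopEquiv (K : Type*) [Field K] [Algebra K A] {B : Type*} [CommRing B] [Algebra A B]
    [Algebra K B] [IsScalarTower K A B] :
    (B ⧸ (J • ⊤ : Submodule A B)) ≃ₗ[K] B ⧸ J.map (algebraMap A B) :=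
  ((Submodule.quotEquivOfEq _ _ (Ideal.smul_top_eq_map J)).restrictScalars K) ≪≫ₗ
    ((Submodule.Quotient.restrictScalarsEquiv A (J.map (algebraMap A B))).restrictScalars K)

end QuotientFunctor

/-! ### Frobenius powers and the ring `R^(q)` -/

section Frobenius

/-- The `q`-th power map of `B` is a ring homomorphism, so the powers of the images of elements of
`I` generate the Frobenius power of the extended ideal. -/
lemma frobeniusPower_map {A B : Type*} [CommRing A] [CommRing B] (f : A →+* B) {p : ℕ}
    [Fact p.Prime] [CharP B p] (I : Ideal A) (e : ℕ) :
    frobeniusPower (I.map f) (p ^ e) = (frobeniusPower I (p ^ e)).map f := by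
  have : ExpChar B p := ExpChar.prime Fact.out
  apply le_antisymm
  · rw [frobeniusPower, Ideal.span_le]
    have h : I.map f ≤ ((frobeniusPower I (p ^ e)).map f).comap (iterateFrobenius B p e) := by
      rw [Ideal.map_le_iff_le_comap]
      intro a ha
      rw [Ideal.mem_comap, Ideal.mem_comap, iterateFrobenius_def, ← map_pow]
      exact Ideal.mem_map_of_mem f (Ideal.subset_span ⟨a, ha, rfl⟩)
    rintro _ ⟨a, ha, rfl⟩
    exact h ha
  · rw [frobeniusPower, Ideal.map_span, Ideal.span_le]
    rintro _ ⟨_, ⟨a, ha, rfl⟩, rfl⟩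
    refine Ideal.subset_span ⟨f a, Ideal.mem_map_of_mem f ha, ?_⟩
    rw [map_pow]

variable {K : Type*} [Field K] {d : ℕ} {M : AddSubmonoid (Fin d → ℤ)}

instance isScalarTower_group :
    IsScalarTower K (AddMonoidAlgebra K M) (AddMonoidAlgebra K (Fin d → ℤ)) :=
  IsScalarTower.of_algebraMap_eq fun k => by
    change _ = AddMonoidAlgebra.mapDomainRingHom K M.subtype _
    simp

instance isScalarTower_root (n : ℕ) :
    IsScalarTower K (AddMonoidAlgebra K M) (AddMonoidAlgebra K (rootMonoid M n)) :=
  IsScalarTower.of_algebraMap_eq fun k => by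
    change _ = AddMonoidAlgebra.mapDomainRingHom K (toRoot M n) _
    simp

/-- Multiplication by `n` is an isomorphism `(1/n) M ≃ M`. -/
def rootEquiv (M : AddSubmonoid (Fin d → ℤ)) {n : ℕ} (hn : 0 < n) : rootMonoid M n ≃+ M :=
  (AddEquiv.ofBijective
    ({ toFun := fun m => ⟨(n : ℝ)⁻¹ • castHom d m, m, m.2, by
          change castHom d m = n • _
          rw [← Nat.cast_smul_eq_nsmul ℝ, smul_smul, mul_inv_cancel₀ (by positivity), one_smul]⟩
       map_zero' := by ext; simp
       map_add' := fun a b => by ext; simp [mul_add] } : M →+ rootMonoid M n)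
    ⟨fun a b h => by
      have h1 : (n : ℝ)⁻¹ • castHom d a = (n : ℝ)⁻¹ • castHom d b := congrArg Subtype.val h
      exact Subtype.ext (castHom_injective d
        (smul_right_injective _ (inv_ne_zero (by positivity : (n : ℝ) ≠ 0)) h1)),
    fun y => by
      obtain ⟨m, hm, h⟩ := mem_rootMonoid_iff.1 y.2
      refine ⟨⟨m, hm⟩, Subtype.ext ?_⟩
      change (n : ℝ)⁻¹ • castHom d m = _
      rw [h, ← Nat.cast_smul_eq_nsmul ℝ, smul_smul, inv_mul_cancel₀ (by positivity), one_smul]⟩).symm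

lemma rootEquiv_toRoot {n : ℕ} (hn : 0 < n) (m : M) : rootEquiv M hn (toRoot M n m) = n • m := by
  rw [rootEquiv, AddEquiv.symm_apply_eq]
  apply Subtype.ext
  change castHom d m = (n : ℝ)⁻¹ • castHom d (n • (m : Fin d → ℤ))
  rw [map_nsmul, ← Nat.cast_smul_eq_nsmul ℝ, smul_smul, inv_mul_cancel₀ (by positivity), one_smul]

variable {p : ℕ} [Fact p.Prime] [CharP K p]

instance charP_addMonoidAlgebra {N : Type*} [AddCommMonoid N] : CharP (AddMonoidAlgebra K N) p :=
  charP_of_injective_algebraMap (algebraMap K (AddMonoidAlgebra K N)).injective p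

variable [PerfectRing K p]

/-- The isomorphism `R^(p^e) ≃ R` given by the Frobenius map of `R^(p^e)`. -/
def rootRingEquiv (K : Type*) [Field K] (M : AddSubmonoid (Fin d → ℤ)) (p : ℕ) [Fact p.Prime]
    [CharP K p] [PerfectRing K p] (e : ℕ) :
    AddMonoidAlgebra K (rootMonoid M (p ^ e)) ≃+* AddMonoidAlgebra K M :=
  have : ExpChar K p := ExpChar.prime Fact.out
  (AddMonoidAlgebra.mapRingEquiv _ (iterateFrobeniusEquiv K p e)).trans
    (AddMonoidAlgebra.mapDomainRingEquiv K
      (rootEquiv M (pow_pos (Nat.Prime.pos (Fact.out : p.Prime)) e)))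

lemma rootRingEquiv_single (e : ℕ) (y : rootMonoid M (p ^ e)) (k : K) :
    rootRingEquiv K M p e (AddMonoidAlgebra.single y k) = AddMonoidAlgebra.single
      (rootEquiv M (pow_pos (Nat.Prime.pos (Fact.out : p.Prime)) e) y) (k ^ p ^ e) := by
  have : ExpChar K p := ExpChar.prime Fact.out
  rw [rootRingEquiv, RingEquiv.trans_apply, AddMonoidAlgebra.mapRingEquiv_single,
    AddMonoidAlgebra.mapDomainRingEquiv_single, iterateFrobeniusEquiv_def]

/-- On the subring `R` of `R^(q)` the isomorphism is the `q`-th power map; therefore it carries the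
extension of `J` to `J^[q]`. -/
lemma rootRingEquiv_algebraMap (e : ℕ) (f : AddMonoidAlgebra K M) :
    rootRingEquiv K M p e (algebraMap _ _ f) = f ^ p ^ e := by
  have : ExpChar (AddMonoidAlgebra K M) p := ExpChar.prime Fact.out
  rw [← iterateFrobenius_def]
  induction f using AddMonoidAlgebra.induction_linear with
  | zero => simp
  | add f g hf hg => rw [map_add, map_add, map_add, hf, hg]
  | single m k =>
    have h : algebraMap (AddMonoidAlgebra K M) (AddMonoidAlgebra K (rootMonoid M (p ^ e)))
        (AddMonoidAlgebra.single m k) = AddMonoidAlgebra.single (toRoot M (p ^ e) m) k :=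
      AddMonoidAlgebra.mapDomain_single
    rw [h, rootRingEquiv_single, rootEquiv_toRoot, iterateFrobenius_def,
      AddMonoidAlgebra.single_pow]

/-- `R / J^[q] ≃ R^(q) / J R^(q)`, semilinearly over the Frobenius map of `K`. -/
def quotientFrobeniusEquiv (J : Ideal (AddMonoidAlgebra K M)) (e : ℕ) :
    (AddMonoidAlgebra K (rootMonoid M (p ^ e)) ⧸ J.map (algebraMap (AddMonoidAlgebra K M)
      (AddMonoidAlgebra K (rootMonoid M (p ^ e))))) ≃+*
    AddMonoidAlgebra K M ⧸ frobeniusPower J (p ^ e) :=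
  Ideal.quotientEquiv _ _ (rootRingEquiv K M p e) (by
    rw [Ideal.map_map]
    have h : ((rootRingEquiv K M p e : _ →+* AddMonoidAlgebra K M).comp
        (algebraMap (AddMonoidAlgebra K M) (AddMonoidAlgebra K (rootMonoid M (p ^ e))))) =
        (fun f => f ^ p ^ e : AddMonoidAlgebra K M → AddMonoidAlgebra K M) :=
      funext (rootRingEquiv_algebraMap e)
    rw [Ideal.map, h, frobeniusPower])

lemma exists_semilinear_equiv (J : Ideal (AddMonoidAlgebra K M)) (e : ℕ) :
    ∃ (i : K ≃+* K) (j : (AddMonoidAlgebra K (rootMonoid M (p ^ e)) ⧸ J.map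
        (algebraMap (AddMonoidAlgebra K M) (AddMonoidAlgebra K (rootMonoid M (p ^ e))))) ≃+*
        AddMonoidAlgebra K M ⧸ frobeniusPower J (p ^ e)),
      (algebraMap K _).comp i.toRingHom = j.toRingHom.comp (algebraMap K _) := by
  have : ExpChar K p := ExpChar.prime Fact.out
  refine ⟨iterateFrobeniusEquiv K p e, quotientFrobeniusEquiv J e, ?_⟩
  ext k
  have h := rootRingEquiv_single (M := M) e 0 k
  rw [map_zero] at h
  exact congrArg (Ideal.Quotient.mk _) h.symm

/-- The isomorphism of quotient rings is semilinear over the Frobenius map of `K`. As `K` is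
perfect, this is an automorphism, and dimensions are preserved. -/
theorem finrank_quotient_frobeniusPower (J : Ideal (AddMonoidAlgebra K M)) (e : ℕ) :
    Module.finrank K (AddMonoidAlgebra K M ⧸ frobeniusPower J (p ^ e)) =
      Module.finrank K (AddMonoidAlgebra K (rootMonoid M (p ^ e)) ⧸
        (J • ⊤ : Submodule (AddMonoidAlgebra K M) (AddMonoidAlgebra K (rootMonoid M (p ^ e))))) := by
  rw [LinearEquiv.finrank_eq (quotientSmulTopEquiv J K)]
  obtain ⟨i, j, h⟩ := exists_semilinear_equiv (p := p) J e
  exact (Algebra.finrank_eq_of_equiv_equiv i j h).symm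

theorem finite_quotient_frobeniusPower (J : Ideal (AddMonoidAlgebra K M)) (e : ℕ)
    [Module.Finite K (AddMonoidAlgebra K (rootMonoid M (p ^ e)) ⧸ (J • ⊤ :
      Submodule (AddMonoidAlgebra K M) (AddMonoidAlgebra K (rootMonoid M (p ^ e)))))] :
    Module.Finite K (AddMonoidAlgebra K M ⧸ frobeniusPower J (p ^ e)) := by
  have := Module.Finite.equiv (quotientSmulTopEquiv (B := AddMonoidAlgebra K (rootMonoid M (p ^ e)))
    J K)
  obtain ⟨i, j, h⟩ := exists_semilinear_equiv (p := p) J e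
  exact Module.Finite.of_equiv_equiv i j h

end Frobenius

end ConicHK
end

/-! ### The decomposition of `R^(n)` and its length modulo an ideal -/

noncomputable section
namespace ConicHK

section ClassProjection

variable {K : Type*} [Field K] {N P β : Type*} [AddCommMonoid N] [AddCommMonoid P]
  [Algebra (AddMonoidAlgebra K N) (AddMonoidAlgebra K P)]

open Classical in
/-- The projection to the span of the monomials in a class `b` of exponents, for a classification of
exponents that is invariant under `N`. -/
def classProj {φ : N →+ P}
    (hφ : algebraMap (AddMonoidAlgebra K N) (AddMonoidAlgebra K P) =
      AddMonoidAlgebra.mapDomainRingHom K φ) (D : P → β) (hD : ∀ m x, D (φ m + x) = D x) (b : β) :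
    AddMonoidAlgebra K P →ₗ[AddMonoidAlgebra K N] AddMonoidAlgebra K P where
  toFun f := AddMonoidAlgebra.ofCoeff (f.coeff.filter fun x => D x = b)
  map_add' f g := by
    rw [AddMonoidAlgebra.coeff_add, Finsupp.filter_add]; rfl
  map_smul' r f := by
    let F : AddMonoidAlgebra K P →+ AddMonoidAlgebra K P :=
      { toFun := fun f => AddMonoidAlgebra.ofCoeff (f.coeff.filter fun x => D x = b)
        map_zero' := by rw [AddMonoidAlgebra.coeff_zero, Finsupp.filter_zero]; rfl
        map_add' := fun f g => by rw [AddMonoidAlgebra.coeff_add, Finsupp.filter_add]; rfl }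
    have hF : ∀ x c, F (AddMonoidAlgebra.single x c) =
        if D x = b then AddMonoidAlgebra.single x c else 0 := by
      intro x c
      apply AddMonoidAlgebra.coeff_injective
      change Finsupp.filter _ (Finsupp.single x c) = _
      split_ifs with h
      · rw [Finsupp.filter_single_of_pos (fun x => D x = b) h]; rfl
      · rw [Finsupp.filter_single_of_neg (fun x => D x = b) h]; rfl
    change F (r • f) = r • F f
    induction r using AddMonoidAlgebra.induction_linear with
    | zero => simp
    | add r r' h h' => rw [add_smul, map_add, h, h', add_smul]
    | single m a =>
      induction f using AddMonoidAlgebra.induction_linear with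
      | zero => simp
      | add f g h h' => rw [smul_add, map_add, h, h', map_add, smul_add]
      | single x c =>
        rw [single_smul_single hφ, hF, hF, hD]
        split_ifs
        · rw [single_smul_single hφ]
        · rw [smul_zero]

open Classical in
lemma coeff_classProj {φ : N →+ P}
    (hφ : algebraMap (AddMonoidAlgebra K N) (AddMonoidAlgebra K P) =
      AddMonoidAlgebra.mapDomainRingHom K φ) (D : P → β) (hD : ∀ m x, D (φ m + x) = D x) (b : β) (f : AddMonoidAlgebra K P) (x : P) :
    (classProj hφ D hD b f).coeff x = if D x = b then f.coeff x else 0 :=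
  Finsupp.filter_apply _ _ _

/-- The decomposition of `K[P]` by a classification of exponents that is invariant under `N`. -/
theorem nonempty_equiv_pi {φ : N →+ P}
    (hφ : algebraMap (AddMonoidAlgebra K N) (AddMonoidAlgebra K P) =
      AddMonoidAlgebra.mapDomainRingHom K φ) (D : P → β) (hD : ∀ m x, D (φ m + x) = D x)
    (s : Set β) [Fintype s] (hs : ∀ x, D x ∈ s)
    (V : s → Submodule (AddMonoidAlgebra K N) (AddMonoidAlgebra K P))
    (hV : ∀ b f, f ∈ V b ↔ ∀ x ∈ f.coeff.support, D x = b) :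
    Nonempty (AddMonoidAlgebra K P ≃ₗ[AddMonoidAlgebra K N] ∀ b, V b) := by
  classical
  have hmem : ∀ (b : s) f, classProj hφ D hD b f ∈ V b := by
    intro b f
    rw [hV]
    intro x hx
    rw [Finsupp.mem_support_iff, coeff_classProj] at hx
    by_contra h
    exact hx (if_neg h)
  refine ⟨LinearEquiv.ofBijective
    (LinearMap.pi fun b : s => (classProj hφ D hD b).codRestrict (V b) (hmem b)) ⟨?_, ?_⟩⟩
  · intro f g hfg
    apply AddMonoidAlgebra.coeff_injective
    ext x
    have h1 : classProj hφ D hD (D x) f = classProj hφ D hD (D x) g :=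
      congrArg Subtype.val (congrFun hfg ⟨D x, hs x⟩)
    have h2 := congrArg (fun f => f.coeff x) h1
    simpa [coeff_classProj] using h2
  · intro v
    refine ⟨∑ b, (v b : AddMonoidAlgebra K P), ?_⟩
    funext b
    apply Subtype.ext
    change classProj hφ D hD b (∑ b, (v b : AddMonoidAlgebra K P)) = v b
    apply AddMonoidAlgebra.coeff_injective
    have hz : ∀ (b : s) x, D x ≠ b → (v b : AddMonoidAlgebra K P).coeff x = 0 := by
      intro b x h
      by_contra h0
      exact h ((hV b _).1 (v b).2 x (Finsupp.mem_support_iff.2 h0))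
    ext x
    rw [coeff_classProj]
    split_ifs with h
    · rw [AddMonoidAlgebra.coeff_sum, Finsupp.finsetSum_apply]
      refine Finset.sum_eq_single b (fun b' _ hb' => hz b' x fun h' => hb' ?_) (by simp)
      exact Subtype.ext (h'.symm.trans h)
    · exact (hz b x h).symm

end ClassProjection

section Root

variable {K : Type*} [Field K] {d s : ℕ} {M : AddSubmonoid (Fin d → ℤ)} {σ : Fin s → Fin d → ℤ}

/-- Exponents are classified by their image in the torus, which is invariant under `M` because `M ⊂
ℤ^d`. -/
lemma nonempty_root_equiv {n : ℕ} [Fintype (rootClasses d n)] :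
    Nonempty (AddMonoidAlgebra K (rootMonoid M n) ≃ₗ[AddMonoidAlgebra K M]
      ∀ c : rootClasses d n, residueSummand K M n c) := by
  refine nonempty_equiv_pi rfl (fun y : rootMonoid M n => (QuotientAddGroup.mk (y : Fin d → ℝ) : Torus d))
    ?_ (rootClasses d n : Set (Torus d)) ?_ (fun c => residueSummand K M n c) (fun b f => Iff.rfl)
  · intro m x
    change (QuotientAddGroup.mk (castHom d m + (x : Fin d → ℝ)) : Torus d) = _
    have h : (QuotientAddGroup.mk (castHom d m) : Torus d) = 0 :=
      (QuotientAddGroup.eq_zero_iff _).2 ⟨m, rfl⟩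
    rw [QuotientAddGroup.mk_add, h, zero_add]
  · intro y
    obtain ⟨m, -, hm⟩ := mem_rootMonoid_iff.1 y.2
    exact ⟨y, ⟨m, hm⟩, rfl⟩

lemma isNoetherianRing_monoidAlgebra (hM : IsPositiveNormalAffine M) :
    IsNoetherianRing (AddMonoidAlgebra K M) := by
  have : AddMonoid.FG M := (AddMonoid.fg_iff_addSubmonoid_fg M).2 hM.fg
  exact Algebra.FiniteType.isNoetherianRing K _

lemma exists_add_mem (hM : IsPositiveNormalAffine M) (hσ : IsSupportForms M σ) (z : Fin s → ℤ) :
    ∃ t : M, ∀ x ∈ upperSet σ z, x + t ∈ M := by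
  obtain ⟨v, hv⟩ := exists_interior hM hσ
  let N : ℕ := ∑ j, (z j).natAbs
  have hN : ∀ j, -(N : ℤ) ≤ z j := fun j => by
    have := Finset.single_le_sum (f := fun j => (z j).natAbs) (fun _ _ => Nat.zero_le _)
      (Finset.mem_univ j)
    change (z j).natAbs ≤ N at this
    omega
  refine ⟨⟨N • v, M.nsmul_mem ((mem_monoid_iff hM hσ).2 fun i => (hv i).le) N⟩, fun x hx => ?_⟩
  rw [mem_monoid_iff hM hσ]
  intro i
  rw [map_add, map_nsmul, nsmul_eq_mul]
  nlinarith [hv i, hN i, hx i]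

/-- The ideal lies in the cyclic module generated by a single monomial `-t`, and `K[M]` is
noetherian. -/
lemma finite_divisorialIdeal (hM : IsPositiveNormalAffine M) (hσ : IsSupportForms M σ)
    (z : Fin s → ℤ) : Module.Finite (AddMonoidAlgebra K M) (divisorialIdeal K hM hσ z) := by
  have := isNoetherianRing_monoidAlgebra (K := K) hM
  obtain ⟨t, ht⟩ := exists_add_mem hM hσ z
  let W := Submodule.span (AddMonoidAlgebra K M)
    {(AddMonoidAlgebra.single (-(t : Fin d → ℤ)) 1 : AddMonoidAlgebra K (Fin d → ℤ))}
  have hW : IsNoetherian (AddMonoidAlgebra K M) W :=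
    isNoetherian_span_of_finite _ (Set.finite_singleton _)
  refine Module.Finite.iff_fg.2 (isNoetherian_submodule.1 hW _ ?_)
  intro f hf
  rw [← sum_single_coeff f]
  refine Submodule.sum_mem _ fun x hx => ?_
  have h2 := single_smul_single (K := K) (φ := M.subtype) rfl ⟨x + t, ht x (hf x hx)⟩ (f.coeff x)
    (-(t : Fin d → ℤ)) 1
  change _ = AddMonoidAlgebra.single (x + t + -(t : Fin d → ℤ)) _ at h2
  rw [add_neg_cancel_right, mul_one] at h2
  rw [← h2]
  exact Submodule.smul_mem _ _ (Submodule.subset_span rfl)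

lemma finite_conicOfCell (hM : IsPositiveNormalAffine M) (hσ : IsSupportForms M σ)
    {γ : Set (Fin d → ℝ)} (hγ : IsOpenCell σ γ) :
    Module.Finite (AddMonoidAlgebra K M) (conicOfCell K M σ γ) := by
  rw [conicOfCell_eq hM hσ hγ]
  exact finite_divisorialIdeal hM hσ _

lemma conicOfCell_ne_bot (hM : IsPositiveNormalAffine M) (hσ : IsSupportForms M σ)
    {γ : Set (Fin d → ℝ)} (hγ : IsOpenCell σ γ) : conicOfCell K M σ γ ≠ ⊥ := by
  rw [conicOfCell_eq hM hσ hγ]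
  obtain ⟨v, hv⟩ := exists_interior hM hσ
  let N : ℕ := ∑ j, (cellBounds σ γ j).natAbs
  rw [Submodule.ne_bot_iff]
  refine ⟨AddMonoidAlgebra.single (N • v) 1, single_mem_supportedSubmodule rfl (fun i => ?_) 1, ?_⟩
  · have := Finset.single_le_sum (f := fun j => (cellBounds σ γ j).natAbs)
      (fun _ _ => Nat.zero_le _) (Finset.mem_univ i)
    change (cellBounds σ γ i).natAbs ≤ N at this
    have h1 : cellBounds σ γ i ≤ (N : ℤ) := by omega
    rw [map_nsmul, nsmul_eq_mul]
    nlinarith [hv i]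
  · intro h
    have := congrArg (fun f => f.coeff (N • v)) h
    simp at this

/-- Dimensions add up over the summands `I_c`, which are grouped by the unique `γ` with `I_c ≅ 𝒞_γ`.
The ideal is kept general, since both `𝔪` and the extension of `𝔪_S` are needed. -/
theorem finrank_root_quotient (hM : IsPositiveNormalAffine M) (hσ : IsSupportForms M σ)
    {T : Set (Set (Fin d → ℝ))} (hT : IsCellRepresentatives σ T) (hfin : T.Finite)
    (J : Ideal (AddMonoidAlgebra K M)) [Module.Finite K (AddMonoidAlgebra K M ⧸ J)] {n : ℕ}
    (hn : 0 < n) :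
    Module.Finite K (AddMonoidAlgebra K (rootMonoid M n) ⧸
      (J • ⊤ : Submodule (AddMonoidAlgebra K M) (AddMonoidAlgebra K (rootMonoid M n)))) ∧
    Module.finrank K (AddMonoidAlgebra K (rootMonoid M n) ⧸
      (J • ⊤ : Submodule (AddMonoidAlgebra K M) (AddMonoidAlgebra K (rootMonoid M n)))) =
      ∑ γ ∈ hfin.toFinset, Module.finrank K (conicOfCell K M σ γ ⧸
        (J • ⊤ : Submodule (AddMonoidAlgebra K M) (conicOfCell K M σ γ))) *
          multiplicity K M σ γ n := by
  classical
  have : Fintype (rootClasses d n) := (finite_rootClasses hn).fintype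
  obtain ⟨e⟩ := nonempty_root_equiv (K := K) (M := M) (n := n)
  have E := (quotientPiEquiv J e).restrictScalars K
  choose g hg huniq using fun c : rootClasses d n =>
    existsUnique_residueSummand_equiv (K := K) hM hσ hT hn c.2
  have hgT := fun c => (hg c).1
  have E' := fun c => (quotientCongr J (hg c).2.some).restrictScalars K
  have hfin' : ∀ c : rootClasses d n, Module.Finite K (residueSummand K M n c ⧸
      (J • ⊤ : Submodule (AddMonoidAlgebra K M) (residueSummand K M n c))) := by
    intro c
    have := finite_conicOfCell (K := K) hM hσ (hT.isOpenCell _ (hgT c))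
    have := finite_quotient_smul_top J K (N := conicOfCell K M σ (g c))
    exact Module.Finite.equiv (E' c).symm
  refine ⟨Module.Finite.equiv E.symm, ?_⟩
  rw [E.finrank_eq, Module.finrank_pi_fintype, Finset.sum_congr rfl fun c _ => (E' c).finrank_eq,
    ← Finset.sum_fiberwise_of_maps_to (s := Finset.univ) (t := hfin.toFinset) (g := g)
      fun c _ => hfin.mem_toFinset.2 (hgT c)]
  refine Finset.sum_congr rfl fun γ hγ => ?_
  rw [Finset.sum_congr rfl fun c hc => by rw [(Finset.mem_filter.1 hc).2], Finset.sum_const,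
    smul_eq_mul, mul_comm]
  congr 1
  rw [multiplicity, ← Set.ncard_coe_finset, ← Set.ncard_image_of_injective _ Subtype.val_injective]
  congr 1
  ext c
  constructor
  · rintro ⟨c, hc, rfl⟩
    refine ⟨c.2, ?_⟩
    rw [← (Finset.mem_filter.1 hc).2]
    exact (hg c).2
  · rintro ⟨hc, h⟩
    refine ⟨⟨c, hc⟩, ?_, rfl⟩
    rw [Finset.coe_filter]
    exact ⟨Finset.mem_univ _, (huniq ⟨c, hc⟩ γ ⟨hfin.mem_toFinset.1 hγ, h⟩).symm⟩

end Root

end ConicHK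
end

/-! ### Gradings and minimal numbers of generators -/

noncomputable section
namespace ConicHK

section ChangeOfRings

theorem finite_quotient_of_forall_exists (K : Type*) {A : Type*} [Field K] [CommRing A] [Algebra K A]
    {I : Ideal A} (hA : ∀ a : A, ∃ k : K, a - algebraMap K A k ∈ I) : Module.Finite K (A ⧸ I) := by
  refine Module.Finite.of_surjective (Algebra.linearMap K (A ⧸ I)) fun x => ?_
  obtain ⟨a, rfl⟩ := Ideal.Quotient.mk_surjective x
  obtain ⟨k, hk⟩ := hA a
  exact ⟨k, ((Ideal.Quotient.mk_eq_mk_iff_sub_mem _ _).2 hk).symm⟩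

/-- `N / I N` for an ideal `I` of `A` and its extension to an `A`-algebra. -/
def quotientMapEquiv (K : Type*) {A B N : Type*} [Field K] [CommRing A] [CommRing B] [Algebra A B]
    [Algebra K A] [Algebra K B] [AddCommGroup N] [Module A N] [Module B N] [Module K N]
    [IsScalarTower A B N] [IsScalarTower K A N] [IsScalarTower K B N] (I : Ideal A) :
    (N ⧸ (I • ⊤ : Submodule A N)) ≃ₗ[K] N ⧸ (I.map (algebraMap A B) • ⊤ : Submodule B N) :=
  ((Submodule.quotEquivOfEq _ _ (Ideal.smul_restrictScalars I (⊤ : Submodule B N)).symm).restrictScalars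
    K) ≪≫ₗ ((Submodule.Quotient.restrictScalarsEquiv A
      (I.map (algebraMap A B) • ⊤ : Submodule B N)).restrictScalars K)

end ChangeOfRings

variable {K : Type*} [Field K] {d s : ℕ} {M : AddSubmonoid (Fin d → ℤ)} {σ : Fin s → Fin d → ℤ}

section Degrees

/-- A homomorphism on `M` extends to the group generated by `M`. -/
lemma exists_extension (hM : IsPositiveNormalAffine M) (deg : M →+ ℕ) :
    ∃ D : (Fin d → ℤ) →+ ℤ, ∀ m : M, D m = deg m := by
  have hrep : ∀ x : Fin d → ℤ, ∃ a b : M, x = a - b := by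
    intro x
    have hx : x ∈ AddSubgroup.closure (M : Set (Fin d → ℤ)) := by rw [hM.gp]; trivial
    induction hx using AddSubgroup.closure_induction with
    | mem x hx => exact ⟨⟨x, hx⟩, 0, by simp⟩
    | zero => exact ⟨0, 0, by simp⟩
    | add x y _ _ hx hy =>
      obtain ⟨a, b, rfl⟩ := hx
      obtain ⟨a', b', rfl⟩ := hy
      exact ⟨a + a', b + b', by push_cast; abel⟩
    | neg x _ hx =>
      obtain ⟨a, b, rfl⟩ := hx
      exact ⟨b, a, by abel⟩
  choose a b hab using hrep
  have hwd : ∀ (x : Fin d → ℤ) (a' b' : M), x = a' - b' → (deg (a x) : ℤ) - deg (b x) = deg a' - deg b' := by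
    intro x a' b' h
    have h1 : a x + b' = a' + b x := by
      apply Subtype.ext
      push_cast
      linear_combination h - hab x
    have h2 := congrArg deg h1
    rw [map_add, map_add] at h2
    omega
  refine ⟨AddMonoidHom.mk' (fun x => (deg (a x) : ℤ) - deg (b x)) fun x y => ?_, fun m => ?_⟩
  · rw [hwd (x + y) (a x + a y) (b x + b y)
      (by push_cast; linear_combination hab x + hab y), map_add, map_add]
    push_cast
    ring
  · change (deg (a m) : ℤ) - deg (b m) = deg m
    rw [hwd m m 0 (by simp)]
    simp

/-- There is a grading of `M` by positive degrees. -/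
lemma exists_degree (hM : IsPositiveNormalAffine M) (hσ : IsSupportForms M σ) :
    ∃ deg : M →+ ℕ, ∀ x : M, x ≠ 0 → 0 < deg x := by
  have hnn := fun (m : M) i => (mem_monoid_iff hM hσ).1 m.2 i
  refine ⟨{ toFun := fun m => ∑ i, (intForm (σ i) m).toNat
            map_zero' := by simp
            map_add' := fun m m' => ?_ }, fun x hx => ?_⟩
  · rw [← Finset.sum_add_distrib]
    refine Finset.sum_congr rfl fun i _ => ?_
    rw [AddSubmonoid.coe_add, map_add, Int.toNat_add (hnn m i) (hnn m' i)]
  · by_contra h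
    change ¬ 0 < ∑ i, (intForm (σ i) x).toNat at h
    apply hx
    apply Subtype.ext
    refine eq_zero_of_intForm hM hσ fun i => ?_
    have h1 := Finset.sum_eq_zero_iff.1 (Nat.eq_zero_of_not_pos h) i (Finset.mem_univ i)
    have := hnn x i
    omega

lemma sub_coeff_zero_mem (f : AddMonoidAlgebra K M) :
    ∃ k : K, f - algebraMap K _ k ∈ monomialMaxIdeal K M := by
  classical
  induction f using AddMonoidAlgebra.induction_linear with
  | zero => exact ⟨0, by simp⟩
  | add f g hf hg =>
    obtain ⟨k, hk⟩ := hf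
    obtain ⟨l, hl⟩ := hg
    refine ⟨k + l, ?_⟩
    rw [map_add, add_sub_add_comm]
    exact add_mem hk hl
  | single m c =>
    by_cases hm : m = 0
    · refine ⟨c, ?_⟩
      rw [hm, AddMonoidAlgebra.coe_algebraMap]
      simp
    · refine ⟨0, ?_⟩
      rw [map_zero, sub_zero]
      have h : (AddMonoidAlgebra.single m c : AddMonoidAlgebra K M) =
          AddMonoidAlgebra.single 0 c * AddMonoidAlgebra.single m 1 := by
        rw [AddMonoidAlgebra.single_mul_single, zero_add, mul_one]
      rw [h]
      exact Ideal.mul_mem_left _ _ (Ideal.subset_span ⟨m, hm, rfl⟩)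

lemma finite_quotient_monomialMaxIdeal :
    Module.Finite K (AddMonoidAlgebra K M ⧸ monomialMaxIdeal K M) :=
  finite_quotient_of_forall_exists K sub_coeff_zero_mem

/-- The minimal number of generators of a conic ideal over a graded algebra `S → R` such that `R` is
a finite `S`-module. -/
lemma minGens_conicOfCell (hM : IsPositiveNormalAffine M) (hσ : IsSupportForms M σ)
    {γ : Set (Fin d → ℝ)} (hγ : IsOpenCell σ γ) (deg : M →+ ℕ)
    {S : Type*} [CommRing S] [Algebra K S] [Algebra S (AddMonoidAlgebra K M)]
    [Module S (AddMonoidAlgebra K (Fin d → ℤ))]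
    [IsScalarTower S (AddMonoidAlgebra K M) (AddMonoidAlgebra K (Fin d → ℤ))]
    [IsScalarTower K S (AddMonoidAlgebra K (Fin d → ℤ))] [Module.Finite S (AddMonoidAlgebra K M)]
    {I : Ideal S} {G : Set S} (hI : I = Ideal.span G)
    (hS : ∀ a : S, ∃ k : K, a - algebraMap K S k ∈ I)
    (hG : ∀ g ∈ G, ∃ e, 0 < e ∧ algebraMap S (AddMonoidAlgebra K M) g ∈
      AddMonoidAlgebra.gradeBy K deg e) :
    minGens S (conicOfCell K M σ γ) = Module.finrank K (conicOfCell K M σ γ ⧸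
      (I • ⊤ : Submodule S (conicOfCell K M σ γ))) := by
  obtain ⟨D, hD⟩ := exists_extension hM deg
  obtain ⟨t, ht⟩ := exists_add_mem hM hσ (cellBounds σ γ)
  have hfin : Module.Finite S (conicOfCell K M σ γ) := by
    have := finite_conicOfCell (K := K) hM hσ hγ
    exact Module.Finite.trans (AddMonoidAlgebra K M) _
  have := finite_quotient_of_forall_exists K hS
  have hfinQ := finite_quotient_smul_top I K (N := conicOfCell K M σ γ)
  revert hfinQ
  rw [conicOfCell_eq hM hσ hγ, divisorialIdeal]
  intro hfinQ
  -- As `x + t ∈ M` for all exponents `x` of the ideal, their degrees are at least `-deg t`.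
  refine minGens_supportedSubmodule rfl _ _ (deg := deg) (D := D) (D₀ := -deg t) (fun m x => ?_)
    (fun x hx => ?_) hI hS hG
  · rw [map_add, ← hD]; rfl
  · have h1 := hD ⟨x + t, ht x hx⟩
    change D (x + t) = _ at h1
    rw [map_add, hD] at h1
    omega

lemma mem_gradeBy_single (deg : M →+ ℕ) {m : M} {g : AddMonoidAlgebra K M}
    (hg : g = AddMonoidAlgebra.single m 1) :
    g ∈ AddMonoidAlgebra.gradeBy K deg (deg m) := by
  rw [hg]
  exact AddMonoidAlgebra.single_mem_gradeBy deg m 1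

theorem minGens_conicOfCell_monomialMaxIdeal (hM : IsPositiveNormalAffine M)
    (hσ : IsSupportForms M σ) {γ : Set (Fin d → ℝ)} (hγ : IsOpenCell σ γ) :
    minGens (AddMonoidAlgebra K M) (conicOfCell K M σ γ) =
      Module.finrank K (conicOfCell K M σ γ ⧸ (monomialMaxIdeal K M • ⊤ :
        Submodule (AddMonoidAlgebra K M) (conicOfCell K M σ γ))) := by
  obtain ⟨deg, hdeg⟩ := exists_degree hM hσ
  refine minGens_conicOfCell hM hσ hγ deg rfl sub_coeff_zero_mem ?_
  rintro g ⟨m, hm, hg⟩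
  exact ⟨deg m, hdeg m hm, mem_gradeBy_single deg hg⟩

theorem minGens_root (hM : IsPositiveNormalAffine M) (hσ : IsSupportForms M σ) {n : ℕ} (hn : 0 < n)
    [Module.Finite K (AddMonoidAlgebra K (rootMonoid M n) ⧸ (monomialMaxIdeal K M • ⊤ :
        Submodule (AddMonoidAlgebra K M) (AddMonoidAlgebra K (rootMonoid M n))))] :
    minGens (AddMonoidAlgebra K M) (AddMonoidAlgebra K (rootMonoid M n)) =
      Module.finrank K (AddMonoidAlgebra K (rootMonoid M n) ⧸ (monomialMaxIdeal K M • ⊤ :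
        Submodule (AddMonoidAlgebra K M) (AddMonoidAlgebra K (rootMonoid M n)))) := by
  obtain ⟨deg, hdeg⟩ := exists_degree hM hσ
  let V := supportedSubmodule K (toRoot M n) rfl Set.univ fun _ _ _ => trivial
  have hV : V = ⊤ := eq_top_iff.2 fun f _ x _ => trivial
  let e : V ≃ₗ[AddMonoidAlgebra K M] AddMonoidAlgebra K (rootMonoid M n) :=
    LinearEquiv.ofEq _ _ hV ≪≫ₗ Submodule.topEquiv
  have E := (quotientCongr (monomialMaxIdeal K M) e).restrictScalars K
  have := Module.Finite.equiv E.symm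
  -- To stay within integers, `y ∈ (1/n)M` receives the degree of `n y ∈ M`; the degrees on `M` are
  -- multiplied by `n` accordingly.
  have h := minGens_supportedSubmodule (K := K) (φ := toRoot M n) rfl Set.univ (fun _ _ _ => trivial)
    (deg := n • deg) (D := fun y => (deg (rootEquiv M hn y) : ℤ)) (D₀ := 0) (fun m x => ?_)
    (fun _ _ => by positivity) (S := AddMonoidAlgebra K M) (I := monomialMaxIdeal K M) rfl
    sub_coeff_zero_mem ?_
  · rw [← E.finrank_eq, ← h, minGens, minGens, Submodule.spanFinrank_top]
    change _ = V.spanFinrank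
    rw [hV]
  · rw [map_add, rootEquiv_toRoot, map_add, map_nsmul]
    push_cast
    rfl
  · rintro g ⟨m, hm, hg⟩
    exact ⟨(n • deg) m, Nat.mul_pos hn (hdeg m hm), mem_gradeBy_single _ hg⟩

end Degrees

section Subalgebra

lemma sub_mem_irrelevantIdeal {deg : M →+ ℕ} (hdeg : ∀ x : M, x ≠ 0 → 0 < deg x)
    {S : Subalgebra K (AddMonoidAlgebra K M)} (hS : IsGradedSubalgebra K deg S) (a : S) :
    ∃ k : K, a - algebraMap K S k ∈ irrelevantIdeal K deg S := by
  classical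
  let c : ℕ → S := fun n => ⟨_, hS a a.2 n⟩
  have hc : ∀ n, ((c n : S) : AddMonoidAlgebra K M) ∈ AddMonoidAlgebra.gradeBy K deg n :=
    fun n => (DirectSum.decompose (AddMonoidAlgebra.gradeBy K deg) (a : AddMonoidAlgebra K M) n).2
  have hsum : a = ∑ n ∈ (DirectSum.decompose (AddMonoidAlgebra.gradeBy K deg)
      (a : AddMonoidAlgebra K M)).support, c n := by
    apply Subtype.ext
    rw [AddSubmonoidClass.coe_finsetSum]
    exact (DirectSum.sum_support_decompose _ _).symm
  -- Only the monomial `1` has degree `0`, so the component of degree `0` is a constant.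
  have h0 : ∃ k : K, c 0 = algebraMap K S k := by
    refine ⟨((c 0 : S) : AddMonoidAlgebra K M).coeff 0, Subtype.ext ?_⟩
    have hs : ((c 0 : S) : AddMonoidAlgebra K M).coeff.support ⊆ {0} := by
      intro x hx
      rw [Finset.mem_singleton]
      by_contra hx0
      exact (hdeg x hx0).ne' (hc 0 x hx)
    change _ = algebraMap K (AddMonoidAlgebra K M) _
    rw [AddMonoidAlgebra.coe_algebraMap]
    apply AddMonoidAlgebra.coeff_injective
    exact Finsupp.support_subset_singleton.1 hs
  have hspan : ∀ n, ∃ k : K, c n - algebraMap K S k ∈ irrelevantIdeal K deg S := by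
    intro n
    rcases Nat.eq_zero_or_pos n with rfl | hn
    · obtain ⟨k, hk⟩ := h0
      exact ⟨k, by rw [hk, sub_self]; exact zero_mem _⟩
    · exact ⟨0, by rw [map_zero, sub_zero]; exact Ideal.subset_span ⟨n, hn, hc n⟩⟩
  choose k hk using hspan
  refine ⟨∑ n ∈ (DirectSum.decompose (AddMonoidAlgebra.gradeBy K deg)
      (a : AddMonoidAlgebra K M)).support, k n, ?_⟩
  nth_rewrite 1 [hsum]
  rw [map_sum, ← Finset.sum_sub_distrib]
  exact sum_mem fun n _ => hk n

lemma finite_quotient_map_irrelevantIdeal {deg : M →+ ℕ} (hdeg : ∀ x : M, x ≠ 0 → 0 < deg x) {S : Subalgebra K (AddMonoidAlgebra K M)}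
    (hS : IsGradedSubalgebra K deg S) [Module.Finite S (AddMonoidAlgebra K M)] : Module.Finite K (AddMonoidAlgebra K M ⧸
    (irrelevantIdeal K deg S).map (algebraMap S (AddMonoidAlgebra K M))) := by
  have := finite_quotient_of_forall_exists K (sub_mem_irrelevantIdeal hdeg hS)
  have := finite_quotient_smul_top (irrelevantIdeal K deg S) K (N := AddMonoidAlgebra K M)
  exact Module.Finite.equiv (quotientSmulTopEquiv (irrelevantIdeal K deg S) K)

/-- Nakayama over `S` gives the dimension of `𝒞_γ/𝔪_S𝒞_γ`. This quotient is unchanged when `𝔪_S` is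
replaced by its extension to `R`, and so it fits the length formula over `R`. -/
theorem minGens_conicOfCell_subalgebra (hM : IsPositiveNormalAffine M) (hσ : IsSupportForms M σ)
    {deg : M →+ ℕ} (hdeg : ∀ x : M, x ≠ 0 → 0 < deg x) {S : Subalgebra K (AddMonoidAlgebra K M)}
    (hS : IsGradedSubalgebra K deg S) [Module.Finite S (AddMonoidAlgebra K M)]
    {γ : Set (Fin d → ℝ)} (hγ : IsOpenCell σ γ) :
    minGens S (conicOfCell K M σ γ) = Module.finrank K (conicOfCell K M σ γ ⧸
      ((irrelevantIdeal K deg S).map (algebraMap S (AddMonoidAlgebra K M)) • ⊤ :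
        Submodule (AddMonoidAlgebra K M) (conicOfCell K M σ γ))) := by
  rw [← (quotientMapEquiv K (irrelevantIdeal K deg S)).finrank_eq]
  refine minGens_conicOfCell hM hσ hγ deg rfl (sub_mem_irrelevantIdeal hdeg hS) ?_
  rintro g ⟨n, hn, hg⟩
  exact ⟨n, hn, hg⟩

end Subalgebra

end ConicHK
end

/-! ### Asymptotics of weighted cell counts -/

noncomputable section
namespace ConicHK

variable {d s : ℕ} {M : AddSubmonoid (Fin d → ℤ)} {σ : Fin s → Fin d → ℤ}
  {T : Set (Set (Fin d → ℝ))}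

section Volume

lemma continuous_evalForm (a : Fin d → ℤ) : Continuous (evalForm a) :=
  continuous_finsetSum _ fun j _ => continuous_const.mul (continuous_apply j)

/-- A cell is nonempty, open and bounded. Positivity makes the leading coefficient nonzero, so that
the degree is exactly `d`. -/
lemma volume_pos (hM : IsPositiveNormalAffine M) (hσ : IsSupportForms M σ) {γ : Set (Fin d → ℝ)}
    (hγ : IsOpenCell σ γ) : 0 < volume.real γ := by
  obtain ⟨hne, z, hz⟩ := hγ
  have hopen : IsOpen γ := by
    rw [hz, Set.ofPred_forall]
    refine isOpen_iInter_of_finite fun i => ?_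
    exact (isOpen_lt continuous_const (continuous_evalForm _)).inter
      (isOpen_lt (continuous_evalForm _) continuous_const)
  obtain ⟨C, hC⟩ := exists_coordinate_bound hM hσ
  have hbdd : Bornology.IsBounded γ := by
    refine (Metric.isBounded_Icc (fun _ : Fin d => -(C * ∑ i, (|(z i : ℝ)| + 1)))
      (fun _ => (C * ∑ i, (|(z i : ℝ)| + 1)))).subset fun y hy => ?_
    rw [hz] at hy
    have h1 : ∀ k, |y k| ≤ C * ∑ i, (|(z i : ℝ)| + 1) := by
      intro k
      refine (hC y k).trans (mul_le_mul_of_nonneg_left (Finset.sum_le_sum fun i _ => ?_)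
        (Nat.cast_nonneg C))
      have := hy i
      rw [abs_le]
      constructor <;> linarith [neg_abs_le (z i : ℝ), le_abs_self (z i : ℝ)]
    exact ⟨fun k => (abs_le.1 (h1 k)).1, fun k => (abs_le.1 (h1 k)).2⟩
  exact ENNReal.toReal_pos (hopen.measure_pos volume hne).ne' hbdd.measure_lt_top.ne

lemma nonempty_of_isCellRepresentatives (hM : IsPositiveNormalAffine M) (hσ : IsSupportForms M σ)
    (hT : IsCellRepresentatives σ T) : T.Nonempty := by
  obtain ⟨γ, ⟨hγ, -⟩, -⟩ := existsUnique_representative hT (openCell_ceil_nonempty hM hσ 0)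
  exact ⟨γ, hγ⟩

end Volume

section WeightedCounts

variable (hM : IsPositiveNormalAffine M) (hσ : IsSupportForms M σ) (hT : IsCellRepresentatives σ T)
  (hfin : T.Finite) (w : Set (Fin d → ℝ) → ℕ)

/-- The weighted number of residue classes. -/
def weightedCount (σ : Fin s → Fin d → ℤ) (hfin : T.Finite) (w : Set (Fin d → ℝ) → ℕ) (n : ℕ) : ℕ :=
  ∑ γ ∈ hfin.toFinset, w γ * cellCount σ (cellBounds σ γ) n

include hM hσ hT in
theorem tendsto_weightedCount : Tendsto (fun n : ℕ => (weightedCount σ hfin w n : ℝ) / (n : ℝ) ^ d)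
    atTop (𝓝 (∑ γ ∈ hfin.toFinset, (w γ : ℝ) * volume.real γ)) := by
  simp only [weightedCount, Nat.cast_sum, Nat.cast_mul, Finset.sum_div, mul_div_assoc]
  refine tendsto_finsetSum _ fun γ hγ => Tendsto.const_mul _ ?_
  have h := tendsto_cellCount hM hσ (cellBounds σ γ)
  rwa [openCell_cellBounds (hT.isOpenCell γ (hfin.mem_toFinset.1 hγ))] at h

include hM hσ hT in
-- The limit identifies every leading coefficient with the weighted volume. As the coefficients of
-- the quasi-polynomial are rational, the weighted volume is rational as well.
theorem exists_quasiPolynomial_weightedCount : ∃ (q : QuasiPolynomial) (v a : ℚ),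
    (∀ n : ℕ, 1 ≤ n → q.value n = weightedCount σ hfin w n) ∧
    (∀ n : ℤ, (q.poly n).natDegree ≤ d ∧ (q.poly n).coeff d = v) ∧
    (∀ i : ℕ, i + 1 = d → ∀ n : ℤ, (q.poly n).coeff i = a) ∧
    (v : ℝ) = ∑ γ ∈ hfin.toFinset, (w γ : ℝ) * volume.real γ := by
  choose f hf hfc using fun z => exists_quasiPolyFun_cellCount hM hσ z
  obtain ⟨q, hq⟩ := exists_quasiPolynomial (f := ∑ γ ∈ hfin.toFinset, (w γ : ℚ) • f (cellBounds σ γ))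
    (sum_mem fun γ _ => (quasiPolyFun ℤ).smul_mem (hf _) _)
  have hval : ∀ n : ℕ, 1 ≤ n → q.value n = weightedCount σ hfin w n := by
    intro n hn
    rw [hq, Finset.sum_apply, weightedCount, Nat.cast_sum]
    refine Finset.sum_congr rfl fun γ _ => ?_
    rw [Pi.smul_apply, hfc _ n hn, smul_eq_mul, Nat.cast_mul]
  have hlim : Tendsto (fun n : ℕ => (q.value n : ℝ) / (n : ℝ) ^ d) atTop
      (𝓝 (∑ γ ∈ hfin.toFinset, (w γ : ℝ) * volume.real γ)) := by
    refine (tendsto_weightedCount hM hσ hT hfin w).congr' ?_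
    filter_upwards [eventually_ge_atTop 1] with n hn
    rw [hval n hn, Rat.cast_natCast]
  have hcoef : ∀ n, (q.poly n).natDegree ≤ d ∧ (q.poly n).coeff d = (q.poly 0).coeff d := by
    intro n
    refine ⟨(q.of_tendsto hlim n).1, ?_⟩
    have h : (((q.poly n).coeff d : ℚ) : ℝ) = ((q.poly 0).coeff d : ℚ) :=
      (q.of_tendsto hlim n).2.trans (q.of_tendsto hlim 0).2.symm
    exact_mod_cast h
  have hsecond : ∃ a : ℚ, ∀ i : ℕ, i + 1 = d → ∀ n : ℤ, (q.poly n).coeff i = a := by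
    rcases d with _ | m
    -- For `d = 0` there is no second coefficient, and the value `0` is arbitrary.
    · exact ⟨0, fun i hi => absurd hi (Nat.succ_ne_zero i)⟩
    · choose L hL using fun z => exists_tendsto_cellCount_diff hM hσ z
      refine ⟨(q.poly 0).coeff m, fun i hi n => ?_⟩
      obtain rfl := Nat.succ.inj hi
      refine q.second_coeff (fun n => (hcoef n).1) (fun n => (hcoef n).2)
        (L := ∑ γ ∈ hfin.toFinset, (w γ : ℝ) * L (cellBounds σ γ)) ?_ n
      have h := tendsto_finsetSum hfin.toFinset fun γ _ =>
        (hL (cellBounds σ γ)).const_mul (w γ : ℝ)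
      refine h.congr' ?_
      filter_upwards [eventually_ge_atTop 1] with n hn
      have h1 := hval (n + 1) (by omega)
      rw [Nat.cast_add_one] at h1
      rw [hval n hn, h1, Rat.cast_natCast, Rat.cast_natCast, weightedCount, weightedCount,
        Nat.cast_sum, Nat.cast_sum, ← Finset.sum_sub_distrib, Finset.sum_div]
      refine Finset.sum_congr rfl fun γ _ => ?_
      push_cast
      ring
  obtain ⟨a, ha⟩ := hsecond
  exact ⟨q, (q.poly 0).coeff d, a, hval, hcoef, ha, (q.of_tendsto hlim 0).2⟩

end WeightedCounts

section HilbertKunz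

variable {K : Type*} [Field K] {p : ℕ} [Fact p.Prime] [CharP K p] [PerfectRing K p]
  (hM : IsPositiveNormalAffine M) (hσ : IsSupportForms M σ) (hT : IsCellRepresentatives σ T)
  (hfin : T.Finite) (J : Ideal (AddMonoidAlgebra K M)) [Module.Finite K (AddMonoidAlgebra K M ⧸ J)]

/-- The dimension of `C_γ / J C_γ`. -/
def conicLength (σ : Fin s → Fin d → ℤ) (J : Ideal (AddMonoidAlgebra K M)) (γ : Set (Fin d → ℝ)) : ℕ :=
  Module.finrank K (conicOfCell K M σ γ ⧸
    (J • ⊤ : Submodule (AddMonoidAlgebra K M) (conicOfCell K M σ γ)))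

include hM hσ hT in
lemma sum_mul_multiplicity (w : Set (Fin d → ℝ) → ℕ) {n : ℕ} (hn : 0 < n) :
    ∑ γ ∈ hfin.toFinset, w γ * multiplicity K M σ γ n = weightedCount σ hfin w n :=
  Finset.sum_congr rfl fun γ hγ => by
    rw [multiplicity_eq hM hσ hn (hT.isOpenCell γ (hfin.mem_toFinset.1 hγ))]

include hM hσ hT in
theorem finrank_quotient_frobeniusPower_eq (e : ℕ) :
    Module.Finite K (AddMonoidAlgebra K M ⧸ frobeniusPower J (p ^ e)) ∧
    Module.finrank K (AddMonoidAlgebra K M ⧸ frobeniusPower J (p ^ e)) =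
      weightedCount σ hfin (conicLength σ J) (p ^ e) := by
  have hn : 0 < p ^ e := pow_pos (Nat.Prime.pos Fact.out) e
  obtain ⟨h1, h2⟩ := finrank_root_quotient hM hσ hT hfin J hn
  refine ⟨finite_quotient_frobeniusPower J e, ?_⟩
  rw [finrank_quotient_frobeniusPower, h2, ← sum_mul_multiplicity (K := K) hM hσ hT hfin _ hn]
  rfl


include hM hσ hT in
theorem tendsto_finrank_frobeniusPower :
    Tendsto (fun e : ℕ => (Module.finrank K (AddMonoidAlgebra K M ⧸ frobeniusPower J (p ^ e)) : ℝ) /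
      (p : ℝ) ^ (d * e)) atTop
      (𝓝 (∑ γ ∈ hfin.toFinset, (conicLength σ J γ : ℝ) * volume.real γ)) := by
  have hp : 1 < p := Nat.Prime.one_lt Fact.out
  refine ((tendsto_weightedCount hM hσ hT hfin (conicLength σ J)).comp
    (tendsto_pow_atTop_atTop_of_one_lt hp)).congr fun e => ?_
  rw [Function.comp, (finrank_quotient_frobeniusPower_eq hM hσ hT hfin J e).2, mul_comm d, pow_mul]
  push_cast
  rfl

end HilbertKunz

end ConicHK
end

noncomputable section
namespace ConicHK

variable {K : Type*} [Field K] {d s : ℕ} {M : AddSubmonoid (Fin d → ℤ)} {σ : Fin s → Fin d → ℤ}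

lemma minGens_conicOfCell_pos (hM : IsPositiveNormalAffine M) (hσ : IsSupportForms M σ)
    {γ : Set (Fin d → ℝ)} (hγ : IsOpenCell σ γ) :
    0 < minGens (AddMonoidAlgebra K M) (conicOfCell K M σ γ) := by
  have := finite_conicOfCell (K := K) hM hσ hγ
  have hfg : (conicOfCell K M σ γ).FG := Module.Finite.iff_fg.1 this
  rw [minGens, Submodule.spanFinrank_top, Nat.pos_iff_ne_zero, ne_eq,
    Submodule.spanFinrank_eq_zero_iff_eq_bot hfg]
  exact conicOfCell_ne_bot hM hσ hγ

end ConicHK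
end

/-! ### Linear algebra for the comparison of `S` with `R` -/

noncomputable section
namespace ConicHK

section LinearAlgebra

variable {K V : Type*} [Field K] [AddCommGroup V] [Module K V]

/-- The dimension of a quotient by a subspace such that all classes have representatives in a fixed
finite-dimensional subspace. -/
theorem finrank_quotient_add {A : Type*} [AddCommGroup A] [Module K A] (φ : A →ₗ[K] V)
    (hφ : Function.Injective φ) (P : Submodule K A) (W : Submodule K V) [FiniteDimensional K W]
    (h : ∀ a, ∃ b ∈ P, φ (a - b) ∈ W) :
    Module.Finite K (A ⧸ P) ∧ Module.finrank K (A ⧸ P) + Module.finrank K ↥(P.map φ ⊓ W) =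
      Module.finrank K ↥(LinearMap.range φ ⊓ W) := by
  have hrank : ∀ Q : Submodule K A, Module.finrank K (Q.map φ) = Module.finrank K Q :=
    fun Q => (Submodule.equivMapOfInjective φ hφ Q).finrank_eq.symm
  have hfin : FiniteDimensional K (W.comap φ) :=
    FiniteDimensional.of_injective (φ.restrict (p := W.comap φ) (q := W) fun _ h => h)
      fun x y hxy => Subtype.ext (hφ (congrArg Subtype.val hxy))
  -- `A/P` is the quotient of `A ∩ W` by `P ∩ W`, with `A` viewed inside `V`.
  let g : W.comap φ →ₗ[K] A ⧸ P := P.mkQ.comp (W.comap φ).subtype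
  have hg : Function.Surjective g := by
    intro q
    obtain ⟨a, rfl⟩ := P.mkQ_surjective q
    obtain ⟨b, hb, hab⟩ := h a
    refine ⟨⟨a - b, hab⟩, ?_⟩
    change P.mkQ (a - b) = P.mkQ a
    rw [map_sub, sub_eq_self]
    exact (Submodule.Quotient.mk_eq_zero P).2 hb
  refine ⟨Module.Finite.of_surjective g hg, ?_⟩
  have h1 := g.finrank_range_add_finrank_ker
  rw [LinearMap.range_eq_top.2 hg, finrank_top] at h1
  have h2 : (LinearMap.ker g).map (W.comap φ).subtype = P ⊓ W.comap φ := by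
    rw [LinearMap.ker_comp, Submodule.ker_mkQ, Submodule.map_comap_subtype, inf_comm]
  have h3 : Module.finrank K (LinearMap.ker g) = Module.finrank K ↥(P ⊓ W.comap φ) := by
    rw [← h2]
    exact (Submodule.equivMapOfInjective _ (Submodule.subtype_injective _) _).finrank_eq
  have h4 : P.map φ ⊓ W = (P ⊓ W.comap φ).map φ := by
    ext v
    constructor
    · rintro ⟨⟨a, ha, rfl⟩, hw⟩
      exact ⟨a, ⟨ha, hw⟩, rfl⟩
    · rintro ⟨a, ⟨ha, hw⟩, rfl⟩
      exact ⟨⟨a, ha, rfl⟩, hw⟩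
  rw [h4, hrank, ← h3, h1, ← Submodule.map_comap_eq, hrank]

/-- The map `m` embeds `V₂ ∩ U` into `V₁ ∩ W`, and `V₂ ∩ U` has codimension at most `dim W - dim U`
in `V₂ ∩ W`. -/
theorem finrank_inf_le {V₁ V₂ U W : Submodule K V} [FiniteDimensional K W] (hUW : U ≤ W)
    (m : V →ₗ[K] V) (hm : Function.Injective m) (hV : V₂.map m ≤ V₁) (hU : U.map m ≤ W) :
    Module.finrank K ↥(V₂ ⊓ W) + Module.finrank K U ≤
      Module.finrank K ↥(V₁ ⊓ W) + Module.finrank K W := by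
  have := Submodule.finiteDimensional_of_le hUW
  have h1 : Module.finrank K ↥(V₂ ⊓ U) ≤ Module.finrank K ↥(V₁ ⊓ W) := by
    rw [(Submodule.equivMapOfInjective m hm (V₂ ⊓ U)).finrank_eq]
    exact Submodule.finrank_mono (le_inf ((Submodule.map_mono inf_le_left).trans hV)
      ((Submodule.map_mono inf_le_right).trans hU))
  have h2 := Submodule.finrank_sup_add_finrank_inf_eq (V₂ ⊓ W) U
  have h3 : Module.finrank K ↥((V₂ ⊓ W) ⊔ U) ≤ Module.finrank K W :=
    Submodule.finrank_mono (sup_le inf_le_right hUW)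
  rw [inf_assoc, inf_eq_right.2 hUW] at h2
  omega

/-- Comparison of the dimensions of `A/P` and `B/Q` for `A ⊆ B`, `P ⊆ Q`, when an injective linear
map of bounded degree carries `B` to `A` and `Q` to `P`. -/
theorem abs_finrank_quotient_sub_le {A B : Type*} [AddCommGroup A] [Module K A] [AddCommGroup B]
    [Module K B] (φ : A →ₗ[K] V) (hφ : Function.Injective φ) (ψ : B →ₗ[K] V)
    (hψ : Function.Injective ψ) (P : Submodule K A) (Q : Submodule K B) {U W : Submodule K V}
    [FiniteDimensional K W] (hP : ∀ a, ∃ b ∈ P, φ (a - b) ∈ W)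
    (hQ : ∀ a, ∃ b ∈ Q, ψ (a - b) ∈ W) (hUW : U ≤ W) (m : V →ₗ[K] V) (hm : Function.Injective m)
    (hU : U.map m ≤ W) (hAB : LinearMap.range φ ≤ LinearMap.range ψ)
    (hBA : (LinearMap.range ψ).map m ≤ LinearMap.range φ) (hPQ : P.map φ ≤ Q.map ψ)
    (hQP : (Q.map ψ).map m ≤ P.map φ) :
    Module.Finite K (A ⧸ P) ∧
    |(Module.finrank K (A ⧸ P) : ℝ) - Module.finrank K (B ⧸ Q)| ≤
      Module.finrank K W - Module.finrank K U := by
  obtain ⟨hf, h1⟩ := finrank_quotient_add φ hφ P W hP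
  obtain ⟨-, h2⟩ := finrank_quotient_add ψ hψ Q W hQ
  have h3 := finrank_inf_le hUW m hm hBA hU
  have h4 := finrank_inf_le hUW m hm hQP hU
  have h5 : Module.finrank K ↥(LinearMap.range φ ⊓ W) ≤ Module.finrank K ↥(LinearMap.range ψ ⊓ W) :=
    Submodule.finrank_mono (inf_le_inf_right _ hAB)
  have h6 : Module.finrank K ↥(P.map φ ⊓ W) ≤ Module.finrank K ↥(Q.map ψ ⊓ W) :=
    Submodule.finrank_mono (inf_le_inf_right _ hPQ)
  have h7 : Module.finrank K (A ⧸ P) + Module.finrank K U ≤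
      Module.finrank K (B ⧸ Q) + Module.finrank K W := by omega
  have h8 : Module.finrank K (B ⧸ Q) + Module.finrank K U ≤
      Module.finrank K (A ⧸ P) + Module.finrank K W := by omega
  refine ⟨hf, abs_le.2 ⟨?_, ?_⟩⟩
  · have : ((Module.finrank K (B ⧸ Q) + Module.finrank K U : ℕ) : ℝ) ≤
      (Module.finrank K (A ⧸ P) + Module.finrank K W : ℕ) := by exact_mod_cast h8
    push_cast at this
    linarith
  · have : ((Module.finrank K (A ⧸ P) + Module.finrank K U : ℕ) : ℝ) ≤
      (Module.finrank K (B ⧸ Q) + Module.finrank K W : ℕ) := by exact_mod_cast h7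
    push_cast at this
    linarith

end LinearAlgebra

section Filtration

variable {K : Type*} [Field K] {N : Type*} [AddCommMonoid N] (deg : N →+ ℕ)

/-- The elements of degree at most `L`. -/
def degreeLE (K : Type*) [Field K] (deg : N →+ ℕ) (L : ℕ) : Submodule K (AddMonoidAlgebra K N) :=
  AddMonoidAlgebra.supported K K {x | deg x ≤ L}

variable {deg}

lemma mem_degreeLE {L : ℕ} {f : AddMonoidAlgebra K N} :
    f ∈ degreeLE K deg L ↔ ∀ x ∈ f.coeff.support, deg x ≤ L := Iff.rfl

lemma degreeLE_mono {L L' : ℕ} (h : L ≤ L') : degreeLE K deg L ≤ degreeLE K deg L' :=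
  fun _ hf x hx => (mem_degreeLE.1 hf x hx).trans h

lemma mul_mem_degreeLE {a b : ℕ} {f g : AddMonoidAlgebra K N} (hf : f ∈ degreeLE K deg a)
    (hg : g ∈ degreeLE K deg b) : f * g ∈ degreeLE K deg (a + b) := by
  classical
  intro x hx
  obtain ⟨y, hy, z, hz, rfl⟩ := Finset.mem_add.1 (AddMonoidAlgebra.support_coeff_mul_subset _ _ hx)
  rw [Set.mem_ofPred_eq, map_add]
  exact add_le_add (hf hy) (hg hz)

lemma one_mem_degreeLE : (1 : AddMonoidAlgebra K N) ∈ degreeLE K deg 0 := by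
  rw [AddMonoidAlgebra.one_def, mem_degreeLE]
  intro x hx
  rw [AddMonoidAlgebra.coeff_single] at hx
  rw [Finset.mem_singleton.1 (Finsupp.support_single_subset hx), map_zero]

lemma pow_mem_degreeLE {a : ℕ} {f : AddMonoidAlgebra K N} (hf : f ∈ degreeLE K deg a) (n : ℕ) :
    f ^ n ∈ degreeLE K deg (n * a) := by
  induction n with
  | zero => simpa using one_mem_degreeLE
  | succ n ih =>
    rw [pow_succ, Nat.succ_mul]
    exact mul_mem_degreeLE ih hf

lemma exists_mem_degreeLE (f : AddMonoidAlgebra K N) : ∃ L, f ∈ degreeLE K deg L :=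
  ⟨∑ x ∈ f.coeff.support, deg x, fun _ hx =>
    Finset.single_le_sum (f := fun x => deg x) (fun _ _ => Nat.zero_le _) hx⟩

lemma exists_forall_mem_degreeLE {ι : Type*} [Finite ι] (f : ι → AddMonoidAlgebra K N) :
    ∃ L, ∀ i, f i ∈ degreeLE K deg L := by
  have := Fintype.ofFinite ι
  choose L hL using fun i => exists_mem_degreeLE (deg := deg) (f i)
  exact ⟨∑ i, L i, fun i => degreeLE_mono
    (Finset.single_le_sum (f := L) (fun _ _ => Nat.zero_le _) (Finset.mem_univ i)) (hL i)⟩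

lemma finiteDimensional_degreeLE {L : ℕ} (h : {x | deg x ≤ L}.Finite) :
    FiniteDimensional K (degreeLE K deg L) := by
  have := h.to_subtype
  exact Module.Finite.equiv (AddMonoidAlgebra.supportedEquivFinsupp (R := K) (S := K)
    {x | deg x ≤ L}).symm

lemma finrank_degreeLE {L : ℕ} (h : {x | deg x ≤ L}.Finite) :
    Module.finrank K (degreeLE K deg L) = {x | deg x ≤ L}.ncard := by
  have := h.fintype
  rw [degreeLE, LinearEquiv.finrank_eq (AddMonoidAlgebra.supportedEquivFinsupp (R := K) (S := K)
    {x | deg x ≤ L}), Module.finrank_finsupp_self, ← Nat.card_eq_fintype_card]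
  rfl

end Filtration

end ConicHK
end

/-! ### Representatives of bounded degree and the conductor -/

noncomputable section
namespace ConicHK

section Generators

/-- An algebra `S = K + I` of finite type is generated by finitely many elements of `I`. -/
theorem exists_generators {K S : Type*} [Field K] [CommRing S] [Algebra K S]
    [Algebra.FiniteType K S] {I : Ideal S} (hS : ∀ a : S, ∃ k : K, a - algebraMap K S k ∈ I) :
    ∃ (n : ℕ) (f : Fin n → S), (∀ i, f i ∈ I) ∧
      Function.Surjective (MvPolynomial.aeval (R := K) f) := by
  obtain ⟨n, g, hg⟩ := Algebra.FiniteType.iff_quotient_mvPolynomial''.1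
    (inferInstance : Algebra.FiniteType K S)
  choose k hk using fun i => hS (g (MvPolynomial.X i))
  refine ⟨n, fun i => g (MvPolynomial.X i) - algebraMap K S (k i), hk, fun a => ?_⟩
  obtain ⟨P, rfl⟩ := hg a
  refine ⟨MvPolynomial.aeval (fun i => MvPolynomial.X i + MvPolynomial.C (k i)) P, ?_⟩
  have h : (MvPolynomial.aeval (R := K) fun i => g (MvPolynomial.X i) - algebraMap K S (k i)).comp
      (MvPolynomial.aeval (R := K) fun i => MvPolynomial.X i + MvPolynomial.C (k i)) = g := by
    ext i
    simp [MvPolynomial.algHom_C]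
  exact congrArg (fun g => g P) h

variable {K : Type*} [Field K] {N : Type*} [AddCommMonoid N] {deg : N →+ ℕ}
  {S : Subalgebra K (AddMonoidAlgebra K N)}

/-- A monomial in finitely many algebra generators `f i ∈ I` lies in `I^[q]` as soon as one exponent
is at least `q`. Otherwise its degree is at most a constant times `q`. -/
theorem exists_sub_mem_degreeLE [Algebra.FiniteType K S] {I : Ideal S}
    (hS : ∀ a : S, ∃ k : K, a - algebraMap K S k ∈ I) :
    ∃ C : ℕ, ∀ q : ℕ, ∀ a : S, ∃ b ∈ frobeniusPower I q,
      ((a - b : S) : AddMonoidAlgebra K N) ∈ degreeLE K deg (C * q) := by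
  obtain ⟨n, f, hf, hsurj⟩ := exists_generators hS
  obtain ⟨B, hB⟩ := exists_forall_mem_degreeLE (deg := deg) fun i => (f i : AddMonoidAlgebra K N)
  refine ⟨n * B, fun q a => ?_⟩
  obtain ⟨P, rfl⟩ := hsurj a
  induction P using MvPolynomial.induction_on' with
  | add P Q hP hQ =>
    obtain ⟨b, hb, h⟩ := hP
    obtain ⟨b', hb', h'⟩ := hQ
    refine ⟨b + b', add_mem hb hb', ?_⟩
    rw [map_add, add_sub_add_comm]
    exact add_mem h h'
  | monomial u c =>
    rw [MvPolynomial.aeval_monomial, ← Algebra.smul_def, Finsupp.prod_fintype _ _ (by simp)]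
    by_cases hu : ∃ i, q ≤ u i
    · obtain ⟨i, hi⟩ := hu
      refine ⟨_, ?_, by rw [sub_self]; exact zero_mem _⟩
      rw [Algebra.smul_def]
      refine Ideal.mul_mem_left _ _ ?_
      rw [← Finset.mul_prod_erase _ _ (Finset.mem_univ i)]
      refine Ideal.mul_mem_right _ _ ?_
      rw [← Nat.sub_add_cancel hi, pow_add]
      exact Ideal.mul_mem_left _ _ (Ideal.subset_span ⟨f i, hf i, rfl⟩)
    · push Not at hu
      refine ⟨0, zero_mem _, ?_⟩
      rw [sub_zero]
      refine Submodule.smul_mem _ _ ?_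
      have h : ∀ t : Finset (Fin n), ((∏ i ∈ t, f i ^ u i : S) : AddMonoidAlgebra K N) ∈
          degreeLE K deg (∑ i ∈ t, u i * B) := by
        intro t
        classical
        induction t using Finset.induction_on with
        | empty => simpa using one_mem_degreeLE
        | insert i t hi ih =>
          rw [Finset.prod_insert hi, Finset.sum_insert hi]
          exact mul_mem_degreeLE (pow_mem_degreeLE (hB i) _) ih
      refine degreeLE_mono ?_ (h Finset.univ)
      calc ∑ i, u i * B ≤ ∑ _i : Fin n, q * B :=
            Finset.sum_le_sum fun i _ => Nat.mul_le_mul_right _ (hu i).le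
        _ = n * B * q := by simp; ring

/-- The analogous statement for a finite extension. -/
theorem exists_sub_mem_degreeLE_add [Module.Finite S (AddMonoidAlgebra K N)] :
    ∃ B : ℕ, ∀ (L : ℕ) (J : Ideal S),
      (∀ a : S, ∃ b ∈ J, ((a - b : S) : AddMonoidAlgebra K N) ∈ degreeLE K deg L) →
      ∀ a : AddMonoidAlgebra K N, ∃ b ∈ J.map (algebraMap S (AddMonoidAlgebra K N)),
        a - b ∈ degreeLE K deg (L + B) := by
  obtain ⟨n, g, hg⟩ := Module.Finite.exists_fin (R := S) (M := AddMonoidAlgebra K N)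
  obtain ⟨B, hB⟩ := exists_forall_mem_degreeLE (deg := deg) g
  refine ⟨B, fun L J hJ a => ?_⟩
  have ha : a ∈ Submodule.span S (Set.range g) := by rw [hg]; trivial
  obtain ⟨c, rfl⟩ := (Submodule.mem_span_range_iff_exists_fun S).1 ha
  choose b hb h using fun i => hJ (c i)
  refine ⟨∑ i, b i • g i, sum_mem fun i _ => ?_, ?_⟩
  · rw [Algebra.smul_def]
    exact Ideal.mul_mem_right _ _ (Ideal.mem_map_of_mem _ (hb i))
  · rw [← Finset.sum_sub_distrib]
    refine sum_mem fun i _ => ?_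
    rw [← sub_smul]
    exact mul_mem_degreeLE (h i) (hB i)

/-- There is a nonzerodivisor that carries the normalization of `S` into `S`. -/
theorem exists_conductor [Module.Finite S (AddMonoidAlgebra K N)] (hS : IsNormalizationOf K S) :
    ∃ c : AddMonoidAlgebra K N, (∀ a b, c * a = c * b → a = b) ∧ ∀ a, c * a ∈ S := by
  classical
  have := hS.1
  let F := FractionRing (AddMonoidAlgebra K N)
  have hinj : Function.Injective (algebraMap (AddMonoidAlgebra K N) F) := IsFractionRing.injective _ _
  obtain ⟨n, g, hg⟩ := Module.Finite.exists_fin (R := S) (M := AddMonoidAlgebra K N)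
  -- The generators of `R` as an `S`-module are fractions over `S`; their common denominator carries
  -- `R` into `S`.
  obtain ⟨b, hb⟩ := IsLocalization.exist_integer_multiples_of_finite (nonZeroDivisors S)
    fun i => algebraMap (AddMonoidAlgebra K N) F (g i)
  refine ⟨((b : S) : AddMonoidAlgebra K N), fun x y hxy => ?_, fun a => ?_⟩
  · have hu : IsUnit (algebraMap S F b) := IsLocalization.map_units F b
    have h1 : algebraMap S F b * algebraMap _ F x = algebraMap S F b * algebraMap _ F y := by
      rw [IsScalarTower.algebraMap_apply S (AddMonoidAlgebra K N) F, ← map_mul, ← map_mul]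
      exact congrArg _ hxy
    exact hinj (hu.mul_left_cancel h1)
  · have ha : a ∈ Submodule.span S (Set.range g) := by rw [hg]; trivial
    obtain ⟨c, rfl⟩ := (Submodule.mem_span_range_iff_exists_fun S).1 ha
    rw [Finset.mul_sum]
    refine sum_mem fun i _ => ?_
    obtain ⟨r, hr⟩ := hb i
    have h1 : ((b : S) : AddMonoidAlgebra K N) * g i = r := by
      apply hinj
      rw [Algebra.smul_def, IsScalarTower.algebraMap_apply S (AddMonoidAlgebra K N) F,
        IsScalarTower.algebraMap_apply S (AddMonoidAlgebra K N) F, ← map_mul] at hr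
      exact hr.symm
    rw [mul_smul_comm, h1]
    exact (c i * r).2

end Generators

end ConicHK
end

/-! ### Counting monomials by degree -/

noncomputable section
namespace ConicHK

variable {d s : ℕ} {M : AddSubmonoid (Fin d → ℤ)} {σ : Fin s → Fin d → ℤ}

section DegreeCount

/-- It holds for the generators of `M`, because the nonzero ones have degree at least `1`, and both
sides behave well under addition. -/
lemma exists_abs_le_degree (hM : IsPositiveNormalAffine M) {deg : M →+ ℕ}
    (hdeg : ∀ x : M, x ≠ 0 → 0 < deg x) :
    ∃ C : ℕ, ∀ (x : M) k, |(x : Fin d → ℤ) k| ≤ C * deg x := by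
  classical
  obtain ⟨t, ht⟩ := (AddMonoid.fg_iff_addSubmonoid_fg M).2 hM.fg
  let C : ℕ := ∑ g ∈ t, ∑ k, ((g : Fin d → ℤ) k).natAbs
  refine ⟨C, fun x => ?_⟩
  have hx : x ∈ AddSubmonoid.closure (t : Set M) := by rw [ht]; trivial
  induction hx using AddSubmonoid.closure_induction with
  | mem x hx =>
    intro k
    by_cases h0 : x = 0
    · simp [h0]
    · have h1 : ((x : Fin d → ℤ) k).natAbs ≤ C :=
        (Finset.single_le_sum (f := fun k => ((x : Fin d → ℤ) k).natAbs)
          (fun _ _ => Nat.zero_le _) (Finset.mem_univ k)).trans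
        (Finset.single_le_sum (f := fun g : M => ∑ k, ((g : Fin d → ℤ) k).natAbs)
          (fun _ _ => Nat.zero_le _) hx)
      have h2 := hdeg x h0
      have h3 : ((x : Fin d → ℤ) k).natAbs ≤ C * deg x := h1.trans (Nat.le_mul_of_pos_right _ h2)
      rw [Int.abs_eq_natAbs]
      exact_mod_cast h3
  | zero => simp
  | add x y _ _ hx hy =>
    intro k
    refine (abs_add_le ((x : Fin d → ℤ) k) _).trans ?_
    rw [map_add]
    push_cast
    linarith [hx k, hy k]

lemma finite_degree_le (hM : IsPositiveNormalAffine M) {deg : M →+ ℕ}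
    (hdeg : ∀ x : M, x ≠ 0 → 0 < deg x) (L : ℕ) : {x | deg x ≤ L}.Finite := by
  obtain ⟨C, hC⟩ := exists_abs_le_degree hM hdeg
  refine Set.Finite.of_finite_image ((Set.finite_Icc (fun _ : Fin d => -((C * L : ℕ) : ℤ))
    (fun _ => ((C * L : ℕ) : ℤ))).subset ?_) (f := fun x : M => (x : Fin d → ℤ))
    Subtype.val_injective.injOn
  rintro _ ⟨x, hx, rfl⟩
  have h : ∀ k, |(x : Fin d → ℤ) k| ≤ ((C * L : ℕ) : ℤ) := fun k => (hC x k).trans (by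
    have : C * deg x ≤ C * L := Nat.mul_le_mul_left C hx
    exact_mod_cast this)
  exact ⟨fun k => (abs_le.1 (h k)).1, fun k => (abs_le.1 (h k)).2⟩

/-- The exponents are the lattice points of the `n`-th dilation of a polytope with one facet
displaced by `b`, and bounded displacements do not affect the limit. Subtracting the results for two
values of `b` shows that a strip of fixed width contains only `o(n^d)` monomials. -/
theorem exists_tendsto_degree_count (hM : IsPositiveNormalAffine M) (hσ : IsSupportForms M σ)
    {deg : M →+ ℕ} (hdeg : ∀ x : M, x ≠ 0 → 0 < deg x) {C : ℕ} (hC : 0 < C) :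
    ∃ v : ℝ, ∀ b : ℕ, Tendsto (fun n : ℕ => ({x | deg x ≤ C * n + b}.ncard : ℝ) / (n : ℝ) ^ d)
      atTop (𝓝 v) := by
  obtain ⟨D, hD⟩ := exists_extension hM deg
  obtain ⟨B, hB⟩ := exists_abs_le_degree hM hdeg
  let ρ : Option (Fin s) → (Fin d → ℤ) →+ ℤ := fun i => i.elim D fun i => -intForm (σ i)
  let β : Option (Fin s) → ℤ := fun i => i.elim (C : ℤ) fun _ => 0
  refine ⟨volume.real {y | ∀ i, realForm (ρ i) y ≤ β i}, fun b => ?_⟩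
  let c : Option (Fin s) → ℤ := fun i => i.elim (b : ℤ) fun _ => 0
  have hmem : ∀ (n : ℕ) x, (∀ i, ρ i x ≤ n * β i + c i) ↔
      x ∈ M ∧ D x ≤ n * C + b := by
    intro n x
    rw [Option.forall, mem_monoid_iff hM hσ, and_comm]
    simp [ρ, β, c]
  have h := tendsto_card_polyhedron ρ β c (by
    rintro (_ | i)
    · exact Or.inr (by simp [β]; omega)
    · exact Or.inl (neg_ne_zero.2 (intForm_ne_zero hσ i))) (B * (C + b)) (by
    intro n hn x hx k
    obtain ⟨hxM, hx⟩ := (hmem n x).1 hx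
    have h1 := hB ⟨x, hxM⟩ k
    have h2 := hD ⟨x, hxM⟩
    change D x = _ at h2
    rw [h2] at hx
    refine h1.trans ?_
    have h3 : deg ⟨x, hxM⟩ ≤ n * C + b := by exact_mod_cast hx
    have h4 : B * deg ⟨x, hxM⟩ ≤ B * (C + b) * n := by
      rw [mul_assoc]
      refine Nat.mul_le_mul_left B (h3.trans ?_)
      nlinarith
    exact_mod_cast h4)
  · refine h.congr fun n => ?_
    congr 2
    rw [← Set.ncard_image_of_injective {x : M | deg x ≤ C * n + b} Subtype.val_injective]
    congr 1
    ext x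
    rw [Set.mem_ofPred_eq, hmem]
    constructor
    · rintro ⟨hxM, hx⟩
      have h2 := hD ⟨x, hxM⟩
      change D x = _ at h2
      refine ⟨⟨x, hxM⟩, ?_, rfl⟩
      rw [h2] at hx
      change deg ⟨x, hxM⟩ ≤ _
      rw [mul_comm]
      exact_mod_cast hx
    · rintro ⟨x, hx, rfl⟩
      refine ⟨x.2, ?_⟩
      rw [hD]
      change deg x ≤ _ at hx
      rw [mul_comm] at hx
      exact_mod_cast hx

end DegreeCount

/-! ### Passage from `S` to its normalization -/

section Normalization

variable {K : Type*} [Field K]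

theorem finiteType_subalgebra (hM : IsPositiveNormalAffine M) (S : Subalgebra K (AddMonoidAlgebra K M))
    [Module.Finite S (AddMonoidAlgebra K M)] : Algebra.FiniteType K S := by
  have : AddMonoid.FG M := (AddMonoid.fg_iff_addSubmonoid_fg M).2 hM.fg
  have h : Algebra.FiniteType K (AddMonoidAlgebra K M) := inferInstance
  exact ⟨fg_of_fg_of_fg K S (AddMonoidAlgebra K M) h.1 Module.Finite.fg_top Subtype.val_injective⟩

/-- The Hilbert-Kunz functions of `S` and of its normalization `R` agree up to `o(q^d)`. -/
theorem exists_bound_finrank_sub (hM : IsPositiveNormalAffine M) {deg : M →+ ℕ}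
    (hdeg : ∀ x : M, x ≠ 0 → 0 < deg x) {S : Subalgebra K (AddMonoidAlgebra K M)}
    (hS : IsGradedSubalgebra K deg S) [Module.Finite S (AddMonoidAlgebra K M)]
    (hnorm : IsNormalizationOf K S) :
    ∃ C B E : ℕ, 0 < C ∧ ∀ q : ℕ, Module.Finite K (S ⧸ frobeniusPower (irrelevantIdeal K deg S) q) ∧
      |(Module.finrank K (S ⧸ frobeniusPower (irrelevantIdeal K deg S) q) : ℝ) -
        Module.finrank K (AddMonoidAlgebra K M ⧸ (frobeniusPower (irrelevantIdeal K deg S) q).map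
          (algebraMap S (AddMonoidAlgebra K M)))| ≤
      ({x | deg x ≤ C * q + (B + E)}.ncard : ℝ) - {x | deg x ≤ C * q + B}.ncard := by
  have := finiteType_subalgebra hM S
  obtain ⟨C, hC⟩ := exists_sub_mem_degreeLE (deg := deg) (sub_mem_irrelevantIdeal hdeg hS)
  obtain ⟨B, hB⟩ := exists_sub_mem_degreeLE_add (deg := deg) (S := S)
  obtain ⟨c, hcinj, hcS⟩ := exists_conductor hnorm
  obtain ⟨E, hE⟩ := exists_mem_degreeLE (deg := deg) c
  -- The constant is enlarged by `1` to be positive, as the asymptotic count of degrees demands.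
  refine ⟨C + 1, B, E, Nat.succ_pos C, fun q => ?_⟩
  have hC' : ∀ a : S, ∃ b ∈ frobeniusPower (irrelevantIdeal K deg S) q,
      ((a - b : S) : AddMonoidAlgebra K M) ∈ degreeLE K deg ((C + 1) * q) := by
    intro a
    obtain ⟨b, hb, h⟩ := hC q a
    exact ⟨b, hb, degreeLE_mono (Nat.mul_le_mul_right q (Nat.le_succ C)) h⟩
  have hB' := hB _ _ hC'
  have hfinW := finite_degree_le hM hdeg ((C + 1) * q + (B + E))
  have := finiteDimensional_degreeLE (K := K) hfinW
  rw [← finrank_degreeLE (K := K) hfinW,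
    ← finrank_degreeLE (K := K) (finite_degree_le hM hdeg ((C + 1) * q + B))]
  generalize frobeniusPower (irrelevantIdeal K deg S) q = J at *
  -- The comparison takes place in `R`, for the pairs `J ⊂ S` and `JR ⊂ R`. Multiplication by `c`
  -- maps `R` to `S`, `JR` to `J`, and raises degrees by at most `E`.
  refine abs_finrank_quotient_sub_le S.val.toLinearMap Subtype.val_injective LinearMap.id
    Function.injective_id (J.restrictScalars K)
    ((J.map (algebraMap S (AddMonoidAlgebra K M))).restrictScalars K) ?_ ?_ (degreeLE_mono (by omega))
    (LinearMap.mulLeft K c) (fun a b => hcinj a b) ?_ ?_ ?_ ?_ ?_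
  · intro a
    obtain ⟨b, hb, h⟩ := hC' a
    exact ⟨b, hb, degreeLE_mono (by omega) h⟩
  · intro a
    obtain ⟨b, hb, h⟩ := hB' a
    exact ⟨b, hb, degreeLE_mono (by omega) h⟩
  · rintro _ ⟨u, hu, rfl⟩
    exact degreeLE_mono (by omega) (mul_mem_degreeLE hE hu)
  · rw [LinearMap.range_id]
    exact le_top
  · rintro _ ⟨u, -, rfl⟩
    exact ⟨⟨c * u, hcS u⟩, rfl⟩
  · rintro _ ⟨u, hu, rfl⟩
    exact ⟨u, Ideal.mem_map_of_mem _ hu, rfl⟩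
  · rintro _ ⟨_, ⟨u, hu, rfl⟩, rfl⟩
    have hu' : u ∈ J.map (algebraMap S (AddMonoidAlgebra K M)) := hu
    change c * u ∈ _
    -- The multiplier varies in this induction: if `cR ⊂ S`, then `(ca)R ⊂ S` for every `a ∈ R`, so
    -- a coefficient from `R` can be absorbed into it.
    refine Submodule.span_induction (p := fun u _ => ∀ c, (∀ a, c * a ∈ S) → c * u ∈
      (J.restrictScalars K).map S.val.toLinearMap) ?_ ?_ ?_ ?_ hu' c hcS
    · rintro _ ⟨g, hg, rfl⟩ c hc
      refine ⟨⟨c, by simpa using hc 1⟩ * g, J.mul_mem_left _ hg, rfl⟩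
    · intro c _
      rw [mul_zero]
      exact zero_mem _
    · intro x y _ _ hx hy c hc
      rw [mul_add]
      exact add_mem (hx c hc) (hy c hc)
    · intro a x _ hx c hc
      rw [smul_eq_mul, ← mul_assoc]
      exact hx (c * a) fun b => by rw [mul_assoc]; exact hc _

/-- The Hilbert-Kunz functions of `S` and of `R` with respect to `𝔪_S R` differ by `o(q^d)`, since
`𝔪_S^[q] R = (𝔪_S R)^[q]`. The limit for `R` is known for every ideal of finite colength. -/
theorem hasHKMultiplicity_subalgebra {p : ℕ} [Fact p.Prime] [CharP K p] [PerfectRing K p]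
    {T : Set (Set (Fin d → ℝ))}
    (hM : IsPositiveNormalAffine M) (hσ : IsSupportForms M σ) (hT : IsCellRepresentatives σ T)
    (hfin : T.Finite) {deg : M →+ ℕ} (hdeg : ∀ x : M, x ≠ 0 → 0 < deg x)
    {S : Subalgebra K (AddMonoidAlgebra K M)} (hS : IsGradedSubalgebra K deg S)
    [Module.Finite S (AddMonoidAlgebra K M)] (hnorm : IsNormalizationOf K S) :
    HasHKMultiplicity K p d S (irrelevantIdeal K deg S)
      (∑ γ ∈ hfin.toFinset, (conicLength σ ((irrelevantIdeal K deg S).map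
        (algebraMap S (AddMonoidAlgebra K M))) γ : ℝ) * volume.real γ) := by
  obtain ⟨C, B, E, hC, hbound⟩ := exists_bound_finrank_sub hM hdeg hS hnorm
  have := finite_quotient_map_irrelevantIdeal hdeg hS
  refine ⟨fun e => (hbound _).1, ?_⟩
  have hlim := tendsto_finrank_frobeniusPower (p := p) hM hσ hT hfin
    ((irrelevantIdeal K deg S).map (algebraMap S (AddMonoidAlgebra K M)))
  obtain ⟨v, hv⟩ := exists_tendsto_degree_count hM hσ hdeg hC
  have hp : 1 < p := Nat.Prime.one_lt Fact.out
  have hdiff := (((hv (B + E)).sub (hv B)).comp (tendsto_pow_atTop_atTop_of_one_lt hp))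
  rw [sub_self] at hdiff
  have hzero := squeeze_zero_norm (f := fun e : ℕ =>
    ((Module.finrank K (S ⧸ frobeniusPower (irrelevantIdeal K deg S) (p ^ e)) : ℝ) -
      Module.finrank K (AddMonoidAlgebra K M ⧸ frobeniusPower ((irrelevantIdeal K deg S).map
          (algebraMap S (AddMonoidAlgebra K M))) (p ^ e))) / (p : ℝ) ^ (d * e)) (fun e => ?_) hdiff
  · have h := hzero.add hlim
    rw [zero_add] at h
    refine h.congr fun e => ?_
    rw [← add_div, sub_add_cancel]
  · have hpe : (0 : ℝ) < (p : ℝ) ^ (d * e) := by positivity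
    have hpow : (((p ^ e : ℕ) : ℝ)) ^ d = (p : ℝ) ^ (d * e) := by
      rw [mul_comm, pow_mul]; push_cast; rfl
    rw [norm_div, Real.norm_eq_abs, Real.norm_of_nonneg hpe.le, Function.comp, hpow, ← sub_div,
      frobeniusPower_map]
    exact div_le_div_of_nonneg_right (hbound (p ^ e)).2 hpe.le

end Normalization

end ConicHK
end

/-! ### The main theorem -/

theorem mainTheorem2 {K : Type*} [Field K] [IsAlgClosed K] (p : ℕ) [Fact p.Prime] [CharP K p]
    {d s : ℕ} (M : AddSubmonoid (Fin d → ℤ)) (hM : ConicHK.IsPositiveNormalAffine M)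
    (σ : Fin s → Fin d → ℤ) (hσ : ConicHK.IsSupportForms M σ)
    (T : Set (Set (Fin d → ℝ))) (hT : ConicHK.IsCellRepresentatives σ T) :
    ∃ hfin : T.Finite,
      -- the Hilbert-Kunz function of `R = K[M]`
      (∀ e : ℕ, 1 ≤ e →
        Module.finrank K (AddMonoidAlgebra K M ⧸
            ConicHK.frobeniusPower (ConicHK.monomialMaxIdeal K M) (p ^ e)) =
          ConicHK.minGens (AddMonoidAlgebra K M)
            (AddMonoidAlgebra K (ConicHK.rootMonoid M (p ^ e))) ∧
        ConicHK.minGens (AddMonoidAlgebra K M)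
            (AddMonoidAlgebra K (ConicHK.rootMonoid M (p ^ e))) =
          ∑ γ ∈ hfin.toFinset,
            ConicHK.minGens (AddMonoidAlgebra K M) (ConicHK.conicOfCell K M σ γ) *
              ConicHK.multiplicity K M σ γ (p ^ e)) ∧
      -- `∑ μ_R(𝒞_γ) v_γ` is a quasi-polynomial; its two highest coefficients
      (∃ (q : ConicHK.QuasiPolynomial) (eHK a : ℚ),
        (∀ n : ℕ, 1 ≤ n →
          q.value n = ∑ γ ∈ hfin.toFinset,
            (ConicHK.minGens (AddMonoidAlgebra K M) (ConicHK.conicOfCell K M σ γ) : ℚ) *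
              ConicHK.multiplicity K M σ γ n) ∧
        (∀ n : ℤ, (q.poly n).natDegree = d ∧ (q.poly n).coeff d = eHK) ∧
        (∀ i : ℕ, i + 1 = d → ∀ n : ℤ, (q.poly n).coeff i = a) ∧
        (eHK : ℝ) = ∑ γ ∈ hfin.toFinset,
          (ConicHK.minGens (AddMonoidAlgebra K M) (ConicHK.conicOfCell K M σ γ) : ℝ) *
            volume.real γ ∧
        ConicHK.HasHKMultiplicity K p d (AddMonoidAlgebra K M) (ConicHK.monomialMaxIdeal K M)
          eHK) ∧
      -- graded subalgebras with normalization `R`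
      (∀ (deg : M →+ ℕ), (∀ x : M, x ≠ 0 → 0 < deg x) →
        ∀ S : Subalgebra K (AddMonoidAlgebra K M), ConicHK.IsGradedSubalgebra K deg S →
          Module.Finite S (AddMonoidAlgebra K M) → ConicHK.IsNormalizationOf K S →
          ∃ eHK : ℚ,
            (eHK : ℝ) = ∑ γ ∈ hfin.toFinset,
              volume.real γ * (ConicHK.minGens S (ConicHK.conicOfCell K M σ γ) : ℝ) ∧
            ConicHK.HasHKMultiplicity K p d S (ConicHK.irrelevantIdeal K deg S) eHK) := by
  have hfin := ConicHK.finite_of_isCellRepresentatives hT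
  have hR := ConicHK.finite_quotient_monomialMaxIdeal (K := K) (M := M)
  have hmin : ∀ γ ∈ hfin.toFinset, ConicHK.minGens (AddMonoidAlgebra K M)
      (ConicHK.conicOfCell K M σ γ) = ConicHK.conicLength σ (ConicHK.monomialMaxIdeal K M) γ :=
    fun γ hγ => ConicHK.minGens_conicOfCell_monomialMaxIdeal hM hσ
      (hT.isOpenCell γ (hfin.mem_toFinset.1 hγ))
  have hsum : ∀ n : ℕ, 0 < n → ∑ γ ∈ hfin.toFinset,
      ConicHK.minGens (AddMonoidAlgebra K M) (ConicHK.conicOfCell K M σ γ) *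
        ConicHK.multiplicity K M σ γ n =
      ConicHK.weightedCount σ hfin (ConicHK.conicLength σ (ConicHK.monomialMaxIdeal K M)) n := by
    intro n hn
    rw [← ConicHK.sum_mul_multiplicity (K := K) hM hσ hT hfin _ hn]
    exact Finset.sum_congr rfl fun γ hγ => by rw [hmin γ hγ]
  refine ⟨hfin, fun e _ => ?_, ?_, fun deg hdeg S hS hfinS hnorm => ?_⟩
  · have hq : 0 < p ^ e := pow_pos (Nat.Prime.pos Fact.out) e
    have h1 := ConicHK.finrank_root_quotient (K := K) hM hσ hT hfin
      (ConicHK.monomialMaxIdeal K M) hq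
    have := h1.1
    have h2 := ConicHK.finrank_quotient_frobeniusPower (p := p) (ConicHK.monomialMaxIdeal K M) e
    have h3 := ConicHK.minGens_root (K := K) hM hσ hq
    refine ⟨h2.trans h3.symm, ?_⟩
    rw [h3, h1.2]
    exact Finset.sum_congr rfl fun γ hγ => by rw [hmin γ hγ]; rfl
  · obtain ⟨q, v, a, hval, hlead, hsecond, hv⟩ := ConicHK.exists_quasiPolynomial_weightedCount
      hM hσ hT hfin (ConicHK.conicLength σ (ConicHK.monomialMaxIdeal K M))
    -- Every open cell has positive volume, every `𝒞_γ` needs a generator, and there is at least one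
    -- cell; this fixes the degree of each constituent polynomial at `d`.
    have hpos : 0 < v := by
      have h : (0 : ℝ) < v := by
        rw [hv]
        obtain ⟨γ₀, hγ₀⟩ := ConicHK.nonempty_of_isCellRepresentatives hM hσ hT
        refine Finset.sum_pos (fun γ hγ => ?_) ⟨γ₀, hfin.mem_toFinset.2 hγ₀⟩
        have hγ' := hT.isOpenCell γ (hfin.mem_toFinset.1 hγ)
        refine mul_pos ?_ (ConicHK.volume_pos hM hσ hγ')
        rw [← hmin γ hγ]
        exact_mod_cast ConicHK.minGens_conicOfCell_pos (K := K) hM hσ hγ'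
      exact_mod_cast h
    have hvol : (v : ℝ) = ∑ γ ∈ hfin.toFinset,
        (ConicHK.minGens (AddMonoidAlgebra K M) (ConicHK.conicOfCell K M σ γ) : ℝ) *
          volume.real γ :=
      hv.trans (Finset.sum_congr rfl fun γ hγ => by rw [hmin γ hγ])
    refine ⟨q, v, a, fun n hn => ?_, fun n => ⟨?_, (hlead n).2⟩, hsecond, hvol, ?_, ?_⟩
    · rw [hval n hn, ← hsum n hn]
      push_cast
      rfl
    · exact le_antisymm (hlead n).1
        (Polynomial.le_natDegree_of_ne_zero (by rw [(hlead n).2]; exact hpos.ne'))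
    · exact fun e => (ConicHK.finrank_quotient_frobeniusPower_eq hM hσ hT hfin _ e).1
    · rw [hv]
      exact ConicHK.tendsto_finrank_frobeniusPower hM hσ hT hfin _
  -- The quasi-polynomial weighted by the lengths modulo `𝔪_S R` is used only for the rationality of
  -- its leading coefficient.
  · obtain ⟨-, v, -, -, -, -, hv⟩ := ConicHK.exists_quasiPolynomial_weightedCount hM hσ hT hfin
      (ConicHK.conicLength σ ((ConicHK.irrelevantIdeal K deg S).map
        (algebraMap S (AddMonoidAlgebra K M))))
    refine ⟨v, hv.trans (Finset.sum_congr rfl fun γ hγ => ?_), ?_⟩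
    · rw [mul_comm, ConicHK.minGens_conicOfCell_subalgebra hM hσ hdeg hS
        (hT.isOpenCell γ (hfin.mem_toFinset.1 hγ))]
      rfl
    · rw [hv]
      exact ConicHK.hasHKMultiplicity_subalgebra hM hσ hT hfin hdeg hS hnorm
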